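/- **Setting.** Let $(X,W,Y)\sim P$ and let $\hat Y=f(X,W)$ for a fixed measurable prediction model $f$. Labeled points $(X_i,W_i,Y_i)$, $i\le n$, are i.i.d. from $P$; independently, $N=N_n\ge 1$ unlabeled points are i.i.d. with the law of $(X,W)$; and $n/N\to r\in[0,\infty)$ as $n\to\infty$. Let $\ell_\theta(x,y)$ be a loss that is convex in $\theta\in\Theta$ ($\Theta\subseteq\mathbb R^d$ convex, e.g. $\Theta=\mathbb R^d$), with $L(\theta)=\mathbb E[\ell_\theta(X,Y)]$ finite on $\Theta$, and let $\theta^\star$, an interior point of $\Theta$, be the unique minimizer of $L$ over $\Theta$. All gradients $\nabla$ and Hessians $\nabla^2$ are in $\theta$; write $\nabla\ell_\theta=\nabla\ell_\theta(X,Y)$ and $H=\mathbb E[\nabla^2\ell_{\theta^\star}(X,Y)]$. Every $\operatorname{argmin}_\theta$ below is over $\Theta$ and means any measurable choice of a minimizer, arbitrary when there is none. **Algorithm (cross-fitted recalibrated PPI).** Split the labeled data at random (independently of the data) into folds $\mathcal D_1,\mathcal D_2,\mathcal D_3$ whose sizes differ by at most one. For $k=1,2,3$ let $(A,B,C)$ be,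 respectively, $(\mathcal D_1,\mathcal D_2,\mathcal D_3)$, $(\mathcal D_3,\mathcal D_1,\mathcal D_2)$, $(\mathcal D_2,\mathcal D_3,\mathcal D_1)$ and do the following. 1. Put $\hat\theta_0=\operatorname{argmin}_\theta|A|^{-1}\sum_{i\in A}\ell_\theta(X_i,Y_i)$, a measurable function of $A$. 2. Apply an arbitrary measurable learning method to $\hat\theta_0$, the data in $B$ and auxiliary randomness, to obtain a function $\hat s=\hat s^{k}(x,\hat y)\in\mathbb R^d$. The split and the auxiliary randomness are jointly independent of the data. 3. Put $\hat M=\widehat{\mathrm{Cov}}(\nabla\ell_{\hat\theta_0}(X,Y),\hat s(X,\hat Y))\,\widehat{\mathrm{Cov}}(\hat s(X,\hat Y))^{-1}$, the sample covariances being taken on $C$, and $\hat g_\theta(x,\hat y)=\frac{1}{1+n/N}\theta^\top\hat M\hat s(x,\hat y)$. 4. Put $\hat\theta^k=\operatorname{argmin}_\theta\ \frac1{|C|}\sum_{i\in C}\ell_\theta(X_i,Y_i)-\Big(\frac1{|C|}\sum_{i\in C}\hat g_\theta(X_i,\hat Y_i)-\frac1N\sum_{i=n+1}^{n+N}\hat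 g_\theta(X_i,\hat Y_i)\Big)$. Finally, $\hat\theta^{\mathrm{CrossFit}}=\sum_{k=1}^3\frac{|\mathcal D_k|}{n}\hat\theta^k$. **Regularity conditions.** (i) $\ell_\theta(X,Y)$ is a.s. differentiable at $\theta^\star$ and, in a neighborhood of $\theta^\star$, a.s. $M_1(X,Y)$-Lipschitz in $\theta$ with $\mathbb E[M_1(X,Y)]<\infty$. (ii) The Hessian of $L$ at $\theta^\star$ is positive definite. (iii) $\mathbb E\|\nabla\ell_{\theta^\star}\|^2<\infty$ and $\mathrm{Cov}(\nabla\ell_{\theta^\star})$ is positive definite. (iv) In a neighborhood of $\theta^\star$, a.s., $\nabla\ell_\theta(X,Y)$ exists and is $M_3(X,Y)$-Lipschitz in $\theta$ with $\mathbb E[M_3(X,Y)]<\infty$; and $\theta\mapsto\nabla\ell_\theta(X,Y)$ is a.s. differentiable at $\theta^\star$. **Theorem.** Let $s(x,\hat y)\in\mathbb R^d$ be a fixed measurable function with $\mathbb E\|s(X,\hat Y)\|^2<\infty$ and $\mathrm{Cov}(s(X,\hat Y))$ positive definite. Suppose that for each $k$ the $L^2$ error $\mathbb E_{(X,\hat Y)}\|\hat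 s^{k}(X,\hat Y)-s(X,\hat Y)\|^2$ (the expectation is over a fresh pair $(X,\hat Y)$, with $\hat s^{k}$ held fixed) tends to $0$ in probability. Under the regularity conditions, $$\sqrt n\,(\hat\theta^{\mathrm{CrossFit}}-\theta^\star)\xrightarrow{d}\mathcal N(0,\Sigma_s),\qquad \Sigma_s=H^{-1}\big(\mathrm{Cov}(\nabla\ell_{\theta^\star})-\Delta\big)H^{-1},$$ $$\Delta=\tfrac1{1+r}\,\mathrm{Cov}(\nabla\ell_{\theta^\star},s(X,\hat Y))\,\mathrm{Cov}(s(X,\hat Y))^{-1}\,\mathrm{Cov}(s(X,\hat Y),\nabla\ell_{\theta^\star}).$$ Consequently: (a) it never has larger asymptotic variance than the XY-only estimator: $\hat\theta^{XY}=\operatorname{argmin}_\theta\frac1n\sum_{i\le n}\ell_\theta(X_i,Y_i)$ satisfies $\sqrt n(\hat\theta^{XY}-\theta^\star)\xrightarrow{d}\mathcal N(0,\Sigma^{XY})$ with $\Sigma^{XY}=H^{-1}\mathrm{Cov}(\nabla\ell_{\theta^\star})H^{-1}$, and $\Sigma_s\preceq\Sigma^{XY}$; (b) if $s(X,\hat Y)=\mathbb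 E[\nabla\ell_{\theta^\star}(X,Y)\mid X,\hat Y]$ a.s., then it attains the optimal PPI variance. For square-integrable $h(X,\hat Y)\in\mathbb R^d$ let $\Sigma_h^{\mathrm{PPI}}=H^{-1}\big(r\,\mathrm{Cov}(h)+\mathrm{Cov}(\nabla\ell_{\theta^\star}-h)\big)H^{-1}$, the asymptotic covariance of the PPI estimator with imputed loss $g_\theta$, $\nabla g_{\theta^\star}=h$. Then $$\Sigma_s=H^{-1}\big(\mathrm{Cov}(\nabla\ell_{\theta^\star})-\tfrac1{1+r}\mathrm{Cov}(s(X,\hat Y))\big)H^{-1}=\Sigma^{\mathrm{PPI}}_{s/(1+r)}\preceq\Sigma_h^{\mathrm{PPI}}\quad\text{for all such }h.$$ -/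

import Mathlib

open MeasureTheory ProbabilityTheory Filter Topology

noncomputable section

namespace RePPI

/-- The Euclidean parameter space `ℝ^d`. -/
abbrev Vec (d : ℕ) := EuclideanSpace ℝ (Fin d)

/-- A finite dataset: a sample size together with the list of its points. -/
abbrev Dataset (α : Type*) := Σ m : ℕ, (Fin m → α)

/-- The sample average of `φ` over a dataset. -/
def avg {α F : Type*} [AddCommGroup F] [Module ℝ F] (D : Dataset α) (φ : α → F) : F :=
  (D.1 : ℝ)⁻¹ • ∑ t, φ (D.2 t)

/-- `t` is a minimizer of `F` over `Θ`. -/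
def IsArgmin {E : Type*} (F : E → ℝ) (Θ : Set E) (t : E) : Prop :=
  t ∈ Θ ∧ IsMinOn F Θ t

/-- `t` is a legitimate value of `argmin_Θ F`: it is a minimizer of `F` over `Θ`, unless there is
no minimizer at all (in which case nothing is required of `t`). -/
def SelectsArgmin {E : Type*} (F : E → ℝ) (Θ : Set E) (t : E) : Prop :=
  (∃ u, IsArgmin F Θ u) → IsArgmin F Θ t

/-- The Hessian matrix of `F` at `θ`, i.e. the Jacobian matrix of the gradient of `F`. -/
def hessian {d : ℕ} (F : Vec d → ℝ) (θ : Vec d) : Matrix (Fin d) (Fin d) ℝ :=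
  Matrix.of fun i j => (fderiv ℝ (fun t => gradient F t) θ (EuclideanSpace.single j 1)) i

/-- The cross-covariance matrix `Cov(φ, ψ)` of two random vectors. -/
def crossCov {Z : Type*} [MeasurableSpace Z] {d : ℕ} (P : Measure Z) (φ ψ : Z → Vec d) :
    Matrix (Fin d) (Fin d) ℝ :=
  Matrix.of fun i j => covariance (fun z => φ z i) (fun z => ψ z j) P

/-- The sample cross-covariance matrix of `φ` and `ψ` on a dataset. -/
def sampleCov {α : Type*} {d : ℕ} (D : Dataset α) (φ ψ : α → Vec d) :
    Matrix (Fin d) (Fin d) ℝ :=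
  Matrix.of fun i j =>
    ((D.1 : ℝ) - 1)⁻¹ * ∑ t, (φ (D.2 t) i - avg D φ i) * (ψ (D.2 t) j - avg D ψ j)

section Model

variable {𝒳 𝒲 𝒴 𝒱 : Type*} {d : ℕ}

/-- From a labeled point `(x, w, y)` to the pair `(x, ŷ)`, where `ŷ = f (x, w)`. -/
def predL (f : 𝒳 × 𝒲 → 𝒱) (z : 𝒳 × 𝒲 × 𝒴) : 𝒳 × 𝒱 := (z.1, f (z.1, z.2.1))

/-- From an unlabeled point `(x, w)` to the pair `(x, ŷ)`, where `ŷ = f (x, w)`. -/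
def predU (f : 𝒳 × 𝒲 → 𝒱) (u : 𝒳 × 𝒲) : 𝒳 × 𝒱 := (u.1, f u)

/-- The loss `ℓ_θ(x, y)` at a labeled point `(x, w, y)`. -/
def pointLoss (ℓ : Vec d → 𝒳 → 𝒴 → ℝ) (θ : Vec d) (z : 𝒳 × 𝒲 × 𝒴) : ℝ := ℓ θ z.1 z.2.2

/-- The gradient in `θ` of the loss, `∇ℓ_θ(x, y)`, at a labeled point `(x, w, y)`. -/
def gradLoss (ℓ : Vec d → 𝒳 → 𝒴 → ℝ) (θ : Vec d) (z : 𝒳 × 𝒲 × 𝒴) : Vec d :=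
  gradient (fun t => ℓ t z.1 z.2.2) θ

/-- The population risk `L(θ) = E[ℓ_θ(X, Y)]`. -/
def risk [MeasurableSpace 𝒳] [MeasurableSpace 𝒲] [MeasurableSpace 𝒴]
    (P : Measure (𝒳 × 𝒲 × 𝒴)) (ℓ : Vec d → 𝒳 → 𝒴 → ℝ) (θ : Vec d) : ℝ :=
  ∫ z, pointLoss ℓ θ z ∂P

/-- The matrix `H_θ = E[∇²ℓ_θ(X, Y)]`. -/
def expHessian [MeasurableSpace 𝒳] [MeasurableSpace 𝒲] [MeasurableSpace 𝒴]
    (P : Measure (𝒳 × 𝒲 × 𝒴)) (ℓ : Vec d → 𝒳 → 𝒴 → ℝ) (θ : Vec d) :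
    Matrix (Fin d) (Fin d) ℝ :=
  Matrix.of fun i j => ∫ z, hessian (fun t => ℓ t z.1 z.2.2) θ i j ∂P

/-- `θs` is the unique minimizer over `Θ` of the (well defined) population risk, and an interior
point of `Θ`. -/
structure IsUniqueTarget [MeasurableSpace 𝒳] [MeasurableSpace 𝒲] [MeasurableSpace 𝒴]
    (P : Measure (𝒳 × 𝒲 × 𝒴)) (Θ : Set (Vec d)) (ℓ : Vec d → 𝒳 → 𝒴 → ℝ) (θs : Vec d) :
    Prop where
  integrable : ∀ θ ∈ Θ, Integrable (pointLoss (𝒲 := 𝒲) ℓ θ) P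
  mem_interior : θs ∈ interior Θ
  lt_of_ne : ∀ θ ∈ Θ, θ ≠ θs → risk P ℓ θs < risk P ℓ θ

/-- The regularity conditions on the loss. -/
structure RegularLoss [MeasurableSpace 𝒳] [MeasurableSpace 𝒲] [MeasurableSpace 𝒴]
    (P : Measure (𝒳 × 𝒲 × 𝒴)) (Θ : Set (Vec d)) (ℓ : Vec d → 𝒳 → 𝒴 → ℝ) (θs : Vec d) :
    Prop where
  /-- convexity in the parameter -/
  convexOn : ∀ x y, ConvexOn ℝ Θ (fun θ => ℓ θ x y)
  /-- almost sure differentiability at the target -/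
  differentiableAt : ∀ᵐ z ∂P, DifferentiableAt ℝ (fun θ => pointLoss ℓ θ z) θs
  /-- the loss is Lipschitz near the target, with an integrable Lipschitz constant -/
  lipschitz : ∃ U ∈ 𝓝 θs, ∃ M₁ : 𝒳 → 𝒴 → ℝ, Integrable (fun z => M₁ z.1 z.2.2) P ∧
    ∀ᵐ z ∂P, ∀ θ ∈ U, ∀ θ' ∈ U,
      |pointLoss ℓ θ z - pointLoss ℓ θ' z| ≤ M₁ z.1 z.2.2 * ‖θ - θ'‖
  /-- the Hessian of the population risk at the target is positive definite -/
  hessian_posDef : (hessian (risk P ℓ) θs).PosDef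
  /-- the gradient at the target has a finite second moment -/
  memLp_gradLoss : MemLp (gradLoss ℓ θs) 2 P
  /-- the covariance matrix of the gradient at the target is positive definite -/
  cov_posDef : (crossCov P (gradLoss ℓ θs) (gradLoss ℓ θs)).PosDef
  /-- the gradient exists and is Lipschitz near the target, with an integrable Lipschitz
  constant -/
  gradient_lipschitz : ∃ U ∈ 𝓝 θs, ∃ M₃ : 𝒳 → 𝒴 → ℝ, Integrable (fun z => M₃ z.1 z.2.2) P ∧
    ∀ᵐ z ∂P, (∀ θ ∈ U, DifferentiableAt ℝ (fun t => pointLoss ℓ t z) θ) ∧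
      ∀ θ ∈ U, ∀ θ' ∈ U, ‖gradLoss ℓ θ z - gradLoss ℓ θ' z‖ ≤ M₃ z.1 z.2.2 * ‖θ - θ'‖
  /-- the gradient is almost surely differentiable at the target -/
  gradient_differentiableAt : ∀ᵐ z ∂P, DifferentiableAt ℝ (fun θ => gradLoss ℓ θ z) θs

/-- The sampling model: the labeled points `Z i = (X_i, W_i, Y_i)` are i.i.d. with law `P`; the
unlabeled points `U j` are i.i.d. with the law of `(X, W)` under `P`; the two samples are
independent. -/
structure IsSample [MeasurableSpace 𝒳] [MeasurableSpace 𝒲] [MeasurableSpace 𝒴]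
    {Ω : Type*} [MeasurableSpace Ω] (μ : Measure Ω) (P : Measure (𝒳 × 𝒲 × 𝒴))
    (Z : ℕ → Ω → 𝒳 × 𝒲 × 𝒴) (U : ℕ → Ω → 𝒳 × 𝒲) : Prop where
  measurable_labeled : ∀ i, Measurable (Z i)
  measurable_unlabeled : ∀ j, Measurable (U j)
  law_labeled : ∀ i, μ.map (Z i) = P
  law_unlabeled : ∀ j, μ.map (U j) = P.map (fun z => (z.1, z.2.1))
  iIndep_labeled : iIndepFun Z μ
  iIndep_unlabeled : iIndepFun U μ
  indep : IndepFun (fun ω i => Z i ω) (fun ω j => U j ω) μ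

/-- The dataset of the first `n` points of a sequence. -/
def firstPoints {α : Type*} (n : ℕ) (z : ℕ → α) : Dataset α := ⟨n, fun i => z i⟩

/-- The indices assigned to fold `j` by the labels `κ`. -/
def foldIndices {n : ℕ} (κ : Fin n → Fin 3) (j : Fin 3) : Finset (Fin n) :=
  Finset.univ.filter fun i => κ i = j

/-- The dataset of fold `j`: the points carrying the label `j`, in increasing order of index. -/
def fold {α : Type*} {n : ℕ} (κ : Fin n → Fin 3) (z : ℕ → α) (j : Fin 3) : Dataset α :=
  ⟨(foldIndices κ j).card, fun t => z ((foldIndices κ j).orderEmbOfFin rfl t)⟩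

/-- The folds are even: any two fold sizes differ by at most one. -/
def EvenSplit {n : ℕ} (κ : Fin n → Fin 3) : Prop :=
  ∀ j j', (foldIndices κ j).card ≤ (foldIndices κ j').card + 1

/-- The three fold rotations `(D₁, D₂, D₃)`, `(D₃, D₁, D₂)`, `(D₂, D₃, D₁)`. In each of them the
first fold is used for the initial estimator, the second one to fit `ŝ`, and the third one for
the matrix `M̂` and the prediction-powered estimate. -/
def rotation : Fin 3 → Fin 3 × Fin 3 × Fin 3 := ![(0, 1, 2), (2, 0, 1), (1, 2, 0)]

/-- The empirical risk on a labeled dataset. -/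
def empRisk (ℓ : Vec d → 𝒳 → 𝒴 → ℝ) (D : Dataset (𝒳 × 𝒲 × 𝒴)) (θ : Vec d) : ℝ :=
  avg D (pointLoss ℓ θ)

/-- The objective function of the prediction-powered estimator with imputed loss `g`, computed
from a labeled dataset `D` and an unlabeled dataset `D'`. -/
def ppiObjective (ℓ : Vec d → 𝒳 → 𝒴 → ℝ) (f : 𝒳 × 𝒲 → 𝒱) (g : Vec d → 𝒳 × 𝒱 → ℝ)
    (D : Dataset (𝒳 × 𝒲 × 𝒴)) (D' : Dataset (𝒳 × 𝒲)) (θ : Vec d) : ℝ :=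
  empRisk ℓ D θ - (avg D (fun z => g θ (predL f z)) - avg D' (fun u => g θ (predU f u)))

/-- The matrix `M̂ = Ĉov(∇ℓ_{θ₀}, ŝ) Ĉov(ŝ)⁻¹`, computed on the dataset `D`. -/
def tuningMatrix (ℓ : Vec d → 𝒳 → 𝒴 → ℝ) (f : 𝒳 × 𝒲 → 𝒱) (D : Dataset (𝒳 × 𝒲 × 𝒴))
    (θ₀ : Vec d) (shat : 𝒳 × 𝒱 → Vec d) : Matrix (Fin d) (Fin d) ℝ :=
  sampleCov D (gradLoss ℓ θ₀) (fun z => shat (predL f z)) *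
    (sampleCov D (fun z => shat (predL f z)) (fun z => shat (predL f z)))⁻¹

/-- The linear imputed loss `c θᵀ M ŝ(x, ŷ)`. -/
def linearImputedLoss (c : ℝ) (M : Matrix (Fin d) (Fin d) ℝ) (shat : 𝒳 × 𝒱 → Vec d)
    (θ : Vec d) (v : 𝒳 × 𝒱) : ℝ :=
  c * (WithLp.ofLp θ ⬝ᵥ M.mulVec (WithLp.ofLp (shat v)))

/-- The fitted function `ŝ` of rotation `k`: the learning method `learn` is applied to the initial
estimate `init (first fold)`, to the second fold, and to the auxiliary randomness `ξ`. -/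
def fittedScore {Ξ : Type*} (init : Dataset (𝒳 × 𝒲 × 𝒴) → Vec d)
    (learn : Vec d → Dataset (𝒳 × 𝒲 × 𝒴) → Ξ → 𝒳 × 𝒱 → Vec d)
    (folds : Fin 3 → Dataset (𝒳 × 𝒲 × 𝒴)) (k : Fin 3) (ξ : Ξ) : 𝒳 × 𝒱 → Vec d :=
  learn (init (folds (rotation k).1)) (folds (rotation k).2.1) ξ

/-- The objective function that is minimized in rotation `k`, with the imputed loss
`θ ↦ (1 + n/N)⁻¹ θᵀ M̂ ŝ`; here `n` is the size of the whole labeled dataset and `N` the size of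
the unlabeled dataset `D'`. -/
def rotationObjective {Ξ : Type*} (ℓ : Vec d → 𝒳 → 𝒴 → ℝ) (f : 𝒳 × 𝒲 → 𝒱)
    (init : Dataset (𝒳 × 𝒲 × 𝒴) → Vec d)
    (learn : Vec d → Dataset (𝒳 × 𝒲 × 𝒴) → Ξ → 𝒳 × 𝒱 → Vec d) (n : ℕ)
    (folds : Fin 3 → Dataset (𝒳 × 𝒲 × 𝒴)) (D' : Dataset (𝒳 × 𝒲)) (k : Fin 3) (ξ : Ξ) :
    Vec d → ℝ :=
  let shat := fittedScore init learn folds k ξ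
  let D := folds (rotation k).2.2
  let M := tuningMatrix ℓ f D (init (folds (rotation k).1)) shat
  ppiObjective ℓ f (linearImputedLoss (1 / (1 + (n : ℝ) / (D'.1 : ℝ))) M shat) D D'

/-- The cross-fitted estimate `∑ₖ (|Dₖ| / n) θ̂ᵏ`. -/
def crossFit {n : ℕ} (κ : Fin n → Fin 3) (θhat : Fin 3 → Vec d) : Vec d :=
  ∑ k, (((foldIndices κ k).card : ℝ) / (n : ℝ)) • θhat k

variable [MeasurableSpace 𝒳] [MeasurableSpace 𝒲] [MeasurableSpace 𝒴]

/-- The asymptotic covariance of the prediction-powered estimator whose imputed loss has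
the gradient `h(X, Ŷ)` at the target:
`H⁻¹ (r Cov(h) + Cov(∇ℓ - h)) H⁻¹`. -/
def ppiCov (P : Measure (𝒳 × 𝒲 × 𝒴)) (ℓ : Vec d → 𝒳 → 𝒴 → ℝ) (θs : Vec d)
    (f : 𝒳 × 𝒲 → 𝒱) (r : ℝ) (h : 𝒳 × 𝒱 → Vec d) : Matrix (Fin d) (Fin d) ℝ :=
  (expHessian P ℓ θs)⁻¹ *
    (r • crossCov P (fun z => h (predL f z)) (fun z => h (predL f z)) +
      crossCov P (fun z => gradLoss ℓ θs z - h (predL f z))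
        (fun z => gradLoss ℓ θs z - h (predL f z))) *
    (expHessian P ℓ θs)⁻¹

/-- The asymptotic covariance `H⁻¹ Cov(∇ℓ) H⁻¹` of the estimator that uses the labeled data
only. -/
def xyCov (P : Measure (𝒳 × 𝒲 × 𝒴)) (ℓ : Vec d → 𝒳 → 𝒴 → ℝ) (θs : Vec d) :
    Matrix (Fin d) (Fin d) ℝ :=
  (expHessian P ℓ θs)⁻¹ * crossCov P (gradLoss ℓ θs) (gradLoss ℓ θs) * (expHessian P ℓ θs)⁻¹

/-- The variance reduction `Δ = (1 + r)⁻¹ Cov(∇ℓ, s) Cov(s)⁻¹ Cov(s, ∇ℓ)`. -/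
def reduction (P : Measure (𝒳 × 𝒲 × 𝒴)) (ℓ : Vec d → 𝒳 → 𝒴 → ℝ) (θs : Vec d)
    (f : 𝒳 × 𝒲 → 𝒱) (r : ℝ) (s : 𝒳 × 𝒱 → Vec d) : Matrix (Fin d) (Fin d) ℝ :=
  (1 / (1 + r)) •
    (crossCov P (gradLoss ℓ θs) (fun z => s (predL f z)) *
      (crossCov P (fun z => s (predL f z)) (fun z => s (predL f z)))⁻¹ *
      crossCov P (fun z => s (predL f z)) (gradLoss ℓ θs))

/-- The asymptotic covariance `H⁻¹ (Cov(∇ℓ) - Δ) H⁻¹` of the recalibrated estimator. -/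
def reppiCov (P : Measure (𝒳 × 𝒲 × 𝒴)) (ℓ : Vec d → 𝒳 → 𝒴 → ℝ) (θs : Vec d)
    (f : 𝒳 × 𝒲 → 𝒱) (r : ℝ) (s : 𝒳 × 𝒱 → Vec d) : Matrix (Fin d) (Fin d) ℝ :=
  (expHessian P ℓ θs)⁻¹ *
    (crossCov P (gradLoss ℓ θs) (gradLoss ℓ θs) - reduction P ℓ θs f r s) *
    (expHessian P ℓ θs)⁻¹

end Model

/-- `√n (T n - θs)` converges in distribution to the centered Gaussian law with covariance
matrix `S` (a genuine covariance matrix). -/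
def AsymptoticallyNormal {Ω : Type*} [MeasurableSpace Ω] {d : ℕ} (μ : Measure Ω)
    [IsProbabilityMeasure μ] (T : ℕ → Ω → Vec d) (θs : Vec d)
    (S : Matrix (Fin d) (Fin d) ℝ) : Prop :=
  S.PosSemidef ∧
    TendstoInDistribution (fun (n : ℕ) ω => √(n : ℝ) • (T n ω - θs)) atTop id
      (fun _ => μ) (multivariateGaussian 0 S)

end RePPI

end

open scoped ENNReal

set_option linter.unusedSectionVars false

/-! The imputed loss is linear in `θ`, so each rotation minimizes an empirical risk minus a linear
functional `⟨b, θ⟩`: convex M-estimation with a small random tilt `b = c M̂ (avg_C ŝ - avg_U ŝ)`,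
where `C` is the estimation fold and `U` the unlabeled sample. Near `θs` the gradient is `G + H (θ -
θs)` up to a small relative error, with `G = avg_C ∇ℓ - b`. Convexity then localizes every minimizer
and gives `θ̂ - θs = -H⁻¹ G + o(‖G‖)` (`argmin_of_gradient_approx`, `argmin_expansion`). These
statements are deterministic along a filter; for the filter `probFilter` of events whose probability
tends to one they become statements in probability.

It remains to replace `ŝ` and `M̂` in `b` by their limits. Cross-fitting makes `ŝ` independent of
`C` and of `U`. Given the training data, the averages of `ŝ - s` over `C` and over `U` have the same
mean, and variances of order at most `E‖ŝ - s‖² / n`, so their difference is `o_P(n^{-1/2})`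
(`tendsto_sqrt_smul_avg_sub_avg`). The difference of the averages of `s` is already `O_P(n^{-1/2})`,
so mere consistency of `M̂` suffices. There the Lipschitz constant `M₃` of the gradient is only
integrable, and the error of `θ̂₀` is absorbed by `‖θ̂₀ - θs‖ · max ‖ŝ‖ = O_P(n^{-1/2}) ·
o_P(n^{1/2})` (`tendsto_tuningMatrix`). All this is collected in `tendsto_rotation`.

The fold averages recombine to the average over the whole labeled sample, since fold weights differ
by at most `1 / n` (`tendsto_crossFit`). Up to `o_P(n^{-1/2})`, the estimation error is therefore
the labeled average of `-H⁻¹ (∇ℓ - K (s - E s))` plus the unlabeled average of `-H⁻¹ K (s - E s)`,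
with `K = Cov(∇ℓ, s) Cov(s)⁻¹ / (1 + r)`. The central limit theorem for two independent samples
applies, and the choice of `K` collapses the covariance to `Σ_s`
(`recalibrated_covariance_identity`). Claim (a) is the positivity of `Δ`; claim (b) is a completion
of the square in `h` (`ppiCov_eq_of_crossCov_eq`). -/

namespace RePPI

/-! ### Minimizers of a convex function whose gradient is nearly affine. -/

section ConvexArgmin

open Metric
open scoped InnerProductSpace

variable {d : ℕ} {F : Vec d → ℝ} {Θ : Set (Vec d)} {θs G : Vec d} {g : Vec d → Vec d}
  {A : Vec d →L[ℝ] Vec d} {δ ε lam : ℝ}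

/-- Coercivity of `A` beats both errors: `⟪A t, t⟫` is at least `lam * ‖t‖ ^ 2`, the approximation
error costs at most half of that, and `G` strictly less than the other half. So the gradient points
outward once `‖u - θs‖` exceeds `2 / lam * ‖G‖`. -/
lemma inner_gradient_pos_of_approx {u : Vec d}
    (happrox : ‖g u - G - A (u - θs)‖ ≤ ε * ‖u - θs‖)
    (hA : ∀ t, lam * ‖t‖ ^ 2 ≤ ⟪A t, t⟫_ℝ) (hε : ε ≤ lam / 2)
    (hG : ‖G‖ < lam / 2 * ‖u - θs‖) :
    0 < ⟪g u, u - θs⟫_ℝ := by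
  set t := u - θs with ht
  have hpos : 0 < ‖t‖ := by
    by_contra h
    have h0 : ‖t‖ = 0 := le_antisymm (not_lt.1 h) (norm_nonneg _)
    rw [h0, mul_zero] at hG
    exact absurd hG (not_lt.2 (norm_nonneg _))
  have h1 : ⟪g u, t⟫_ℝ = ⟪g u - G - A t, t⟫_ℝ + ⟪G, t⟫_ℝ + ⟪A t, t⟫_ℝ := by
    rw [← inner_add_left, ← inner_add_left]; congr 1; abel
  have h2 := abs_le.1 (abs_real_inner_le_norm (g u - G - A t) t)
  have h3 := abs_le.1 (abs_real_inner_le_norm G t)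
  have h4 := hA t
  have h5 : ‖g u - G - A t‖ * ‖t‖ ≤ lam / 2 * ‖t‖ * ‖t‖ :=
    mul_le_mul_of_nonneg_right (happrox.trans (mul_le_mul_of_nonneg_right hε hpos.le)) hpos.le
  have h6 : ‖G‖ * ‖t‖ < lam / 2 * ‖t‖ * ‖t‖ := mul_lt_mul_of_pos_right hG hpos
  nlinarith [h2.1, h3.1]

/-- To first order, `F` decreases when one moves from `u` towards `v`. -/
lemma not_isMinOn_segment_of_inner_pos {u v : Vec d} (hF : HasGradientAt F (g u) u)
    (hpos : 0 < ⟪g u, u - v⟫_ℝ) : ¬ IsMinOn F (segment ℝ v u) u := by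
  intro hmin
  have h := IsLocalMinOn.hasFDerivWithinAt_nonneg (y := v - u) (hmin.localize)
    (hasGradientAt_iff_hasFDerivAt.1 hF).hasFDerivWithinAt
    (mem_posTangentConeAt_of_segment_subset (by
      rw [add_sub_cancel, segment_symm]))
  rw [InnerProductSpace.toDual_apply_apply, ← neg_sub u v, inner_neg_right] at h
  linarith

lemma eq_zero_of_isMinOn_of_hasGradientAt {u : Vec d} (hF : HasGradientAt F (g u) u)
    (hu : u ∈ interior Θ) (hmin : IsMinOn F Θ u) : g u = 0 := by
  have h := (hmin.isLocalMin (mem_interior_iff_mem_nhds.1 hu)).hasFDerivAt_eq_zero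
    (hasGradientAt_iff_hasFDerivAt.1 hF)
  simpa using h

/-- If the gradient of a convex function is close to the affine map `u ↦ G + A (u - θs)` on a ball
around `θs`, then the function has a minimizer, and every minimizer is close to the zero of the
affine map. -/
theorem argmin_of_gradient_approx
    (hconv : ConvexOn ℝ Θ F) (hball : closedBall θs δ ⊆ interior Θ)
    (hF : ∀ u ∈ closedBall θs δ, HasGradientAt F (g u) u)
    (happrox : ∀ u ∈ closedBall θs δ, ‖g u - G - A (u - θs)‖ ≤ ε * ‖u - θs‖)
    (hA : ∀ t, lam * ‖t‖ ^ 2 ≤ ⟪A t, t⟫_ℝ) (hlam : 0 < lam) (hε : ε ≤ lam / 2) (hδ : 0 < δ)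
    (hG : ‖G‖ < lam / 2 * δ) :
    (∃ u, IsArgmin F Θ u) ∧ ∀ u, IsArgmin F Θ u →
      ‖u - θs‖ ≤ 2 / lam * ‖G‖ ∧ ‖G + A (u - θs)‖ ≤ ε * ‖u - θs‖ := by
  have hsub : closedBall θs δ ⊆ Θ := hball.trans interior_subset
  -- The gradient points outward on the sphere, so no point there is minimal on its own radius.
  have hsphere : ∀ u, ‖u - θs‖ = δ → ¬ IsMinOn F (segment ℝ θs u) u := by
    intro u hu
    have hu' : u ∈ closedBall θs δ := by rw [mem_closedBall_iff_norm]; exact hu.le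
    exact not_isMinOn_segment_of_inner_pos (hF u hu')
      (inner_gradient_pos_of_approx (happrox u hu') hA hε (by rwa [hu]))
  have hθs : θs ∈ closedBall θs δ := mem_closedBall_self hδ.le
  constructor
  -- A minimizer on the compact ball is off the sphere by `hsphere`, hence a local minimizer, hence
  -- a global one by convexity.
  · have hcont : ContinuousOn F (closedBall θs δ) := fun u hu =>
      (hasGradientAt_iff_hasFDerivAt.1 (hF u hu)).continuousAt.continuousWithinAt
    obtain ⟨u, hu, humin⟩ := (isCompact_closedBall θs δ).exists_isMinOn ⟨θs, hθs⟩ hcont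
    have hne : ‖u - θs‖ ≠ δ := fun h => hsphere u h
      (humin.on_subset ((convex_closedBall θs δ).segment_subset hθs hu))
    have hlt : u ∈ ball θs δ := by
      rw [mem_ball_iff_norm]; exact lt_of_le_of_ne (mem_closedBall_iff_norm.1 hu) hne
    refine ⟨u, hsub hu, IsMinOn.of_isLocalMinOn_of_convexOn (hsub hu) ?_ hconv⟩
    exact (humin.isLocalMin (mem_of_superset (isOpen_ball.mem_nhds hlt) ball_subset_closedBall)).on _
  · rintro v ⟨hvΘ, hvmin⟩
    -- If `v` were outside the ball, let `w` be the point where the segment from `θs` to `v` crosses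
    -- the sphere. For `x` on the radius of `w`, the point `w` lies between `x` and `v`, so
    -- convexity gives `F w ≤ max (F x) (F v) = F x`, against `hsphere`.
    have hvle : ‖v - θs‖ ≤ δ := by
      by_contra! hgt
      have hne : ‖v - θs‖ ≠ 0 := (hδ.trans hgt).ne'
      set w := AffineMap.lineMap (k := ℝ) θs v (δ / ‖v - θs‖) with hw
      have hw1 : w - θs = (δ / ‖v - θs‖) • (v - θs) := by
        rw [hw, AffineMap.lineMap_apply]; simp
      have hwn : ‖w - θs‖ = δ := by
        rw [hw1, norm_smul, Real.norm_of_nonneg (by positivity), div_mul_cancel₀ _ hne]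
      have hwseg : w ∈ segment ℝ θs v := by
        rw [segment_eq_image_lineMap]
        exact ⟨_, ⟨by positivity, (div_le_one (hδ.trans hgt)).2 hgt.le⟩, rfl⟩
      refine hsphere w hwn fun x hx => ?_
      have hxΘ : x ∈ Θ := hconv.1.segment_subset (hsub hθs) hvΘ
        ((convex_segment θs v).segment_subset (left_mem_segment ℝ _ _) hwseg hx)
      have hwx : w ∈ segment ℝ x v := mem_segment_iff_wbtw.2
        ((mem_segment_iff_wbtw.1 hwseg).trans_left_right (mem_segment_iff_wbtw.1 hx))
      have h1 := hconv.le_max_of_mem_segment hxΘ hvΘ hwx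
      rwa [max_eq_left (hvmin hxΘ)] at h1
    have hvb : v ∈ closedBall θs δ := mem_closedBall_iff_norm.2 hvle
    have hg0 := eq_zero_of_isMinOn_of_hasGradientAt (hF v hvb) (hball hvb) hvmin
    have h1 : ‖G + A (v - θs)‖ ≤ ε * ‖v - θs‖ := by
      have := happrox v hvb
      rwa [hg0, zero_sub, ← neg_add', norm_neg] at this
    refine ⟨?_, h1⟩
    -- Beyond this radius the gradient points outward and cannot vanish.
    by_contra! hlt
    have h2 : ‖G‖ < lam / 2 * ‖v - θs‖ := by
      have := mul_lt_mul_of_pos_left hlt (half_pos hlam)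
      have h3 : lam / 2 * (2 / lam * ‖G‖) = ‖G‖ := by field_simp
      linarith
    have h3 := inner_gradient_pos_of_approx (happrox v hvb) hA hε h2
    rw [hg0, inner_zero_left] at h3
    exact lt_irrefl _ h3

end ConvexArgmin

/-! ### Algebra and calculus of sample averages. -/

section Averages

variable {α E : Type*} [NormedAddCommGroup E] [NormedSpace ℝ E]

lemma avg_add (D : Dataset α) (φ ψ : α → E) :
    avg D (fun z => φ z + ψ z) = avg D φ + avg D ψ := by
  simp [avg, Finset.sum_add_distrib]

lemma avg_sub (D : Dataset α) (φ ψ : α → E) :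
    avg D (fun z => φ z - ψ z) = avg D φ - avg D ψ := by
  simp [avg, Finset.sum_sub_distrib, smul_sub]

lemma avg_map {E' : Type*} [NormedAddCommGroup E'] [NormedSpace ℝ E'] (D : Dataset α)
    (L : E →ₗ[ℝ] E') (φ : α → E) : avg D (fun z => L (φ z)) = L (avg D φ) := by
  simp [avg, map_sum]

lemma avg_const {D : Dataset α} (hD : 0 < D.1) (c : E) : avg D (fun _ => c) = c := by
  have : (D.1 : ℝ) ≠ 0 := by positivity
  simp [avg, ← Nat.cast_smul_eq_nsmul ℝ, smul_smul, this]

lemma avg_mono {D : Dataset α} {φ ψ : α → ℝ} (h : ∀ t, φ (D.2 t) ≤ ψ (D.2 t)) :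
    avg D φ ≤ avg D ψ := by
  unfold avg
  exact smul_le_smul_of_nonneg_left (Finset.sum_le_sum fun t _ => h t) (by positivity)

lemma avg_nonneg {D : Dataset α} {φ : α → ℝ} (h : ∀ t, 0 ≤ φ (D.2 t)) : 0 ≤ avg D φ := by
  unfold avg
  exact smul_nonneg (by positivity) (Finset.sum_nonneg fun t _ => h t)

lemma norm_avg_le (D : Dataset α) (φ : α → E) : ‖avg D φ‖ ≤ avg D (fun z => ‖φ z‖) := by
  unfold avg
  rw [norm_smul, Real.norm_of_nonneg (by positivity), smul_eq_mul]
  exact mul_le_mul_of_nonneg_left (norm_sum_le _ _) (by positivity)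

lemma avg_congr {D : Dataset α} {φ ψ : α → E} (h : ∀ t, φ (D.2 t) = ψ (D.2 t)) :
    avg D φ = avg D ψ := by
  unfold avg; congr 1; exact Finset.sum_congr rfl fun t _ => h t

/-- The Cauchy–Schwarz inequality for sample averages. -/
lemma avg_mul_sq_le (D : Dataset α) (φ ψ : α → ℝ) :
    (avg D fun z => φ z * ψ z) ^ 2 ≤ (avg D fun z => φ z ^ 2) * avg D fun z => ψ z ^ 2 := by
  simp only [avg, smul_eq_mul]
  have h := Finset.sum_mul_sq_le_sq_mul_sq Finset.univ (fun t => φ (D.2 t)) (fun t => ψ (D.2 t))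
  calc ((D.1 : ℝ)⁻¹ * ∑ t, φ (D.2 t) * ψ (D.2 t)) ^ 2
      = ((D.1 : ℝ)⁻¹) ^ 2 * (∑ t, φ (D.2 t) * ψ (D.2 t)) ^ 2 := by ring
    _ ≤ ((D.1 : ℝ)⁻¹) ^ 2 * ((∑ t, φ (D.2 t) ^ 2) * ∑ t, ψ (D.2 t) ^ 2) :=
        mul_le_mul_of_nonneg_left h (by positivity)
    _ = _ := by ring

lemma convexOn_avg {V : Type*} [AddCommGroup V] [Module ℝ V] {Θ : Set V} (hΘ : Convex ℝ Θ)
    (D : Dataset α) {φ : V → α → ℝ} (h : ∀ z, ConvexOn ℝ Θ fun θ => φ θ z) :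
    ConvexOn ℝ Θ fun θ => avg D (φ θ) := by
  unfold avg
  refine ConvexOn.smul (by positivity) ?_
  have : ∀ s : Finset (Fin D.1), ConvexOn ℝ Θ fun θ => ∑ t ∈ s, φ θ (D.2 t) := by
    classical
    intro s
    induction s using Finset.induction_on with
    | empty => simpa using convexOn_const 0 hΘ
    | insert a s ha ih => simp only [Finset.sum_insert ha]; exact (h (D.2 a)).add ih
  exact this _

lemma hasGradientAt_avg {d : ℕ} {D : Dataset α} {φ : Vec d → α → ℝ} {g : α → Vec d} {u : Vec d}
    (h : ∀ t, HasGradientAt (fun θ => φ θ (D.2 t)) (g (D.2 t)) u) :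
    HasGradientAt (fun θ => avg D (φ θ)) (avg D g) u := by
  rw [hasGradientAt_iff_hasFDerivAt]
  have h1 := (HasFDerivAt.fun_sum (u := Finset.univ)
    fun t _ => hasGradientAt_iff_hasFDerivAt.1 (h t)).const_smul ((D.1 : ℝ)⁻¹)
  convert! h1 using 1
  simp [avg, map_sum]

end Averages

end RePPI

namespace RePPI

/-! ### Measurability of derivatives in the parameter. -/

section FDerivMeasurability

variable {Z E : Type*} [MeasurableSpace Z] [NormedAddCommGroup E] [NormedSpace ℝ E] {d : ℕ}

lemma clm_eq_sum_smulRight (L : Vec d →L[ℝ] E) :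
    L = ∑ j, (EuclideanSpace.proj j : Vec d →L[ℝ] ℝ).smulRight
      (L (EuclideanSpace.single j 1)) := by
  ext t
  conv_lhs => rw [← (EuclideanSpace.basisFun (Fin d) ℝ).sum_repr t, map_sum]
  simp

/-- The derivative in the parameter is a measurable function of the point. -/
lemma aestronglyMeasurable_of_ae_hasFDerivAt {P : Measure Z} {Φ : Vec d → Z → E} {u : Vec d}
    {Φ' : Z → Vec d →L[ℝ] E} (hΦ : ∀ᶠ x in 𝓝 u, AEStronglyMeasurable (Φ x) P)
    (hd : ∀ᵐ z ∂P, HasFDerivAt (fun x => Φ x z) (Φ' z) u) : AEStronglyMeasurable Φ' P := by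
  have hcoord : ∀ v : Vec d, AEStronglyMeasurable (fun z => Φ' z v) P := by
    intro v
    have hlim : Tendsto (fun n : ℕ => u + ((n : ℝ) + 1)⁻¹ • v) atTop (𝓝 u) := by
      have h1 : Tendsto (fun n : ℕ => ((n : ℝ) + 1)⁻¹ • v) atTop (𝓝 ((0 : ℝ) • v)) :=
        Tendsto.smul_const (by simpa using tendsto_one_div_add_atTop_nhds_zero_nat (𝕜 := ℝ)) v
      simpa using h1.const_add u
    -- The derivative is a limit of difference quotients; the shift by `n₀` keeps every evaluation
    -- point where measurability is known.
    obtain ⟨n₀, hn₀⟩ := eventually_atTop.1 (hlim.eventually hΦ)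
    have hu := mem_of_mem_nhds hΦ
    refine aestronglyMeasurable_of_tendsto_ae (u := atTop)
      (f := fun (n : ℕ) z => (((n + n₀ : ℕ) : ℝ) + 1) •
        (Φ (u + (((n + n₀ : ℕ) : ℝ) + 1)⁻¹ • v) z - Φ u z)) ?_ ?_
    · intro n
      exact ((hn₀ (n + n₀) (by omega)).sub hu).const_smul _
    · filter_upwards [hd] with z hz
      have h1 : Tendsto (fun n : ℕ => (((n + n₀ : ℕ) : ℝ) + 1)) atTop atTop :=
        (tendsto_natCast_atTop_atTop.comp (tendsto_add_atTop_nat n₀)).atTop_add tendsto_const_nhds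
      exact hz.lim v (tendsto_norm_atTop_atTop.comp h1)
  have : Φ' = fun z => ∑ j, (EuclideanSpace.proj j : Vec d →L[ℝ] ℝ).smulRight
      (Φ' z (EuclideanSpace.single j 1)) := funext fun z => clm_eq_sum_smulRight _
  rw [this]
  refine Finset.aestronglyMeasurable_fun_sum _ fun j _ => ?_
  exact (ContinuousLinearMap.smulRightL ℝ (Vec d) E
    (EuclideanSpace.proj j)).continuous.comp_aestronglyMeasurable (hcoord _)

end FDerivMeasurability

/-! ### The population risk: differentiation under the integral, and linearization in mean. -/

section Population

open Metric
open scoped InnerProductSpace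

variable {𝒳 𝒲 𝒴 : Type*} [MeasurableSpace 𝒳] [MeasurableSpace 𝒲] [MeasurableSpace 𝒴] {d : ℕ}
  {P : Measure (𝒳 × 𝒲 × 𝒴)} {Θ : Set (Vec d)} {ℓ : Vec d → 𝒳 → 𝒴 → ℝ} {θs : Vec d}

/-- The derivative of the gradient of the loss. -/
noncomputable def gradJacobian (ℓ : Vec d → 𝒳 → 𝒴 → ℝ) (θ : Vec d) (z : 𝒳 × 𝒲 × 𝒴) :
    Vec d →L[ℝ] Vec d :=
  fderiv ℝ (fun t => gradLoss ℓ t z) θ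

/-- The regularity conditions, gathered on one ball around the target. -/
structure RegularOnBall (P : Measure (𝒳 × 𝒲 × 𝒴)) (Θ : Set (Vec d)) (ℓ : Vec d → 𝒳 → 𝒴 → ℝ)
    (θs : Vec d) (R : ℝ) (M₁ M₃ : 𝒳 × 𝒲 × 𝒴 → ℝ) : Prop where
  pos : 0 < R
  subset_interior : closedBall θs R ⊆ interior Θ
  integrable_loss : ∀ θ ∈ Θ, Integrable (pointLoss (𝒲 := 𝒲) ℓ θ) P
  integrable₁ : Integrable M₁ P
  integrable₃ : Integrable M₃ P
  nonneg₃ : ∀ z, 0 ≤ M₃ z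
  differentiableAt : ∀ᵐ z ∂P, ∀ u ∈ closedBall θs R, DifferentiableAt ℝ (fun t => pointLoss ℓ t z) u
  lipschitz : ∀ᵐ z ∂P, ∀ u ∈ closedBall θs R, ∀ v ∈ closedBall θs R,
    |pointLoss ℓ u z - pointLoss ℓ v z| ≤ M₁ z * ‖u - v‖
  gradient_lipschitz : ∀ᵐ z ∂P, ∀ u ∈ closedBall θs R, ∀ v ∈ closedBall θs R,
    ‖gradLoss ℓ u z - gradLoss ℓ v z‖ ≤ M₃ z * ‖u - v‖
  gradient_hasFDerivAt : ∀ᵐ z ∂P, HasFDerivAt (fun t => gradLoss ℓ t z) (gradJacobian ℓ θs z) θs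

lemma RegularLoss.exists_regularOnBall (hreg : RegularLoss P Θ ℓ θs)
    (htarget : IsUniqueTarget P Θ ℓ θs) : ∃ R M₁ M₃, RegularOnBall P Θ ℓ θs R M₁ M₃ := by
  obtain ⟨U₁, hU₁, M₁, hM₁, h₁⟩ := hreg.lipschitz
  obtain ⟨U₃, hU₃, M₃, hM₃, h₃⟩ := hreg.gradient_lipschitz
  obtain ⟨R, hR, hsub⟩ := nhds_basis_closedBall.mem_iff.1
    (inter_mem (inter_mem hU₁ hU₃) (isOpen_interior.mem_nhds htarget.mem_interior))
  refine ⟨R, fun z => M₁ z.1 z.2.2, fun z => |M₃ z.1 z.2.2|, hR, fun u hu => (hsub hu).2,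
    htarget.integrable, hM₁, hM₃.abs, fun z => abs_nonneg _, ?_, ?_, ?_, ?_⟩
  · filter_upwards [h₃] with z hz u hu using hz.1 u (hsub hu).1.2
  · filter_upwards [h₁] with z hz u hu v hv using hz u (hsub hu).1.1 v (hsub hv).1.1
  · filter_upwards [h₃] with z hz u hu v hv
    exact (hz.2 u (hsub hu).1.2 v (hsub hv).1.2).trans
      (mul_le_mul_of_nonneg_right (le_abs_self _) (norm_nonneg _))
  · filter_upwards [hreg.gradient_differentiableAt] with z hz using hz.hasFDerivAt

namespace RegularOnBall

variable {R : ℝ} {M₁ M₃ : 𝒳 × 𝒲 × 𝒴 → ℝ}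

lemma mono (h : RegularOnBall P Θ ℓ θs R M₁ M₃) {δ : ℝ} (hδ : 0 < δ) (hδR : δ ≤ R) :
    RegularOnBall P Θ ℓ θs δ M₁ M₃ := by
  have hsub := closedBall_subset_closedBall hδR (x := θs)
  refine ⟨hδ, hsub.trans h.subset_interior, h.integrable_loss, h.integrable₁, h.integrable₃,
    h.nonneg₃, ?_, ?_, ?_, h.gradient_hasFDerivAt⟩
  · filter_upwards [h.differentiableAt] with z hz u hu using hz u (hsub hu)
  · filter_upwards [h.lipschitz] with z hz u hu v hv using hz u (hsub hu) v (hsub hv)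
  · filter_upwards [h.gradient_lipschitz] with z hz u hu v hv using hz u (hsub hu) v (hsub hv)

/-- Differentiation under the integral sign, dominated by the Lipschitz constant `M₁`; integrability
of the gradient is a by-product. -/
lemma hasGradientAt (h : RegularOnBall P Θ ℓ θs R M₁ M₃) {u : Vec d} (hu : u ∈ ball θs R) :
    Integrable (gradLoss ℓ u) P ∧
      HasGradientAt (risk P ℓ) (∫ z, gradLoss ℓ u z ∂P) u := by
  have hnhds : ball θs R ∈ 𝓝 u := isOpen_ball.mem_nhds hu
  have hmeas : ∀ᶠ x in 𝓝 u, AEStronglyMeasurable (pointLoss (𝒲 := 𝒲) ℓ x) P := by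
    filter_upwards [hnhds] with x hx
    exact (h.integrable_loss x (interior_subset
      (h.subset_interior (ball_subset_closedBall hx)))).aestronglyMeasurable
  have hd : ∀ᵐ z ∂P, HasFDerivAt (fun x => pointLoss ℓ x z)
      (InnerProductSpace.toDual ℝ (Vec d) (gradLoss ℓ u z)) u := by
    filter_upwards [h.differentiableAt] with z hz
    exact hasGradientAt_iff_hasFDerivAt.1 (hz u (ball_subset_closedBall hu)).hasGradientAt
  have key := hasFDerivAt_integral_of_dominated_loc_of_lip (bound := M₁) hnhds hmeas
    (h.integrable_loss u (interior_subset (h.subset_interior (ball_subset_closedBall hu))))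
    (aestronglyMeasurable_of_ae_hasFDerivAt hmeas hd) (by
      filter_upwards [h.lipschitz] with z hz
      refine LipschitzOnWith.of_dist_le_mul fun x hx y hy => ?_
      rw [Real.dist_eq, dist_eq_norm]
      exact (hz x (ball_subset_closedBall hx) y (ball_subset_closedBall hy)).trans
        (mul_le_mul_of_nonneg_right (by simpa using le_abs_self _) (norm_nonneg _)))
    h.integrable₁ hd
  let T := (InnerProductSpace.toDual ℝ (Vec d)).symm.toContinuousLinearEquiv.toContinuousLinearMap
  have hint : Integrable (gradLoss ℓ u) P := by
    refine (ContinuousLinearMap.integrable_comp T key.1).congr (ae_of_all _ fun z => ?_)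
    exact (InnerProductSpace.toDual ℝ (Vec d)).symm_apply_apply _
  refine ⟨hint, ?_⟩
  rw [hasGradientAt_iff_hasFDerivAt]
  convert! key.2 using 1
  exact ((InnerProductSpace.toDual ℝ (Vec d)).toContinuousLinearEquiv.toContinuousLinearMap.integral_comp_comm hint).symm

lemma integral_gradLoss_eq_zero (h : RegularOnBall P Θ ℓ θs R M₁ M₃)
    (htarget : IsUniqueTarget P Θ ℓ θs) : ∫ z, gradLoss ℓ θs z ∂P = 0 := by
  have hg := (h.hasGradientAt (mem_ball_self h.pos)).2
  refine eq_zero_of_isMinOn_of_hasGradientAt (F := risk P ℓ) (Θ := Θ) 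
    (g := fun u => ∫ z, gradLoss ℓ u z ∂P) hg htarget.mem_interior fun θ hθ => ?_
  rcases eq_or_ne θ θs with rfl | hne
  · exact le_refl (risk P ℓ θ)
  · exact (htarget.lt_of_ne θ hθ hne).le

/-- The same argument one order higher, dominated by `M₃`. It identifies the Hessian of the risk
with the mean Hessian of the loss, which is how `hessian_posDef` makes `H` positive definite. -/
lemma hasFDerivAt_gradient (h : RegularOnBall P Θ ℓ θs R M₁ M₃) :
    Integrable (gradJacobian ℓ θs) P ∧
      HasFDerivAt (fun u => gradient (risk P ℓ) u) (∫ z, gradJacobian ℓ θs z ∂P) θs := by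
  have hnhds : ball θs R ∈ 𝓝 θs := ball_mem_nhds _ h.pos
  have hmeas : ∀ᶠ x in 𝓝 θs, AEStronglyMeasurable (gradLoss (𝒲 := 𝒲) ℓ x) P := by
    filter_upwards [hnhds] with x hx using (h.hasGradientAt hx).1.aestronglyMeasurable
  have key := hasFDerivAt_integral_of_dominated_loc_of_lip (bound := M₃) hnhds hmeas
    (h.hasGradientAt (mem_ball_self h.pos)).1
    (aestronglyMeasurable_of_ae_hasFDerivAt hmeas h.gradient_hasFDerivAt) (by
      filter_upwards [h.gradient_lipschitz] with z hz
      refine LipschitzOnWith.of_dist_le_mul fun x hx y hy => ?_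
      rw [dist_eq_norm, dist_eq_norm]
      exact (hz x (ball_subset_closedBall hx) y (ball_subset_closedBall hy)).trans
        (mul_le_mul_of_nonneg_right (by simpa using le_abs_self _) (norm_nonneg _)))
    h.integrable₃ h.gradient_hasFDerivAt
  refine ⟨key.1, key.2.congr_of_eventuallyEq ?_⟩
  filter_upwards [hnhds] with u hu using (h.hasGradientAt hu).2.gradient

lemma expHessian_apply (h : RegularOnBall P Θ ℓ θs R M₁ M₃) (i j : Fin d) :
    expHessian P ℓ θs i j = (∫ z, gradJacobian ℓ θs z ∂P) (EuclideanSpace.single j 1) i := by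
  have h1 : (∫ z, gradJacobian (𝒲 := 𝒲) ℓ θs z ∂P) (EuclideanSpace.single j 1) i =
      ((EuclideanSpace.proj i : Vec d →L[ℝ] ℝ).comp
        (ContinuousLinearMap.apply ℝ (Vec d) (EuclideanSpace.single j 1)))
          (∫ z, gradJacobian ℓ θs z ∂P) := rfl
  rw [h1, ← ContinuousLinearMap.integral_comp_comm _ h.hasFDerivAt_gradient.1]
  rfl

lemma hessian_risk_eq (h : RegularOnBall P Θ ℓ θs R M₁ M₃) :
    hessian (risk P ℓ) θs = expHessian P ℓ θs := by
  ext i j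
  rw [h.expHessian_apply]
  simp only [hessian, Matrix.of_apply]
  rw [h.hasFDerivAt_gradient.2.fderiv]

lemma toEuclideanCLM_expHessian (h : RegularOnBall P Θ ℓ θs R M₁ M₃) :
    Matrix.toEuclideanCLM (𝕜 := ℝ) (expHessian P ℓ θs) = ∫ z, gradJacobian ℓ θs z ∂P := by
  rw [clm_eq_sum_smulRight (Matrix.toEuclideanCLM (𝕜 := ℝ) (expHessian P ℓ θs)),
    clm_eq_sum_smulRight (∫ z, gradJacobian (𝒲 := 𝒲) ℓ θs z ∂P)]
  refine Finset.sum_congr rfl fun j _ => ?_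
  congr 1
  ext i
  rw [← h.expHessian_apply]
  simp [Matrix.mulVec_single]

/-- The gradient is approximated by its linearization at the target, with a relative error that is
small in mean. -/
lemma exists_gradient_approx [IsProbabilityMeasure P] (h : RegularOnBall P Θ ℓ θs R M₁ M₃) {ε : ℝ}
    (hε : 0 < ε) : ∃ δ, 0 < δ ∧ δ ≤ R ∧ ∃ ρ : 𝒳 × 𝒲 × 𝒴 → ℝ, Integrable ρ P ∧
      ∫ z, ρ z ∂P < ε ∧ ∀ᵐ z ∂P, ∀ u ∈ closedBall θs δ,
        ‖gradLoss ℓ u z - gradLoss ℓ θs z - gradJacobian ℓ θs z (u - θs)‖ ≤ ρ z * ‖u - θs‖ := by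
  set e := ε / 2 with he
  have he0 : 0 < e := half_pos hε
  set τ : ℕ → Vec d := TopologicalSpace.denseSeq (Vec d) with hτ
  set r : ℕ → ℝ := fun k => R / (k + 1) with hr
  have hr0 : ∀ k, 0 < r k := fun k => div_pos h.pos (by positivity)
  have hrR : ∀ k, r k ≤ R := fun k => div_le_self h.pos.le (by simp)
  set rem : Vec d → 𝒳 × 𝒲 × 𝒴 → ℝ := fun t z =>
    ‖gradLoss ℓ (θs + t) z - gradLoss ℓ θs z - gradJacobian ℓ θs z t‖ with hrem
  -- `S k` asks for the linearization bound only along countably many dense displacements, so that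
  -- it is measurable up to null sets; continuity recovers all displacements below.
  set S : ℕ → Set (𝒳 × 𝒲 × 𝒴) := fun k => {z | ∀ j, ‖τ j‖ < r k → rem (τ j) z ≤ e * ‖τ j‖} with hS
  have hA := h.hasFDerivAt_gradient.1
  have hg0 := (h.hasGradientAt (mem_ball_self h.pos)).1
  have hSm : ∀ k, NullMeasurableSet (S k) P := by
    intro k
    have : S k = ⋂ j, {z | ‖τ j‖ < r k → rem (τ j) z ≤ e * ‖τ j‖} := by
      ext z; simp [S]
    rw [this]
    refine NullMeasurableSet.iInter fun j => ?_
    by_cases hj : ‖τ j‖ < r k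
    · simp only [hj, forall_const]
      refine nullMeasurableSet_le ?_ aemeasurable_const
      have h1 := (h.hasGradientAt (u := θs + τ j) (by
        rw [mem_ball_iff_norm, add_sub_cancel_left]; exact hj.trans_le (hrR k))).1
      exact ((h1.sub hg0).sub (hA.apply_continuousLinearMap (τ j))).norm.aestronglyMeasurable.aemeasurable
    · simp [hj]
  -- By differentiability at `θs`, almost every `z` lies in `S k` for all large `k`; dominated
  -- convergence applies with `2 * M₃`.
  have hlim : Tendsto (fun k => ∫ z, (S k)ᶜ.indicator (fun z => 2 * M₃ z) z ∂P) atTop (𝓝 0) := by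
    have h0 : ∫ _ : 𝒳 × 𝒲 × 𝒴, (0 : ℝ) ∂P = 0 := by simp
    rw [← h0]
    refine tendsto_integral_of_dominated_convergence (fun z => 2 * M₃ z)
      (fun k => ((h.integrable₃.const_mul 2).indicator₀ (hSm k).compl).aestronglyMeasurable)
      (h.integrable₃.const_mul 2) (fun k => ae_of_all _ fun z => ?_) ?_
    · rw [Real.norm_of_nonneg (Set.indicator_nonneg (fun z _ => by
        have := h.nonneg₃ z; positivity) _)]
      exact Set.indicator_le_self' (fun z _ => by have := h.nonneg₃ z; positivity) _
    · filter_upwards [h.gradient_hasFDerivAt] with z hz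
      obtain ⟨η, hη, hball⟩ := Metric.eventually_nhds_iff.1 (hz.isLittleO.def he0)
      have hrlim : Tendsto r atTop (𝓝 0) := by
        have := (tendsto_one_div_add_atTop_nhds_zero_nat (𝕜 := ℝ)).const_mul R
        simpa [r, div_eq_mul_inv] using this
      refine tendsto_const_nhds.congr' ?_
      filter_upwards [hrlim.eventually (gt_mem_nhds hη)] with k hk
      have hzS : z ∈ S k := by
        intro j hj
        have := @hball (θs + τ j) (by rw [dist_eq_norm, add_sub_cancel_left]; exact hj.trans hk)
        simpa [rem] using this
      simp [hzS]
  obtain ⟨k, hk⟩ := (hlim.eventually (gt_mem_nhds he0)).exists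
  have hind : Integrable ((S k)ᶜ.indicator (fun z => 2 * M₃ z)) P :=
    (h.integrable₃.const_mul 2).indicator₀ (hSm k).compl
  -- Half the radius puts the closed ball inside the open one of radius `r k`, where density
  -- applies. The bound is `e` on `S k`, plus the crude Lipschitz bound `2 * M₃` off it; its mean is
  -- below `e + e = ε`.
  refine ⟨r k / 2, half_pos (hr0 k), (half_le_self (hr0 k).le).trans (hrR k),
    fun z => e + (S k)ᶜ.indicator (fun z => 2 * M₃ z) z, (integrable_const _).add hind, ?_, ?_⟩
  · rw [integral_add (integrable_const _) hind]
    simp only [integral_const, probReal_univ, one_smul]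
    linarith
  filter_upwards [h.gradient_hasFDerivAt, h.gradient_lipschitz] with z hz hlip u hu
  have hθs : θs ∈ closedBall θs R := mem_closedBall_self h.pos.le
  by_cases hzS : z ∈ S k
  · simp only [Set.mem_compl_iff, hzS, not_true_eq_false, not_false_eq_true,
      Set.indicator_of_notMem, add_zero]
    set B : Set (Vec d) := ball 0 (r k) with hB
    have hut : u - θs ∈ B := by
      rw [mem_ball_zero_iff]
      exact (mem_closedBall_iff_norm.1 hu).trans_lt (half_lt_self (hr0 k))
    have hcl : u - θs ∈ closure (B ∩ Set.range τ) :=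
      (TopologicalSpace.denseRange_denseSeq (Vec d)).open_subset_closure_inter isOpen_ball hut
    have hcont : ContinuousOn (fun t => gradLoss ℓ (θs + t) z) B := by
      have h1 : ContinuousOn (fun t => gradLoss ℓ t z) (closedBall θs R) :=
        LipschitzOnWith.continuousOn (K := Real.nnabs (M₃ z)) <|
          LipschitzOnWith.of_dist_le_mul fun x hx y hy => by
            rw [dist_eq_norm, dist_eq_norm]
            exact (hlip x hx y hy).trans
              (mul_le_mul_of_nonneg_right (by simpa using le_abs_self _) (norm_nonneg _))
      refine h1.comp (f := fun t => θs + t) (by fun_prop) fun t ht => ?_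
      rw [mem_closedBall_iff_norm, add_sub_cancel_left]
      exact (mem_ball_zero_iff.1 ht).le.trans (hrR k)
    have hcw : ContinuousWithinAt (fun t => rem t z) (B ∩ Set.range τ) (u - θs) := by
      refine ContinuousWithinAt.mono ?_ Set.inter_subset_left
      exact (((hcont _ hut).sub continuousWithinAt_const).sub
        (gradJacobian ℓ θs z).continuous.continuousWithinAt).norm
    have hle := ContinuousWithinAt.closure_le (g := fun t => e * ‖t‖) hcl hcw (by fun_prop) (by
      rintro _ ⟨hyB, j, rfl⟩
      exact hzS j (mem_ball_zero_iff.1 hyB))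
    simpa [rem] using hle
  · have hb : ‖gradJacobian ℓ θs z‖ ≤ M₃ z := hz.le_of_lip' (h.nonneg₃ z) (by
      filter_upwards [closedBall_mem_nhds θs h.pos] with x hx using hlip x hx θs hθs)
    have huR : u ∈ closedBall θs R :=
      closedBall_subset_closedBall ((half_le_self (hr0 k).le).trans (hrR k)) hu
    rw [Set.indicator_of_mem (by simpa using hzS)]
    calc _ ≤ ‖gradLoss ℓ u z - gradLoss ℓ θs z‖ + ‖gradJacobian ℓ θs z (u - θs)‖ := norm_sub_le _ _
      _ ≤ M₃ z * ‖u - θs‖ + M₃ z * ‖u - θs‖ :=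
        add_le_add (hlip u huR θs hθs) ((ContinuousLinearMap.le_opNorm _ _).trans
          (mul_le_mul_of_nonneg_right hb (norm_nonneg _)))
      _ ≤ (e + 2 * M₃ z) * ‖u - θs‖ := by nlinarith [norm_nonneg (u - θs)]

end RegularOnBall

lemma exists_coercive_of_posDef {H : Matrix (Fin d) (Fin d) ℝ} (hH : H.PosDef) :
    ∃ lam, 0 < lam ∧ ∀ t : Vec d,
      lam * ‖t‖ ^ 2 ≤ ⟪Matrix.toEuclideanCLM (𝕜 := ℝ) H t, t⟫_ℝ := by
  set T := Matrix.toEuclideanCLM (𝕜 := ℝ) H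
  have hpos : ∀ t : Vec d, t ≠ 0 → 0 < ⟪T t, t⟫_ℝ := by
    intro t ht
    have := hH.dotProduct_mulVec_pos (x := WithLp.ofLp t) (by simpa using ht)
    simpa [T, EuclideanSpace.inner_eq_star_dotProduct, dotProduct_comm] using this
  -- The sphere is empty only for `d = 0`; otherwise `lam` is the minimum of the quadratic form on
  -- it.
  rcases (sphere (0 : Vec d) 1).eq_empty_or_nonempty with hempty | hne
  · refine ⟨1, one_pos, fun t => ?_⟩
    have : t = 0 := by
      by_contra ht
      have : ‖t‖⁻¹ • t ∈ sphere (0 : Vec d) 1 := by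
        simp [norm_smul, inv_mul_cancel₀ (norm_ne_zero_iff.2 ht)]
      simp [hempty] at this
    simp [this]
  · obtain ⟨v, hv, hmin⟩ := (isCompact_sphere (0 : Vec d) 1).exists_isMinOn hne
      (f := fun t => ⟪T t, t⟫_ℝ) (by fun_prop)
    have hv1 : ‖v‖ = 1 := by simpa using hv
    refine ⟨⟪T v, v⟫_ℝ, hpos v (by rintro rfl; simp at hv1), fun t => ?_⟩
    rcases eq_or_ne t 0 with rfl | ht
    · simp
    · have hn := norm_ne_zero_iff.2 ht
      have h1 : ⟪T v, v⟫_ℝ ≤ ⟪T (‖t‖⁻¹ • t), ‖t‖⁻¹ • t⟫_ℝ := hmin (by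
        simp [norm_smul, inv_mul_cancel₀ hn])
      rw [map_smul, inner_smul_left, inner_smul_right] at h1
      calc ⟪T v, v⟫_ℝ * ‖t‖ ^ 2 ≤ ((starRingEnd ℝ) ‖t‖⁻¹ * (‖t‖⁻¹ * ⟪T t, t⟫_ℝ)) * ‖t‖ ^ 2 :=
            mul_le_mul_of_nonneg_right h1 (by positivity)
        _ = ⟪T t, t⟫_ℝ := by
            simp only [conj_trivial]; field_simp

end Population

end RePPI

/-! ### Linear expansion of M-estimators along an abstract filter. -/

namespace RePPI

/-- Datasets indexed by a filter whose averages obey the law of large numbers for the law `P`. -/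
structure LawOfLargeNumbers {Z ι : Type*} [MeasurableSpace Z] (P : Measure Z) (l : Filter ι)
    (D : ι → Dataset Z) : Prop where
  ae : ∀ p : Z → Prop, (∀ᵐ z ∂P, p z) → ∀ᶠ i in l, ∀ t, p ((D i).2 t)
  tendsto_avg : ∀ φ : Z → ℝ, Integrable φ P → Tendsto (fun i => avg (D i) φ) l (𝓝 (∫ z, φ z ∂P))

section

variable {Z ι : Type*} [MeasurableSpace Z] {P : Measure Z} {l : Filter ι} {D : ι → Dataset Z}

lemma LawOfLargeNumbers.tendsto_avg_of_finiteDimensional (h : LawOfLargeNumbers P l D)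
    {E : Type*} [NormedAddCommGroup E] [NormedSpace ℝ E] [FiniteDimensional ℝ E]
    {φ : Z → E} (hφ : Integrable φ P) :
    Tendsto (fun i => avg (D i) φ) l (𝓝 (∫ z, φ z ∂P)) := by
  let b := Module.finBasis ℝ E
  have key : ∀ j, Tendsto (fun i => b.coord j (avg (D i) φ)) l (𝓝 (b.coord j (∫ z, φ z ∂P))) := by
    intro j
    let L : E →L[ℝ] ℝ := LinearMap.toContinuousLinearMap (b.coord j)
    have h1 := h.tendsto_avg (fun z => L (φ z)) (L.integrable_comp hφ)
    rw [L.integral_comp_comm hφ] at h1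
    exact h1.congr fun i => avg_map (D i) (b.coord j) φ
  have h2 : Tendsto (fun i => ∑ j, b.coord j (avg (D i) φ) • b j) l
      (𝓝 (∑ j, b.coord j (∫ z, φ z ∂P) • b j)) :=
    tendsto_finsetSum _ fun j _ => (key j).smul_const _
  simpa [Module.Basis.coord_apply, b.sum_repr] using h2

end

section GradientRemainder

variable {𝒳 𝒲 𝒴 : Type*} {d : ℕ} {ℓ : Vec d → 𝒳 → 𝒴 → ℝ} {θs : Vec d}

/-- Two errors, each at most `e` relative to `‖u - θs‖`: the averaged linearization errors of the
single losses, and the deviation of the average Jacobian from `H`. The tilt `b` does not depend on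
`u` and cancels. -/
lemma norm_avg_gradient_remainder_le {D : Dataset (𝒳 × 𝒲 × 𝒴)} {H : Vec d →L[ℝ] Vec d}
    {ρ : 𝒳 × 𝒲 × 𝒴 → ℝ} {e : ℝ} {u b : Vec d}
    (happ : ∀ t, ‖gradLoss ℓ u (D.2 t) - gradLoss ℓ θs (D.2 t) -
      gradJacobian ℓ θs (D.2 t) (u - θs)‖ ≤ ρ (D.2 t) * ‖u - θs‖)
    (hρ : avg D ρ ≤ e) (hA : ‖avg D (gradJacobian ℓ θs) - H‖ ≤ e) :
    ‖avg D (gradLoss ℓ u) - b - (avg D (gradLoss ℓ θs) - b) - H (u - θs)‖ ≤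
      (2 * e) * ‖u - θs‖ := by
  have h1 : avg D (gradLoss ℓ u) - b - (avg D (gradLoss ℓ θs) - b) - H (u - θs) =
      avg D (fun z => gradLoss ℓ u z - gradLoss ℓ θs z - gradJacobian ℓ θs z (u - θs)) +
        (avg D (gradJacobian ℓ θs) - H) (u - θs) := by
    have h2 : avg D (fun z => gradJacobian ℓ θs z (u - θs)) =
        avg D (gradJacobian ℓ θs) (u - θs) :=
      avg_map D (ContinuousLinearMap.apply ℝ (Vec d) (u - θs)).toLinearMap (gradJacobian ℓ θs)
    rw [avg_sub, avg_sub, h2, sub_apply]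
    abel
  rw [h1]
  refine (norm_add_le _ _).trans ?_
  have h3 : ‖avg D (fun z => gradLoss ℓ u z - gradLoss ℓ θs z -
      gradJacobian ℓ θs z (u - θs))‖ ≤ e * ‖u - θs‖ := by
    refine (norm_avg_le _ _).trans
      ((avg_mono (ψ := fun z => ρ z * ‖u - θs‖) happ).trans ?_)
    have : avg D (fun z => ρ z * ‖u - θs‖) = avg D ρ * ‖u - θs‖ :=
      avg_map D (LinearMap.mulRight ℝ ‖u - θs‖) ρ
    rw [this]
    exact mul_le_mul_of_nonneg_right hρ (norm_nonneg _)
  have h4 : ‖(avg D (gradJacobian ℓ θs) - H) (u - θs)‖ ≤ e * ‖u - θs‖ :=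
    (ContinuousLinearMap.le_opNorm _ _).trans (mul_le_mul_of_nonneg_right hA (norm_nonneg _))
  linarith

end GradientRemainder

section MEstimation

open Metric
open scoped InnerProductSpace

variable {𝒳 𝒲 𝒴 ι : Type*} [MeasurableSpace 𝒳] [MeasurableSpace 𝒲] [MeasurableSpace 𝒴] {d : ℕ}
  {P : Measure (𝒳 × 𝒲 × 𝒴)} {Θ : Set (Vec d)} {ℓ : Vec d → 𝒳 → 𝒴 → ℝ} {θs : Vec d}
  {l : Filter ι} {D : ι → Dataset (𝒳 × 𝒲 × 𝒴)} {b θhat : ι → Vec d}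

lemma hasGradientAt_sub_inner {F : Vec d → ℝ} {g u : Vec d} (hF : HasGradientAt F g u)
    (b : Vec d) : HasGradientAt (fun θ => F θ - ⟪b, θ⟫_ℝ) (g - b) u := by
  rw [hasGradientAt_iff_hasFDerivAt] at hF ⊢
  rw [map_sub]
  exact hF.sub (InnerProductSpace.toDual ℝ (Vec d) b).hasFDerivAt

lemma convexOn_empRisk_sub_inner [IsProbabilityMeasure P] (hreg : RegularLoss P Θ ℓ θs)
    (D : Dataset (𝒳 × 𝒲 × 𝒴)) (b : Vec d) :
    ConvexOn ℝ Θ fun θ => empRisk ℓ D θ - ⟪b, θ⟫_ℝ := by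
  -- Convexity of `Θ` is part of the convexity of the loss at any single point, and a point exists
  -- because `P` has mass one.
  have hΘ : Convex ℝ Θ := by
    have : Nonempty (𝒳 × 𝒲 × 𝒴) := nonempty_of_isProbabilityMeasure P
    obtain ⟨z⟩ := this
    exact (hreg.convexOn z.1 z.2.2).1
  exact (convexOn_avg hΘ D (φ := pointLoss ℓ) fun z => hreg.convexOn z.1 z.2.2).sub
    ((InnerProductSpace.toDual ℝ (Vec d) b).toLinearMap.concaveOn hΘ)

/-- Linear expansion of the minimizer of a linearly perturbed empirical risk. -/
theorem argmin_expansion [IsProbabilityMeasure P] (hreg : RegularLoss P Θ ℓ θs)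
    (htarget : IsUniqueTarget P Θ ℓ θs) (hD : LawOfLargeNumbers P l D) (hb : Tendsto b l (𝓝 0))
    (hθ : ∀ᶠ i in l, SelectsArgmin (fun θ => empRisk ℓ (D i) θ - ⟪b i, θ⟫_ℝ) Θ (θhat i)) :
    (fun i => (avg (D i) (gradLoss ℓ θs) - b i) +
        Matrix.toEuclideanCLM (𝕜 := ℝ) (expHessian P ℓ θs) (θhat i - θs)) =o[l]
      (fun i => avg (D i) (gradLoss ℓ θs) - b i) := by
  obtain ⟨R, M₁, M₃, hR⟩ := hreg.exists_regularOnBall htarget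
  have hAvgA : Tendsto (fun i => avg (D i) (gradJacobian ℓ θs)) l
      (𝓝 (Matrix.toEuclideanCLM (𝕜 := ℝ) (expHessian P ℓ θs))) := by
    rw [hR.toEuclideanCLM_expHessian]
    exact hD.tendsto_avg_of_finiteDimensional hR.hasFDerivAt_gradient.1
  obtain ⟨lam, hlam, hcoer⟩ := exists_coercive_of_posDef (hR.hessian_risk_eq ▸ hreg.hessian_posDef)
  generalize Matrix.toEuclideanCLM (𝕜 := ℝ) (expHessian P ℓ θs) = H at hAvgA hcoer ⊢
  have hG0 : Tendsto (fun i => avg (D i) (gradLoss ℓ θs) - b i) l (𝓝 0) := by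
    have h1 := hD.tendsto_avg_of_finiteDimensional (hR.hasGradientAt (mem_ball_self hR.pos)).1
    rw [hR.integral_gradLoss_eq_zero htarget] at h1
    simpa using h1.sub hb
  rw [Asymptotics.isLittleO_iff]
  intro c hc
  -- The first bound is what the localization of minimizers requires. The second turns the remainder
  -- `2 * e * ‖θhat i - θs‖` into `c * ‖G‖`, because `‖θhat i - θs‖ ≤ 2 / lam * ‖G‖`.
  obtain ⟨e, he0, he1, he2⟩ : ∃ e, 0 < e ∧ 2 * e ≤ lam / 2 ∧ 2 * e * (2 / lam) ≤ c := by
    refine ⟨min (lam / 4) (c * lam / 4), by positivity, ?_, ?_⟩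
    · linarith [min_le_left (lam / 4) (c * lam / 4)]
    · calc 2 * min (lam / 4) (c * lam / 4) * (2 / lam) ≤ 2 * (c * lam / 4) * (2 / lam) := by
            gcongr; exact min_le_right _ _
        _ = c := by field_simp; norm_num
  obtain ⟨δ, hδ, hδR, ρ, hρ, hρe, happ⟩ := hR.exists_gradient_approx he0
  have hRδ := hR.mono hδ hδR
  have hδ' : ‖(0 : Vec d)‖ < lam / 2 * δ := by rw [norm_zero]; positivity
  filter_upwards [hθ, hD.ae _ happ, hD.ae _ hRδ.differentiableAt,
    (hD.tendsto_avg ρ hρ).eventually (gt_mem_nhds hρe),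
    hAvgA.eventually (Metric.closedBall_mem_nhds H he0),
    hG0.norm.eventually (gt_mem_nhds hδ')] with i hθi happi hdi hρi hAi hGi
  have hgrad : ∀ u ∈ closedBall θs δ, HasGradientAt
      (fun θ => empRisk ℓ (D i) θ - ⟪b i, θ⟫_ℝ) (avg (D i) (gradLoss ℓ u) - b i) u := by
    intro u hu
    refine hasGradientAt_sub_inner (F := empRisk ℓ (D i)) ?_ (b i)
    refine hasGradientAt_avg (φ := pointLoss ℓ) (g := gradLoss ℓ u) fun t => ?_
    exact (hdi t u hu).hasGradientAt
  have happrox : ∀ u ∈ closedBall θs δ, ‖avg (D i) (gradLoss ℓ u) - b i -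
      (avg (D i) (gradLoss ℓ θs) - b i) - H (u - θs)‖ ≤ 2 * e * ‖u - θs‖ := fun u hu =>
    norm_avg_gradient_remainder_le (fun t => happi t u hu) hρi.le (mem_closedBall_iff_norm.1 hAi)
  have key := argmin_of_gradient_approx (convexOn_empRisk_sub_inner hreg (D i) (b i))
    hRδ.subset_interior hgrad happrox hcoer hlam he1 hδ hGi
  -- The existence of a minimizer, `key.1`, is what gives content to `SelectsArgmin`.
  obtain ⟨h1, h2⟩ := key.2 _ (hθi key.1)
  refine h2.trans ((mul_le_mul_of_nonneg_left h1 (by positivity)).trans ?_)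
  rw [← mul_assoc]
  exact mul_le_mul_of_nonneg_right he2 (norm_nonneg _)

end MEstimation

end RePPI

namespace RePPI

/-! ### Convergence and boundedness in probability as a filter calculus. -/

section ProbFilter

variable {Ω : Type*} [MeasurableSpace Ω] {μ : Measure Ω}

/-- The filter of the sets of pairs `(n, ω)` that contain `(n, ω)` with probability tending to one.
Convergence in probability is convergence along this filter. -/
def probFilter (μ : Measure Ω) : Filter (ℕ × Ω) where
  sets := {S | Tendsto (fun n => μ {ω | (n, ω) ∉ S}) atTop (𝓝 0)}
  univ_sets := by simp
  sets_of_superset := by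
    intro S T hS hST
    exact tendsto_of_tendsto_of_tendsto_of_le_of_le tendsto_const_nhds hS (fun _ => zero_le)
      fun n => measure_mono fun ω hω h => hω (hST h)
  inter_sets := by
    intro S T hS hT
    have h := Tendsto.add (show Tendsto _ _ _ from hS) (show Tendsto _ _ _ from hT)
    rw [add_zero] at h
    refine tendsto_of_tendsto_of_tendsto_of_le_of_le tendsto_const_nhds h (fun _ => zero_le)
      fun n => (measure_mono fun ω hω => ?_).trans (measure_union_le _ _)
    by_contra hc
    simp only [Set.mem_union, Set.mem_ofPred_eq, not_or, not_not] at hc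
    exact hω ⟨hc.1, hc.2⟩

lemma eventually_probFilter {q : ℕ × Ω → Prop} :
    (∀ᶠ p in probFilter μ, q p) ↔ Tendsto (fun n => μ {ω | ¬ q (n, ω)}) atTop (𝓝 0) := Iff.rfl

lemma tendsto_fst_probFilter : Tendsto Prod.fst (probFilter μ) atTop := by
  intro S hS
  change ∀ᶠ p in probFilter μ, p.1 ∈ S
  rw [eventually_probFilter]
  refine tendsto_const_nhds.congr' ?_
  filter_upwards [hS] with n hn
  have : n ∈ S := hn
  simp [this]

lemma eventually_probFilter_of_ae {q : ℕ × Ω → Prop} (h : ∀ n, ∀ᵐ ω ∂μ, q (n, ω)) :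
    ∀ᶠ p in probFilter μ, q p := by
  rw [eventually_probFilter]
  exact tendsto_const_nhds.congr fun n => (ae_iff.1 (h n)).symm

variable {E : Type*} [NormedAddCommGroup E] {F : Type*} [NormedAddCommGroup F]

lemma tendsto_zero_probFilter_iff {X : ℕ × Ω → E} : Tendsto X (probFilter μ) (𝓝 0) ↔
    ∀ ε : ℝ, 0 < ε → Tendsto (fun n => μ {ω | ε ≤ ‖X (n, ω)‖}) atTop (𝓝 0) := by
  rw [Metric.nhds_basis_ball.tendsto_right_iff]
  simp only [mem_ball_zero_iff, eventually_probFilter, not_lt]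

lemma tendsto_zero_probFilter_of_le {X : ℕ × Ω → E}
    (h : ∀ ε : ℝ, 0 < ε → ∀ η : ℝ≥0∞, 0 < η → ∀ᶠ n in atTop, μ {ω | ε ≤ ‖X (n, ω)‖} ≤ η) :
    Tendsto X (probFilter μ) (𝓝 0) := by
  rw [tendsto_zero_probFilter_iff]
  intro ε hε
  rw [ENNReal.tendsto_nhds_zero]
  exact fun η hη => h ε hε η hη

lemma tendstoInMeasure_of_tendsto_probFilter {X : ℕ → Ω → E}
    (h : Tendsto (fun p : ℕ × Ω => X p.1 p.2) (probFilter μ) (𝓝 0)) :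
    TendstoInMeasure μ X atTop 0 := by
  rw [tendstoInMeasure_iff_norm]
  intro ε hε
  simpa using tendsto_zero_probFilter_iff.1 h ε hε

/-- Boundedness in probability. -/
def BddInProb (μ : Measure Ω) (X : ℕ × Ω → E) : Prop :=
  ∀ η : ℝ≥0∞, 0 < η → ∃ K : ℝ, ∀ᶠ n in atTop, μ {ω | K < ‖X (n, ω)‖} ≤ η

lemma BddInProb.of_isBigO {X : ℕ × Ω → E} {Y : ℕ × Ω → F} (hX : BddInProb μ X)
    (h : Y =O[probFilter μ] X) : BddInProb μ Y := by
  intro η hη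
  obtain ⟨c, hc, hYX⟩ := h.exists_pos
  have h2 : 0 < η / 2 := ENNReal.half_pos hη.ne'
  obtain ⟨K, hK⟩ := hX (η / 2) h2
  refine ⟨c * K, ?_⟩
  filter_upwards [hK, ENNReal.tendsto_nhds_zero.1 (eventually_probFilter.1 hYX.bound) _ h2]
    with n h1 h3
  calc μ {ω | c * K < ‖Y (n, ω)‖}
      ≤ μ ({ω | K < ‖X (n, ω)‖} ∪ {ω | ¬ ‖Y (n, ω)‖ ≤ c * ‖X (n, ω)‖}) := by
        refine measure_mono fun ω hω => ?_
        by_contra hcon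
        simp only [Set.mem_union, Set.mem_ofPred_eq, not_or, not_not, not_lt] at hcon
        exact absurd (hcon.2.trans (mul_le_mul_of_nonneg_left hcon.1 hc.le)) (not_le.2 hω)
    _ ≤ η / 2 + η / 2 := (measure_union_le _ _).trans (add_le_add h1 h3)
    _ = η := ENNReal.add_halves η

/-- `o(O_P(1)) = o_P(1)`. This converts relative remainders, such as that of `argmin_expansion`,
into convergence to zero in probability. -/
lemma BddInProb.tendsto_of_isLittleO {X : ℕ × Ω → E} {Y : ℕ × Ω → F} (hX : BddInProb μ X)
    (h : Y =o[probFilter μ] X) : Tendsto Y (probFilter μ) (𝓝 0) := by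
  refine tendsto_zero_probFilter_of_le fun ε hε η hη => ?_
  have h2 : 0 < η / 2 := ENNReal.half_pos hη.ne'
  obtain ⟨K, hK⟩ := hX (η / 2) h2
  -- Where `‖X‖ ≤ |K| + 1`, this constant yields `‖Y‖ ≤ ε / 2`; the `+ 1` avoids a zero denominator.
  have hc : 0 < ε / (2 * (|K| + 1)) := by positivity
  filter_upwards [hK, ENNReal.tendsto_nhds_zero.1 (eventually_probFilter.1 (h.def hc)) _ h2]
    with n h1 h3
  calc μ {ω | ε ≤ ‖Y (n, ω)‖}
      ≤ μ ({ω | K < ‖X (n, ω)‖} ∪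
          {ω | ¬ ‖Y (n, ω)‖ ≤ ε / (2 * (|K| + 1)) * ‖X (n, ω)‖}) := by
        refine measure_mono fun ω hω => ?_
        by_contra hcon
        simp only [Set.mem_union, Set.mem_ofPred_eq, not_or, not_not, not_lt] at hcon
        have h4 : ‖X (n, ω)‖ ≤ |K| + 1 := hcon.1.trans ((le_abs_self K).trans (by linarith))
        have h5 := hcon.2.trans (mul_le_mul_of_nonneg_left h4 hc.le)
        have h6 : ε / (2 * (|K| + 1)) * (|K| + 1) = ε / 2 := by
          field_simp
        have h7 : ε ≤ ‖Y (n, ω)‖ := hω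
        linarith
    _ ≤ η / 2 + η / 2 := (measure_union_le _ _).trans (add_le_add h1 h3)
    _ = η := ENNReal.add_halves η

lemma BddInProb.add {X Y : ℕ × Ω → E} (hX : BddInProb μ X) (hY : BddInProb μ Y) :
    BddInProb μ (fun p => X p + Y p) := by
  intro η hη
  have h2 : 0 < η / 2 := ENNReal.half_pos hη.ne'
  obtain ⟨K, hK⟩ := hX (η / 2) h2
  obtain ⟨L, hL⟩ := hY (η / 2) h2
  refine ⟨K + L, ?_⟩
  filter_upwards [hK, hL] with n h1 h3
  calc μ {ω | K + L < ‖X (n, ω) + Y (n, ω)‖}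
      ≤ μ ({ω | K < ‖X (n, ω)‖} ∪ {ω | L < ‖Y (n, ω)‖}) := by
        refine measure_mono fun ω hω => ?_
        by_contra hcon
        simp only [Set.mem_union, Set.mem_ofPred_eq, not_or, not_lt] at hcon
        exact absurd ((norm_add_le _ _).trans (add_le_add hcon.1 hcon.2)) (not_le.2 hω)
    _ ≤ η / 2 + η / 2 := (measure_union_le _ _).trans (add_le_add h1 h3)
    _ = η := ENNReal.add_halves η

lemma BddInProb.neg {X : ℕ × Ω → E} (hX : BddInProb μ X) : BddInProb μ (fun p => - X p) := by
  simpa [BddInProb] using hX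

lemma BddInProb.sub {X Y : ℕ × Ω → E} (hX : BddInProb μ X) (hY : BddInProb μ Y) :
    BddInProb μ (fun p => X p - Y p) := by
  simpa [sub_eq_add_neg] using hX.add hY.neg

lemma bddInProb_of_tendsto {X : ℕ × Ω → E} {c : E} (h : Tendsto X (probFilter μ) (𝓝 c)) :
    BddInProb μ X := by
  intro η hη
  refine ⟨‖c‖ + 1, ?_⟩
  have h1 : ∀ᶠ p in probFilter μ, ‖X p‖ < ‖c‖ + 1 :=
    h.norm.eventually (gt_mem_nhds (lt_add_one _))
  filter_upwards [ENNReal.tendsto_nhds_zero.1 (eventually_probFilter.1 h1) _ hη] with n hn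
  exact (measure_mono fun ω hω => by simpa using le_of_lt hω).trans hn

lemma BddInProb.tendsto_smul [NormedSpace ℝ E] {X : ℕ × Ω → E} {Y : ℕ × Ω → ℝ}
    (hX : BddInProb μ X) (hY : Tendsto Y (probFilter μ) (𝓝 0)) :
    Tendsto (fun p => Y p • X p) (probFilter μ) (𝓝 0) := by
  refine hX.tendsto_of_isLittleO ?_
  have := ((Asymptotics.isLittleO_one_iff ℝ).2 hY).smul_isBigO
    (Asymptotics.isBigO_refl X (probFilter μ))
  simpa using this

lemma BddInProb.tendsto_clm_apply [NormedSpace ℝ E] [NormedSpace ℝ F] {X : ℕ × Ω → E}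
    {Y : ℕ × Ω → E →L[ℝ] F} (hX : BddInProb μ X) (hY : Tendsto Y (probFilter μ) (𝓝 0)) :
    Tendsto (fun p => Y p (X p)) (probFilter μ) (𝓝 0) := by
  refine squeeze_zero_norm (fun p => (Y p).le_opNorm (X p)) ?_
  have h1 : BddInProb μ (fun p => ‖X p‖) := hX.of_isBigO (Asymptotics.isBigO_refl X _).norm_left
  have h2 : Tendsto (fun p => ‖Y p‖) (probFilter μ) (𝓝 0) := by simpa using hY.norm
  simpa using h1.tendsto_smul h2

lemma BddInProb.clm_apply [NormedSpace ℝ E] [NormedSpace ℝ F] {X : ℕ × Ω → E}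
    {Y : ℕ × Ω → E →L[ℝ] F} {L : E →L[ℝ] F} (hX : BddInProb μ X)
    (hY : Tendsto Y (probFilter μ) (𝓝 L)) : BddInProb μ (fun p => Y p (X p)) := by
  have h1 : BddInProb μ (fun p => L (X p)) := hX.of_isBigO (L.isBigO_comp X _)
  have h2 := hX.tendsto_clm_apply (Y := fun p => Y p - L) (by simpa using hY.sub_const L)
  simpa using h1.add (bddInProb_of_tendsto h2)

/-- A random sequence is bounded in probability if its second moments are, in the form of a
Chebyshev inequality. -/
lemma bddInProb_of_sq_le {X : ℕ × Ω → E} {c : ℝ≥0∞} (hc : c ≠ ⊤)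
    (h : ∀ᶠ n in atTop, ∀ K : ℝ, 0 < K →
      ENNReal.ofReal (K ^ 2) * μ {ω | K < ‖X (n, ω)‖} ≤ c) : BddInProb μ X := by
  intro η hη
  rcases eq_or_ne η ⊤ with rfl | hηt
  · exact ⟨0, by simp⟩
  -- `K ^ 2 = c / η + 1` gives `c ≤ K ^ 2 * η`; the `+ 1` keeps `K` positive when `c = 0`.
  set K : ℝ := √((c / η).toReal + 1)
  have hK : 0 < K := Real.sqrt_pos.2 (by positivity)
  refine ⟨K, ?_⟩
  filter_upwards [h] with n hn
  have h1 := hn K hK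
  have h2 : c ≤ ENNReal.ofReal (K ^ 2) * η := by
    rw [Real.sq_sqrt (by positivity), ENNReal.ofReal_add (by positivity) (by positivity),
      ENNReal.ofReal_toReal (ENNReal.div_ne_top hc hη.ne'), add_mul,
      ENNReal.div_mul_cancel hη.ne' hηt]
    exact le_self_add
  have h3 : ENNReal.ofReal (K ^ 2) ≠ 0 := (ENNReal.ofReal_pos.2 (pow_pos hK 2)).ne'
  exact (ENNReal.mul_le_mul_iff_right h3 ENNReal.ofReal_ne_top).1 (h1.trans h2)

end ProbFilter

/-! ### Markov's inequality conditionally on independent data, with a random choice of sample. -/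

section ConditionalMarkov

variable {Ω : Type*} [MeasurableSpace Ω] {μ : Measure Ω}

/-- Tonelli: by independence the joint law is a product, so the bound with `v` frozen can be
integrated over the law of `V`. -/
lemma lintegral_le_of_indepFun [IsProbabilityMeasure μ] {𝒱 𝒟 : Type*} [MeasurableSpace 𝒱]
    [MeasurableSpace 𝒟] {V : Ω → 𝒱} {D : Ω → 𝒟} (hV : Measurable V) (hD : Measurable D)
    (hVD : IndepFun V D μ) {Φ : 𝒱 × 𝒟 → ℝ≥0∞} (hΦ : Measurable Φ) {c : 𝒱 → ℝ≥0∞}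
    (hc : Measurable c) (h : ∀ v, ∫⁻ x, Φ (v, x) ∂(μ.map D) ≤ c v) :
    ∫⁻ ω, Φ (V ω, D ω) ∂μ ≤ ∫⁻ ω, c (V ω) ∂μ := by
  have := Measure.isProbabilityMeasure_map (μ := μ) hV.aemeasurable
  have := Measure.isProbabilityMeasure_map (μ := μ) hD.aemeasurable
  rw [← lintegral_map hΦ (hV.prodMk hD), (indepFun_iff_map_prod_eq_prod_map_map hV.aemeasurable
    hD.aemeasurable).1 hVD, lintegral_prod _ hΦ.aemeasurable, ← lintegral_map hc hV]
  exact lintegral_mono h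

/-- A conditional Markov inequality for a functional of a sample that is chosen by a random index
with finitely many values. -/
theorem mul_measure_le_of_random_index [IsProbabilityMeasure μ] {K 𝒜 : Type*} {𝒟 : K → Type*}
    [Finite K] [MeasurableSpace K] [MeasurableSingletonClass K] [MeasurableSpace 𝒜]
    [∀ k, MeasurableSpace (𝒟 k)]
    {κ : Ω → K} (hκ : Measurable κ) {A : K → Ω → 𝒜} (hA : ∀ k, Measurable (A k))
    {D : ∀ k, Ω → 𝒟 k} (hD : ∀ k, Measurable (D k))
    (hind : ∀ k, IndepFun (fun ω => (κ ω, A k ω)) (D k) μ)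
    {Φ : ∀ k, 𝒜 × 𝒟 k → ℝ≥0∞} (hΦ : ∀ k, Measurable (Φ k)) {E : Set 𝒜} (hE : MeasurableSet E)
    {c ε : ℝ≥0∞}
    (hc : ∀ ω, ∀ a ∈ E, ∫⁻ x, Φ (κ ω) (a, x) ∂(μ.map (D (κ ω))) ≤ c) {S : Set Ω}
    (hS : ∀ ω ∈ S, A (κ ω) ω ∈ E ∧ ε ≤ Φ (κ ω) (A (κ ω) ω, D (κ ω) ω)) : ε * μ S ≤ c := by
  classical
  have := Fintype.ofFinite K
  have hsub : S ⊆ ⋃ k, S ∩ κ ⁻¹' {k} := fun ω hω => Set.mem_iUnion.2 ⟨κ ω, hω, rfl⟩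
  -- On the event `κ = k` the sample in use is the fixed `D k`, to which independence applies. These
  -- events partition the space, so the bounds add up to `c`.
  have hk : ∀ k, ε * μ (S ∩ κ ⁻¹' {k}) ≤ c * μ (κ ⁻¹' {k}) := by
    intro k
    -- The bound `hc` is available only for values that `κ` takes.
    rcases (κ ⁻¹' {k}).eq_empty_or_nonempty with hem | ⟨ω₀, hω₀⟩
    · simp [hem]
    obtain rfl : κ ω₀ = k := hω₀
    set k := κ ω₀
    set B : Set (K × 𝒜) := {k} ×ˢ E
    have hB : MeasurableSet B := (measurableSet_singleton k).prod hE
    set Ψ : (K × 𝒜) × 𝒟 k → ℝ≥0∞ := fun v => B.indicator 1 v.1 * Φ k (v.1.2, v.2)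
    have hΨ : Measurable Ψ := ((measurable_one.indicator hB).comp measurable_fst).mul
      ((hΦ k).comp ((measurable_snd.comp measurable_fst).prodMk measurable_snd))
    have h1 := lintegral_le_of_indepFun (hκ.prodMk (hA k)) (hD k) (hind k) hΨ
      (c := fun v => ({k} : Set K).indicator (fun _ => c) v.1)
      ((measurable_const.indicator (measurableSet_singleton k)).comp measurable_fst) (by
        rintro ⟨k', a⟩
        by_cases hv : (k', a) ∈ B
        · obtain ⟨hk', ha⟩ := hv
          simp only [Set.mem_singleton_iff] at hk'
          subst hk'
          have : (k, a) ∈ B := ⟨rfl, ha⟩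
          simpa [Ψ, this] using hc ω₀ a ha
        · simp [Ψ, hv])
    have h2 : ∫⁻ ω, ({k} : Set K).indicator (fun _ => c) (κ ω) ∂μ = c * μ (κ ⁻¹' {k}) := by
      rw [← lintegral_indicator_const (hκ (measurableSet_singleton k))]
      rfl
    rw [h2] at h1
    refine le_trans ?_ h1
    refine le_trans ?_ (mul_meas_ge_le_lintegral₀
      (hΨ.comp ((hκ.prodMk (hA k)).prodMk (hD k))).aemeasurable ε)
    refine mul_le_mul_right (measure_mono ?_) _
    rintro ω ⟨hωS, hωk⟩
    have hωk' : κ ω = k := hωk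
    have h3 := hS ω hωS
    rw [hωk'] at h3
    have : (κ ω, A k ω) ∈ B := ⟨hωk, h3.1⟩
    simpa [Ψ, this] using h3.2
  calc ε * μ S ≤ ε * ∑ k, μ (S ∩ κ ⁻¹' {k}) :=
        mul_le_mul_right ((measure_mono hsub).trans (measure_iUnion_fintype_le _ _)) _
    _ = ∑ k, ε * μ (S ∩ κ ⁻¹' {k}) := Finset.mul_sum _ _ _
    _ ≤ ∑ k, c * μ (κ ⁻¹' {k}) := Finset.sum_le_sum fun k _ => hk k
    _ = c * ∑ k, μ (κ ⁻¹' {k}) := (Finset.mul_sum _ _ _).symm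
    _ = c := by
      rw [sum_measure_preimage_singleton _ fun k _ => hκ (measurableSet_singleton k)]
      simp

/-- The joint law is a triple product, which can be bracketed either way. It lets the split and the
auxiliary randomness join the data conditioned on. -/
lemma indepFun_prodMk_of_indepFun [IsProbabilityMeasure μ] {𝒜 ℬ 𝒞 : Type*} [MeasurableSpace 𝒜]
    [MeasurableSpace ℬ] [MeasurableSpace 𝒞] {X : Ω → 𝒜} {Y₁ : Ω → ℬ} {Y₂ : Ω → 𝒞}
    (hX : Measurable X) (hY₁ : Measurable Y₁) (hY₂ : Measurable Y₂)
    (h : IndepFun X (fun ω => (Y₁ ω, Y₂ ω)) μ) (h₁₂ : IndepFun Y₁ Y₂ μ) :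
    IndepFun (fun ω => (X ω, Y₁ ω)) Y₂ μ := by
  have := Measure.isProbabilityMeasure_map (μ := μ) hX.aemeasurable
  have := Measure.isProbabilityMeasure_map (μ := μ) hY₁.aemeasurable
  have := Measure.isProbabilityMeasure_map (μ := μ) hY₂.aemeasurable
  have hX1 : IndepFun X Y₁ μ := h.comp measurable_id measurable_fst
  rw [indepFun_iff_map_prod_eq_prod_map_map (hX.prodMk hY₁).aemeasurable hY₂.aemeasurable]
  rw [indepFun_iff_map_prod_eq_prod_map_map hX.aemeasurable (hY₁.prodMk hY₂).aemeasurable] at h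
  rw [indepFun_iff_map_prod_eq_prod_map_map hX.aemeasurable hY₁.aemeasurable] at hX1
  rw [indepFun_iff_map_prod_eq_prod_map_map hY₁.aemeasurable hY₂.aemeasurable] at h₁₂
  rw [h₁₂, ← Measure.prodAssoc_prod, ← hX1] at h
  have h2 := congrArg (Measure.map MeasurableEquiv.prodAssoc.symm) h
  rw [Measure.map_map (by fun_prop) (by fun_prop), Measure.map_map (by fun_prop) (by fun_prop)] at h2
  simpa [Function.comp_def, MeasurableEquiv.prodAssoc] using h2

end ConditionalMarkov

end RePPI

namespace RePPI

/-! ### Moments and laws of large numbers for averages under product measures. -/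

section ProductSample

lemma avg_mk {α E : Type*} [AddCommGroup E] [Module ℝ E] {m : ℕ} (x : Fin m → α) (φ : α → E) :
    avg ⟨m, x⟩ φ = (m : ℝ)⁻¹ • ∑ t, φ (x t) := rfl

variable {α : Type*} [MeasurableSpace α] {P : Measure α} [IsProbabilityMeasure P]

lemma measurable_avg {𝒜 : Type*} [MeasurableSpace 𝒜] {m : ℕ} {φ : 𝒜 → α → ℝ}
    (hφ : Measurable (Function.uncurry φ)) :
    Measurable fun v : 𝒜 × (Fin m → α) => avg ⟨m, v.2⟩ (φ v.1) := by
  have h : ∀ t : Fin m, Measurable fun v : 𝒜 × (Fin m → α) => φ v.1 (v.2 t) := fun t =>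
    hφ.comp (measurable_fst.prodMk ((measurable_pi_apply t).comp measurable_snd))
  simp only [avg_mk, smul_eq_mul]
  exact (Finset.measurable_fun_sum _ fun t _ => h t).const_mul _

/-- Only an inequality, so that the empty sample, whose average is zero, is covered. -/
lemma lintegral_pi_avg_le (m : ℕ) {ψ : α → ℝ≥0∞} (hψ : Measurable ψ) :
    ∫⁻ x, (m : ℝ≥0∞)⁻¹ * ∑ t, ψ (x t) ∂(Measure.pi fun _ : Fin m => P) ≤ ∫⁻ z, ψ z ∂P := by
  rcases Nat.eq_zero_or_pos m with rfl | hm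
  · simp
  have hmeas : ∀ t : Fin m, Measurable fun x : Fin m → α => ψ (x t) := fun t =>
    hψ.comp (measurable_pi_apply t)
  rw [lintegral_const_mul _ (Finset.measurable_fun_sum _ fun t _ => hmeas t),
    lintegral_finsetSum _ fun t _ => hmeas t]
  have : ∀ t : Fin m, ∫⁻ x : Fin m → α, ψ (x t) ∂(Measure.pi fun _ : Fin m => P) =
      ∫⁻ z, ψ z ∂P := fun t =>
    (measurePreserving_eval (fun _ : Fin m => P) t).lintegral_comp hψ
  simp only [this, Finset.sum_const, Finset.card_univ, Fintype.card_fin, nsmul_eq_mul]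
  rw [← mul_assoc, ENNReal.inv_mul_cancel (by simpa using hm.ne') (ENNReal.natCast_ne_top m),
    one_mul]

lemma evariance_le_lintegral_sq {φ : α → ℝ} (hφ : MemLp φ 2 P) :
    evariance φ P ≤ ∫⁻ z, ‖φ z‖ₑ ^ 2 ∂P := by
  have h1 := variance_le_expectation_sq (μ := P) hφ.aestronglyMeasurable
  rw [← hφ.ofReal_variance_eq]
  refine (ENNReal.ofReal_le_ofReal h1).trans (le_of_eq ?_)
  simp only [Pi.pow_apply]
  rw [ofReal_integral_eq_lintegral_ofReal hφ.integrable_sq (ae_of_all _ fun z => by positivity)]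
  refine lintegral_congr fun z => ?_
  rw [← Real.enorm_of_nonneg (by positivity), enorm_pow]

/-- The variance of a sample average. -/
lemma lintegral_pi_sq_avg_sub_le (m : ℕ) {φ : α → ℝ} (hφ : MemLp φ 2 P) :
    ∫⁻ x, m * ‖avg ⟨m, x⟩ φ - ∫ z, φ z ∂P‖ₑ ^ 2 ∂(Measure.pi fun _ : Fin m => P) ≤
      ∫⁻ z, ‖φ z‖ₑ ^ 2 ∂P := by
  rcases Nat.eq_zero_or_pos m with rfl | hm
  · simp
  have hm0 : (m : ℝ) ≠ 0 := by positivity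
  refine le_trans (le_of_eq ?_) (evariance_le_lintegral_sq hφ)
  have hcoord : ∀ t : Fin m, MemLp (fun x : Fin m → α => φ (x t)) 2
      (Measure.pi fun _ : Fin m => P) := fun t =>
    hφ.comp_measurePreserving (measurePreserving_eval _ t)
  have hsum : MemLp (∑ t : Fin m, fun x : Fin m → α => φ (x t)) 2
      (Measure.pi fun _ : Fin m => P) := memLp_finsetSum' _ fun t _ => hcoord t
  have havg : (fun x : Fin m → α => avg ⟨m, x⟩ φ) =
      (m : ℝ)⁻¹ • ∑ t : Fin m, fun x : Fin m → α => φ (x t) := by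
    ext x; simp [avg]
  have hmean : ∫ x, avg ⟨m, x⟩ φ ∂(Measure.pi fun _ : Fin m => P) = ∫ z, φ z ∂P := by
    have h1 : ∀ t : Fin m, ∫ x : Fin m → α, φ (x t) ∂(Measure.pi fun _ : Fin m => P) =
        ∫ z, φ z ∂P := fun t => integral_comp_eval (μ := fun _ : Fin m => P) (i := t)
          hφ.aestronglyMeasurable
    simp only [avg_mk]
    rw [integral_smul, integral_finsetSum _ fun t _ => (hcoord t).integrable (by norm_num)]
    simp [h1, hm0]
  have hvar : Var[fun x : Fin m → α => avg ⟨m, x⟩ φ; Measure.pi fun _ : Fin m => P] =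
      (m : ℝ)⁻¹ * Var[φ; P] := by
    rw [havg, variance_smul, variance_sum_pi (X := fun _ : Fin m => φ) fun _ => hφ]
    simp only [Finset.sum_const, Finset.card_univ, Fintype.card_fin, nsmul_eq_mul]
    field_simp
  have hav : MemLp (fun x : Fin m → α => avg ⟨m, x⟩ φ) 2 (Measure.pi fun _ : Fin m => P) := by
    rw [havg]; exact hsum.const_smul _
  have hev : ∫⁻ x, ‖avg ⟨m, x⟩ φ - ∫ z, φ z ∂P‖ₑ ^ 2 ∂(Measure.pi fun _ : Fin m => P) =
      evariance (fun x : Fin m → α => avg ⟨m, x⟩ φ) (Measure.pi fun _ : Fin m => P) := by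
    rw [evariance, hmean]
  rw [lintegral_const_mul' _ _ (ENNReal.natCast_ne_top m), hev, ← hav.ofReal_variance_eq, hvar,
    ← hφ.ofReal_variance_eq, ENNReal.ofReal_mul (by positivity), ENNReal.ofReal_inv_of_pos
      (by positivity), ENNReal.ofReal_natCast, ← mul_assoc,
    ENNReal.mul_inv_cancel (by simpa using hm.ne') (ENNReal.natCast_ne_top m), one_mul]

end ProductSample

section IndependentSample

variable {α : Type*} [MeasurableSpace α] {P : Measure α}
  {Ω : Type*} [MeasurableSpace Ω] {μ : Measure Ω} [IsProbabilityMeasure μ]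

lemma map_eq_pi_of_iIndepFun {Z : ℕ → Ω → α} (hZ : ∀ i, Measurable (Z i))
    (hlaw : ∀ i, μ.map (Z i) = P) (hind : iIndepFun Z μ) {m : ℕ} {e : Fin m → ℕ}
    (he : Function.Injective e) :
    μ.map (fun ω t => Z (e t) ω) = Measure.pi fun _ : Fin m => P := by
  have h := (iIndepFun_iff_map_fun_eq_pi_map fun t => (hZ (e t)).aemeasurable).1 (hind.precomp he)
  simpa [hlaw] using h

/-- The law of large numbers in mean, for the product measures. -/
lemma tendsto_lintegral_pi_avg_sub {Z : ℕ → Ω → α} (hZ : ∀ i, Measurable (Z i))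
    (hlaw : ∀ i, μ.map (Z i) = P) (hind : iIndepFun Z μ) {φ : α → ℝ} (hφ : Measurable φ)
    (hint : Integrable φ P) :
    Tendsto (fun m : ℕ => ∫⁻ x, ‖avg ⟨m, x⟩ φ - ∫ z, φ z ∂P‖ₑ ∂(Measure.pi fun _ : Fin m => P))
      atTop (𝓝 0) := by
  have hid : ∀ i, IdentDistrib (fun ω => φ (Z i ω)) (fun ω => φ (Z 0 ω)) μ μ := fun i =>
    IdentDistrib.comp (u := φ) ⟨(hZ i).aemeasurable, (hZ 0).aemeasurable, by rw [hlaw, hlaw]⟩ hφ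
  have hint0 : MemLp (fun ω => φ (Z 0 ω)) 1 μ := by
    rw [memLp_one_iff_integrable]
    have := hint
    rw [← hlaw 0] at this
    exact this.comp_measurable (hZ 0)
  -- The strong law in `L¹` holds for the sequence under `μ`. Carried over to product measures, it
  -- serves for any fold, whatever indices it occupies.
  have h := strong_law_Lp (p := 1) le_rfl (by simp) (fun i ω => φ (Z i ω)) hint0
    (fun i j hij => (hind.indepFun hij).comp hφ hφ) hid
  refine h.congr fun m => ?_
  have hmap := map_eq_pi_of_iIndepFun hZ hlaw hind (Fin.val_injective (n := m))
  have hmean : ∫ ω, φ (Z 0 ω) ∂μ = ∫ z, φ z ∂P := by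
    rw [← hlaw 0, integral_map (hZ 0).aemeasurable hφ.aestronglyMeasurable]
  have hmeas : Measurable fun x : Fin m → α => ‖avg ⟨m, x⟩ φ - ∫ z, φ z ∂P‖ₑ :=
    ((measurable_avg (𝒜 := Unit) (φ := fun _ => φ) (hφ.comp measurable_snd)).comp
      (measurable_const (a := ()) |>.prodMk measurable_id) |>.sub_const _).enorm
  rw [← hmap, lintegral_map hmeas (measurable_pi_lambda _ fun t => hZ _),
    eLpNorm_one_eq_lintegral_enorm]
  refine lintegral_congr fun ω => ?_
  rw [hmean, avg_mk]
  simp only [Finset.sum_range]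

end IndependentSample

/-! ### The largest term of a sample. -/

section MaximalTerm

/-- The maximum of a sample is of smaller order than the sample size. -/
lemma tendsto_mul_measure_gt {α : Type*} [MeasurableSpace α] {P : Measure α} {φ : α → ℝ}
    (hφ : Measurable φ) (hint : Integrable φ P) {ε : ℝ} (hε : 0 < ε) :
    Tendsto (fun n : ℕ => (n : ℝ≥0∞) * P {z | ε * n < |φ z|}) atTop (𝓝 0) := by
  have hS : ∀ n : ℕ, MeasurableSet {z | ε * n < |φ z|} := fun n =>
    measurableSet_lt measurable_const hφ.abs
  -- Pointwise, `n` times the indicator of `ε * n < |φ|` is at most `|φ| / ε` and vanishes for large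
  -- `n`.
  have h := tendsto_lintegral_of_dominated_convergence (μ := P)
    (F := fun (n : ℕ) z => {z | ε * n < |φ z|}.indicator (fun _ => (n : ℝ≥0∞)) z) (f := fun _ => 0)
    (fun z => ENNReal.ofReal (|φ z| / ε)) (fun n => measurable_const.indicator (hS n)) ?_ ?_ ?_
  · simpa [lintegral_indicator_const (hS _)] using h
  · intro n
    refine ae_of_all _ fun z => Set.indicator_apply_le' (fun hz => ?_) (fun _ => zero_le)
    rw [← ENNReal.ofReal_natCast]
    refine ENNReal.ofReal_le_ofReal ?_
    rw [le_div_iff₀ hε, mul_comm]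
    exact le_of_lt hz
  · exact ((hint.abs.div_const ε).lintegral_lt_top).ne
  · refine ae_of_all _ fun z => tendsto_const_nhds.congr' ?_
    have h1 : Tendsto (fun n : ℕ => ε * (n : ℝ)) atTop atTop :=
      tendsto_natCast_atTop_atTop.const_mul_atTop hε
    filter_upwards [h1.eventually_ge_atTop |φ z|] with n hn
    simp [not_lt.2 hn]

end MaximalTerm

end RePPI

namespace RePPI

section Congr

variable {Ω E : Type*} [MeasurableSpace Ω] {μ : Measure Ω} [NormedAddCommGroup E]

lemma BddInProb.congr' {X Y : ℕ × Ω → E} (hX : BddInProb μ X) (h : X =ᶠ[probFilter μ] Y) :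
    BddInProb μ Y :=
  hX.of_isBigO h.symm.isBigO

end Congr

section SigmaMeasurable

lemma measurable_sigma_mk {ι : Type*} {γ : ι → Type*} [∀ i, MeasurableSpace (γ i)] (i : ι) :
    Measurable (Sigma.mk i : γ i → Σ i, γ i) :=
  Measurable.of_le_map (iInf_le _ i)

end SigmaMeasurable

/-! ### Sizes of the folds of an even split. -/

section FoldSizes

variable {n : ℕ} {κ₀ : Fin n → Fin 3}

lemma sum_card_foldIndices (κ₀ : Fin n → Fin 3) : ∑ j, (foldIndices κ₀ j).card = n := by
  have := Finset.card_eq_sum_card_fiberwise (f := κ₀) (s := Finset.univ) (t := Finset.univ)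
    (fun _ _ => Finset.mem_coe.2 (Finset.mem_univ _))
  simpa [foldIndices] using this.symm

/-- Each of the other two folds has at most one point more than fold `j`. -/
lemma EvenSplit.le_three_mul_card (h : EvenSplit κ₀) (j : Fin 3) :
    n ≤ 3 * (foldIndices κ₀ j).card + 2 := by
  have h1 := sum_card_foldIndices κ₀
  rw [Fin.sum_univ_three] at h1
  have h2 := h 0 j
  have h3 := h 1 j
  have h4 := h 2 j
  fin_cases j <;> simp at * <;> omega

end FoldSizes

/-! ### Independence of the folds, and limit theorems for fold and unlabeled averages. -/

section SplitSample

variable {α Ω Ξ β : Type*} [MeasurableSpace α] [MeasurableSpace β] [MeasurableSpace Ω]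
  [MeasurableSpace Ξ]
  {μ : Measure Ω} [IsProbabilityMeasure μ]
  {P : Measure α} [IsProbabilityMeasure P] {Q : Measure β} [IsProbabilityMeasure Q]
  {Z : ℕ → Ω → α} {U : ℕ → Ω → β} {κ : (n : ℕ) → Ω → Fin n → Fin 3} {ξ : ℕ → Fin 3 → Ω → Ξ}

/-- Independent i.i.d. samples `Z` and `U` with laws `P` and `Q`, an even random split of the first
`n` points of `Z` and auxiliary randomness, both independent of the samples. -/
structure IsSplitSample (μ : Measure Ω) (P : Measure α) (Q : Measure β) (Z : ℕ → Ω → α)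
    (U : ℕ → Ω → β) (κ : (n : ℕ) → Ω → Fin n → Fin 3) (ξ : ℕ → Fin 3 → Ω → Ξ) : Prop where
  measurable_labeled : ∀ i, Measurable (Z i)
  measurable_unlabeled : ∀ i, Measurable (U i)
  law_labeled : ∀ i, μ.map (Z i) = P
  law_unlabeled : ∀ i, μ.map (U i) = Q
  iIndep_labeled : iIndepFun Z μ
  iIndep_unlabeled : iIndepFun U μ
  indep : IndepFun (fun ω i => Z i ω) (fun ω j => U j ω) μ
  measurable_split : ∀ n, Measurable (κ n)
  even : ∀ n ω, EvenSplit (κ n ω)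
  measurable_aux : ∀ n k, Measurable (ξ n k)
  indep_split : ∀ n, IndepFun (fun ω => (κ n ω, fun k => ξ n k ω))
    (fun ω => (fun i => Z i ω, fun j => U j ω)) μ

/-- The data available before the fold `j` and the unlabeled sample are used. -/
def trainingData (Z : ℕ → Ω → α) (ξ : ℕ → Fin 3 → Ω → Ξ) (n : ℕ) (j₁ j₂ : Fin 3)
    (κ₀ : Fin n → Fin 3) (ω : Ω) : (Fin 3 → Ξ) × Dataset α × Dataset α :=
  (fun k => ξ n k ω, fold κ₀ (fun i => Z i ω) j₁, fold κ₀ (fun i => Z i ω) j₂)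

namespace IsSplitSample

lemma measurable_sequence (h : IsSplitSample μ P Q Z U κ ξ) : Measurable fun ω i => Z i ω :=
  measurable_pi_lambda _ h.measurable_labeled

lemma measurable_unlabeled_sequence (h : IsSplitSample μ P Q Z U κ ξ) :
    Measurable fun ω i => U i ω :=
  measurable_pi_lambda _ h.measurable_unlabeled

lemma measurable_split_aux (h : IsSplitSample μ P Q Z U κ ξ) (n : ℕ) :
    Measurable fun ω => (κ n ω, fun k => ξ n k ω) :=
  (h.measurable_split n).prodMk (measurable_pi_lambda _ fun k => h.measurable_aux n k)

lemma measurable_fold {n : ℕ} (κ₀ : Fin n → Fin 3) (j : Fin 3) :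
    Measurable fun z : ℕ → α => fold κ₀ z j :=
  (measurable_sigma_mk _).comp (measurable_pi_lambda _ fun _ => measurable_pi_apply _)

lemma measurable_trainingData (h : IsSplitSample μ P Q Z U κ ξ) (n : ℕ) (j₁ j₂ : Fin 3)
    (κ₀ : Fin n → Fin 3) : Measurable (trainingData Z ξ n j₁ j₂ κ₀) :=
  (measurable_pi_lambda _ fun k => h.measurable_aux n k).prodMk
    (((measurable_fold κ₀ j₁).comp h.measurable_sequence).prodMk
      ((measurable_fold κ₀ j₂).comp h.measurable_sequence))

/-- For fixed labels, the folds `j₁` and `j₂` read only indices not labelled `j`, a set disjoint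
from the indices of fold `j`. -/
lemma indep_fold_fold (h : IsSplitSample μ P Q Z U κ ξ) {n : ℕ} (κ₀ : Fin n → Fin 3)
    {j j₁ j₂ : Fin 3} (h₁ : j₁ ≠ j) (h₂ : j₂ ≠ j) :
    IndepFun (fun ω => (fold κ₀ (fun i => Z i ω) j₁, fold κ₀ (fun i => Z i ω) j₂))
      (fun ω (t : Fin (foldIndices κ₀ j).card) =>
        Z ((foldIndices κ₀ j).orderEmbOfFin rfl t) ω) μ := by
  set S : Finset ℕ := (Finset.univ.filter fun i => κ₀ i ≠ j).map Fin.valEmbedding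
  set T : Finset ℕ := (foldIndices κ₀ j).map Fin.valEmbedding
  have hST : Disjoint S T := by
    rw [Finset.disjoint_map, Finset.disjoint_left]
    intro i hi hi'
    simp only [foldIndices, Finset.mem_filter, Finset.mem_univ, true_and] at hi hi'
    exact hi hi'
  have hmem : ∀ j', j' ≠ j → ∀ t : Fin (foldIndices κ₀ j').card,
      (((foldIndices κ₀ j').orderEmbOfFin rfl t : Fin n) : ℕ) ∈ S := by
    intro j' hj' t
    have := (foldIndices κ₀ j').orderEmbOfFin_mem rfl t
    simp only [foldIndices, Finset.mem_filter, Finset.mem_univ, true_and] at this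
    refine Finset.mem_map.2 ⟨_, ?_, rfl⟩
    simp only [Finset.mem_filter, Finset.mem_univ, true_and]
    exact fun hc => hj' (this.symm.trans hc)
  have hmemT : ∀ t : Fin (foldIndices κ₀ j).card,
      (((foldIndices κ₀ j).orderEmbOfFin rfl t : Fin n) : ℕ) ∈ T := fun t =>
    Finset.mem_map.2 ⟨_, (foldIndices κ₀ j).orderEmbOfFin_mem rfl t, rfl⟩
  have key := h.iIndep_labeled.indepFun_finset S T hST h.measurable_labeled
  have hm : ∀ j' (hj' : j' ≠ j), Measurable fun (x : S → α) =>
      (⟨(foldIndices κ₀ j').card, fun t => x ⟨_, hmem j' hj' t⟩⟩ : Dataset α) := fun j' hj' =>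
    (measurable_sigma_mk _).comp (measurable_pi_lambda _ fun _ => measurable_pi_apply _)
  exact key.comp ((hm j₁ h₁).prodMk (hm j₂ h₂))
    (measurable_pi_lambda (fun (x : T → α) t => x ⟨_, hmemT t⟩) fun _ => measurable_pi_apply _)

/-- This is what cross-fitting buys. The training data are read with fixed labels `κ₀` and the
random split is kept as a separate component; `mul_measure_le_of_random_index` matches the two on
the event `κ n = κ₀`. -/
lemma indep_trainingData_fold (h : IsSplitSample μ P Q Z U κ ξ) {n : ℕ} (κ₀ : Fin n → Fin 3)
    {j j₁ j₂ : Fin 3} (h₁ : j₁ ≠ j) (h₂ : j₂ ≠ j) :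
    IndepFun (fun ω => (κ n ω, trainingData Z ξ n j₁ j₂ κ₀ ω))
      (fun ω (t : Fin (foldIndices κ₀ j).card) =>
        Z ((foldIndices κ₀ j).orderEmbOfFin rfl t) ω) μ := by
  have hm : Measurable fun z : ℕ → α => (fold κ₀ z j₁, fold κ₀ z j₂) :=
    (measurable_fold κ₀ j₁).prodMk (measurable_fold κ₀ j₂)
  have hm' : Measurable fun (z : ℕ → α) (t : Fin (foldIndices κ₀ j).card) =>
      z ((foldIndices κ₀ j).orderEmbOfFin rfl t) :=
    measurable_pi_lambda _ fun _ => measurable_pi_apply _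
  have h3 := indepFun_prodMk_of_indepFun (h.measurable_split_aux n) (hm.comp h.measurable_sequence)
    (hm'.comp h.measurable_sequence)
    ((h.indep_split n).comp measurable_id ((hm.prodMk hm').comp measurable_fst))
    (h.indep_fold_fold κ₀ h₁ h₂)
  exact h3.comp (φ := fun v => (v.1.1, v.1.2, v.2)) (by fun_prop) measurable_id

lemma indep_trainingData_unlabeled (h : IsSplitSample μ P Q Z U κ ξ) {n : ℕ} (κ₀ : Fin n → Fin 3)
    (j₁ j₂ : Fin 3) (N : ℕ) :
    IndepFun (fun ω => (κ n ω, trainingData Z ξ n j₁ j₂ κ₀ ω))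
      (fun ω (t : Fin N) => U t ω) μ := by
  have h3 := indepFun_prodMk_of_indepFun (h.measurable_split_aux n) h.measurable_sequence
    h.measurable_unlabeled_sequence (h.indep_split n) h.indep
  have hm : Measurable fun v : ((Fin n → Fin 3) × (Fin 3 → Ξ)) × (ℕ → α) =>
      (v.1.1, v.1.2, fold κ₀ v.2 j₁, fold κ₀ v.2 j₂) :=
    (measurable_fst.comp measurable_fst).prodMk ((measurable_snd.comp measurable_fst).prodMk
      (((measurable_fold κ₀ j₁).comp measurable_snd).prodMk
        ((measurable_fold κ₀ j₂).comp measurable_snd)))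
  exact h3.comp hm (measurable_pi_lambda (fun (u : ℕ → β) (t : Fin N) => u t)
    fun _ => measurable_pi_apply _)

lemma map_fold_tuple (h : IsSplitSample μ P Q Z U κ ξ) {n : ℕ} (κ₀ : Fin n → Fin 3) (j : Fin 3) :
    μ.map (fun ω (t : Fin (foldIndices κ₀ j).card) =>
      Z ((foldIndices κ₀ j).orderEmbOfFin rfl t) ω) = Measure.pi fun _ => P :=
  map_eq_pi_of_iIndepFun h.measurable_labeled h.law_labeled h.iIndep_labeled
    (Fin.val_injective.comp ((foldIndices κ₀ j).orderEmbOfFin rfl).injective)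

lemma map_unlabeled_tuple (h : IsSplitSample μ P Q Z U κ ξ) (N : ℕ) :
    μ.map (fun ω (t : Fin N) => U t ω) = Measure.pi fun _ => Q :=
  map_eq_pi_of_iIndepFun h.measurable_unlabeled h.law_unlabeled h.iIndep_unlabeled
    Fin.val_injective

/-- Markov's inequality for a fold, conditionally on the split, the auxiliary randomness and the
other folds. -/
lemma fold_markov (h : IsSplitSample μ P Q Z U κ ξ) {n : ℕ} {j j₁ j₂ : Fin 3} (h₁ : j₁ ≠ j)
    (h₂ : j₂ ≠ j) {G : (Fin 3 → Ξ) × Dataset α × Dataset α → Dataset α → ℝ≥0∞}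
    (hG : ∀ m, Measurable fun v : ((Fin 3 → Ξ) × Dataset α × Dataset α) × (Fin m → α) =>
      G v.1 ⟨m, v.2⟩)
    {E : Set ((Fin 3 → Ξ) × Dataset α × Dataset α)} (hE : MeasurableSet E) {c ε : ℝ≥0∞}
    (hc : ∀ m, n ≤ 3 * m + 2 → ∀ a ∈ E, ∫⁻ x, G a ⟨m, x⟩ ∂(Measure.pi fun _ => P) ≤ c)
    {S : Set Ω} (hS : ∀ ω ∈ S, trainingData Z ξ n j₁ j₂ (κ n ω) ω ∈ E ∧
      ε ≤ G (trainingData Z ξ n j₁ j₂ (κ n ω) ω) (fold (κ n ω) (fun i => Z i ω) j)) :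
    ε * μ S ≤ c := by
  refine mul_measure_le_of_random_index (h.measurable_split n)
    (A := trainingData Z ξ n j₁ j₂) (h.measurable_trainingData n j₁ j₂)
    (𝒟 := fun κ₀ => Fin (foldIndices κ₀ j).card → α)
    (D := fun κ₀ ω t => Z ((foldIndices κ₀ j).orderEmbOfFin rfl t) ω)
    (fun κ₀ => measurable_pi_lambda _ fun t => h.measurable_labeled _)
    (fun κ₀ => h.indep_trainingData_fold κ₀ h₁ h₂)
    (Φ := fun κ₀ v => G v.1 ⟨(foldIndices κ₀ j).card, v.2⟩) (fun κ₀ => hG _) hE ?_ hS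
  intro ω a ha
  rw [h.map_fold_tuple]
  exact hc _ ((h.even n ω).le_three_mul_card j) a ha

/-- Markov's inequality for the unlabeled sample, conditionally on the labeled one. -/
lemma unlabeled_markov (h : IsSplitSample μ P Q Z U κ ξ) {n N : ℕ} (j₁ j₂ : Fin 3)
    {G : (Fin 3 → Ξ) × Dataset α × Dataset α → Dataset β → ℝ≥0∞}
    (hG : Measurable fun v : ((Fin 3 → Ξ) × Dataset α × Dataset α) × (Fin N → β) =>
      G v.1 ⟨N, v.2⟩)
    {E : Set ((Fin 3 → Ξ) × Dataset α × Dataset α)} (hE : MeasurableSet E) {c ε : ℝ≥0∞}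
    (hc : ∀ a ∈ E, ∫⁻ x, G a ⟨N, x⟩ ∂(Measure.pi fun _ => Q) ≤ c)
    {S : Set Ω} (hS : ∀ ω ∈ S, trainingData Z ξ n j₁ j₂ (κ n ω) ω ∈ E ∧
      ε ≤ G (trainingData Z ξ n j₁ j₂ (κ n ω) ω) (firstPoints N (fun i => U i ω))) :
    ε * μ S ≤ c := by
  refine mul_measure_le_of_random_index (h.measurable_split n)
    (A := trainingData Z ξ n j₁ j₂) (h.measurable_trainingData n j₁ j₂)
    (𝒟 := fun _ => Fin N → β) (D := fun _ ω t => U t ω)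
    (fun κ₀ => measurable_pi_lambda _ fun t => h.measurable_unlabeled _)
    (fun κ₀ => h.indep_trainingData_unlabeled κ₀ j₁ j₂ N)
    (Φ := fun _ v => G v.1 ⟨N, v.2⟩) (fun _ => hG) hE ?_ hS
  intro ω a ha
  rw [h.map_unlabeled_tuple]
  exact hc a ha

lemma measurable_integral_left {𝒜 : Type*} [MeasurableSpace 𝒜] {φ : 𝒜 → α → ℝ}
    (hφ : Measurable (Function.uncurry φ)) : Measurable fun a => ∫ z, φ a z ∂P :=
  (hφ.stronglyMeasurable.integral_prod_right').measurable

lemma measurable_sq_avg_sub {𝒜 : Type*} [MeasurableSpace 𝒜] {φ : 𝒜 → α → ℝ}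
    (hφ : Measurable (Function.uncurry φ)) (m : ℕ) :
    Measurable fun v : 𝒜 × (Fin m → α) =>
      (m : ℝ≥0∞) * ‖avg ⟨m, v.2⟩ (φ v.1) - ∫ z, φ v.1 z ∂P‖ₑ ^ 2 :=
  (((measurable_avg hφ).sub ((measurable_integral_left hφ).comp measurable_fst)).enorm.pow_const
    2).const_mul _

lemma memLp_two_of_lintegral_le {φ : α → ℝ} (hφ : Measurable φ) {c : ℝ≥0∞} (hc : c ≠ ⊤)
    (h : ∫⁻ z, ‖φ z‖ₑ ^ 2 ∂P ≤ c) : MemLp φ 2 P := by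
  refine ⟨hφ.aestronglyMeasurable, ?_⟩
  rw [eLpNorm_lt_top_iff_lintegral_rpow_enorm_lt_top (by norm_num) (by norm_num)]
  simpa using h.trans_lt hc.lt_top

/-- Allows deviations at the scale `√n` to be bounded for a sample of size `m`, at the price of the
factor `q`. -/
lemma ofReal_sq_le_of_le_sqrt_mul {n m q : ℕ} (hq : n ≤ q * m) {x K : ℝ} (hK : 0 ≤ K)
    (h : K ≤ ‖√(n : ℝ) • x‖) : ENNReal.ofReal (K ^ 2) ≤ q * (m * ‖x‖ₑ ^ 2) := by
  have h1 : K ^ 2 ≤ q * (m * ‖x‖ ^ 2) := by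
    calc K ^ 2 ≤ ‖√(n : ℝ) • x‖ ^ 2 := pow_le_pow_left₀ hK h 2
      _ = n * ‖x‖ ^ 2 := by
        rw [norm_smul, mul_pow, Real.norm_of_nonneg (Real.sqrt_nonneg _),
          Real.sq_sqrt (Nat.cast_nonneg _)]
      _ ≤ (q * m : ℕ) * ‖x‖ ^ 2 := by gcongr
      _ = _ := by push_cast; ring
  refine (ENNReal.ofReal_le_ofReal h1).trans (le_of_eq ?_)
  rw [ENNReal.ofReal_mul (by positivity), ENNReal.ofReal_mul (by positivity),
    ENNReal.ofReal_natCast, ENNReal.ofReal_natCast, ENNReal.ofReal_pow (norm_nonneg _),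
    ofReal_norm]

/-- A conditional Chebyshev inequality for the average over a fold. -/
lemma fold_chebyshev (h : IsSplitSample μ P Q Z U κ ξ) {n : ℕ} (hn : 3 ≤ n) {j j₁ j₂ : Fin 3}
    (h₁ : j₁ ≠ j) (h₂ : j₂ ≠ j) {φ : (Fin 3 → Ξ) × Dataset α × Dataset α → α → ℝ}
    (hφ : Measurable (Function.uncurry φ))
    {E : Set ((Fin 3 → Ξ) × Dataset α × Dataset α)} (hE : MeasurableSet E) {c : ℝ≥0∞}
    (hc : c ≠ ⊤) (hb : ∀ a ∈ E, ∫⁻ z, ‖φ a z‖ₑ ^ 2 ∂P ≤ c) {K : ℝ} (hK : 0 ≤ K) :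
    ENNReal.ofReal (K ^ 2) * μ {ω | trainingData Z ξ n j₁ j₂ (κ n ω) ω ∈ E ∧
      K ≤ ‖√(n : ℝ) • (avg (fold (κ n ω) (fun i => Z i ω) j)
        (φ (trainingData Z ξ n j₁ j₂ (κ n ω) ω)) -
          ∫ z, φ (trainingData Z ξ n j₁ j₂ (κ n ω) ω) z ∂P)‖} ≤ (5 : ℕ) * c := by
  refine h.fold_markov (n := n) h₁ h₂
    (G := fun a D => ((5 : ℕ) : ℝ≥0∞) * ((D.1 : ℝ≥0∞) * ‖avg D (φ a) - ∫ z, φ a z ∂P‖ₑ ^ 2))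
    (fun m => (measurable_sq_avg_sub hφ m).const_mul _) hE ?_ ?_
  · intro m _ a ha
    rw [lintegral_const_mul' _ _ (ENNReal.natCast_ne_top 5)]
    refine mul_le_mul_right ((lintegral_pi_sq_avg_sub_le m ?_).trans (hb a ha)) _
    exact memLp_two_of_lintegral_le (hφ.comp measurable_prodMk_left) hc (hb a ha)
  · rintro ω ⟨hωE, hω⟩
    refine ⟨hωE, ofReal_sq_le_of_le_sqrt_mul ?_ hK hω⟩
    -- `n ≥ 3` forces the fold to be nonempty, and `3 * m + 2 ≤ 5 * m` for `m ≥ 1`.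
    have := (h.even n ω).le_three_mul_card j
    change n ≤ 5 * (foldIndices (κ n ω) j).card
    omega

/-- A conditional Chebyshev inequality for the average over the unlabeled sample. -/
lemma unlabeled_chebyshev (h : IsSplitSample μ P Q Z U κ ξ) {n N q : ℕ} (hq : n ≤ q * N)
    (j₁ j₂ : Fin 3) {φ : (Fin 3 → Ξ) × Dataset α × Dataset α → β → ℝ}
    (hφ : Measurable (Function.uncurry φ))
    {E : Set ((Fin 3 → Ξ) × Dataset α × Dataset α)} (hE : MeasurableSet E) {c : ℝ≥0∞}
    (hc : c ≠ ⊤) (hb : ∀ a ∈ E, ∫⁻ z, ‖φ a z‖ₑ ^ 2 ∂Q ≤ c) {K : ℝ} (hK : 0 ≤ K) :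
    ENNReal.ofReal (K ^ 2) * μ {ω | trainingData Z ξ n j₁ j₂ (κ n ω) ω ∈ E ∧
      K ≤ ‖√(n : ℝ) • (avg (firstPoints N (fun i => U i ω))
        (φ (trainingData Z ξ n j₁ j₂ (κ n ω) ω)) -
          ∫ z, φ (trainingData Z ξ n j₁ j₂ (κ n ω) ω) z ∂Q)‖} ≤ q * c := by
  refine h.unlabeled_markov (n := n) j₁ j₂
    (G := fun a D => (q : ℝ≥0∞) * ((D.1 : ℝ≥0∞) * ‖avg D (φ a) - ∫ z, φ a z ∂Q‖ₑ ^ 2))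
    ((measurable_sq_avg_sub hφ N).const_mul _) hE ?_ ?_
  · intro a ha
    rw [lintegral_const_mul' _ _ (ENNReal.natCast_ne_top q)]
    refine mul_le_mul_right ((lintegral_pi_sq_avg_sub_le N ?_).trans (hb a ha)) _
    exact memLp_two_of_lintegral_le (hφ.comp measurable_prodMk_left) hc (hb a ha)
  · rintro ω ⟨hωE, hω⟩
    exact ⟨hωE, ofReal_sq_le_of_le_sqrt_mul hq hK hω⟩

/-- The law of large numbers holds for the folds. -/
lemma lawOfLargeNumbers_fold (h : IsSplitSample μ P Q Z U κ ξ) (j : Fin 3) :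
    LawOfLargeNumbers P (probFilter μ) fun p => fold (κ p.1 p.2) (fun i => Z i p.2) j := by
  have hae : ∀ q : α → Prop, (∀ᵐ z ∂P, q z) → ∀ᶠ p in probFilter μ, ∀ t,
      q ((fold (κ p.1 p.2) (fun i => Z i p.2) j).2 t) := by
    intro q hq
    refine eventually_probFilter_of_ae fun n => ?_
    have : ∀ᵐ ω ∂μ, ∀ i, q (Z i ω) := ae_all_iff.2 fun i =>
      ae_of_ae_map (h.measurable_labeled i).aemeasurable (by rwa [h.law_labeled])
    filter_upwards [this] with ω hω t using hω _
  refine ⟨hae, fun φ hφ => ?_⟩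
  -- The conditional Markov inequality needs a measurable integrand; a measurable version has almost
  -- surely the same averages.
  obtain ⟨ψ, hψm, hψ⟩ := hφ.1.aemeasurable
  have hψi : Integrable ψ P := hφ.congr hψ
  rw [integral_congr_ae hψ, ← tendsto_sub_nhds_zero_iff]
  have key : Tendsto (fun p : ℕ × Ω => avg (fold (κ p.1 p.2) (fun i => Z i p.2) j) ψ - ∫ z, ψ z ∂P)
      (probFilter μ) (𝓝 0) := by
    refine tendsto_zero_probFilter_of_le fun ε hε η hη => ?_
    rcases eq_or_ne η ⊤ with rfl | hηt
    · simp
    have hε' : ENNReal.ofReal ε ≠ 0 := (ENNReal.ofReal_pos.2 hε).ne'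
    have hpos : 0 < ENNReal.ofReal ε * η := ENNReal.mul_pos hε' hη.ne'
    obtain ⟨m₀, hm₀⟩ := eventually_atTop.1 (ENNReal.tendsto_nhds_zero.1
      (tendsto_lintegral_pi_avg_sub h.measurable_labeled h.law_labeled h.iIndep_labeled hψm hψi)
      _ hpos)
    -- For such `n` every fold has at least `m₀` points.
    filter_upwards [eventually_ge_atTop (3 * m₀ + 2)] with n hn
    refine (ENNReal.mul_le_mul_iff_right hε' ENNReal.ofReal_ne_top).1 ?_
    -- The integrand uses no training data; another fold serves as a dummy.
    obtain ⟨j', hj'⟩ : ∃ j' : Fin 3, j' ≠ j := exists_ne j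
    refine h.fold_markov (n := n) hj' hj' (E := Set.univ)
      (G := fun _ D => ‖avg D ψ - ∫ z, ψ z ∂P‖ₑ) (fun m => ?_) MeasurableSet.univ ?_ ?_
    · exact ((measurable_avg (φ := fun _ => ψ) (hψm.comp measurable_snd)).sub_const _).enorm
    · exact fun m hm _ _ => hm₀ m (by omega)
    · intro ω hω
      refine ⟨trivial, ?_⟩
      rw [← ofReal_norm]
      exact ENNReal.ofReal_le_ofReal hω
  refine key.congr' ?_
  filter_upwards [hae _ hψ] with p hp
  rw [avg_congr hp]

lemma bddInProb_fold (h : IsSplitSample μ P Q Z U κ ξ) (j : Fin 3) {φ : α → ℝ}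
    (hφ : MemLp φ 2 P) :
    BddInProb μ fun p => √(p.1 : ℝ) •
      (avg (fold (κ p.1 p.2) (fun i => Z i p.2) j) φ - ∫ z, φ z ∂P) := by
  obtain ⟨ψ, hψm, hψ⟩ := hφ.1.aemeasurable
  have hψ2 : MemLp ψ 2 P := hφ.ae_eq hψ
  have hc : ∫⁻ z, ‖ψ z‖ₑ ^ 2 ∂P ≠ ⊤ := by
    have := (eLpNorm_lt_top_iff_lintegral_rpow_enorm_lt_top (by norm_num) (by norm_num)).1 hψ2.2
    simpa using this.ne
  obtain ⟨j', hj'⟩ : ∃ j' : Fin 3, j' ≠ j := exists_ne j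
  have key : BddInProb μ fun p => √(p.1 : ℝ) •
      (avg (fold (κ p.1 p.2) (fun i => Z i p.2) j) ψ - ∫ z, ψ z ∂P) := by
    refine bddInProb_of_sq_le (c := (5 : ℕ) * ∫⁻ z, ‖ψ z‖ₑ ^ 2 ∂P)
      (ENNReal.mul_ne_top (ENNReal.natCast_ne_top 5) hc) ?_
    filter_upwards [eventually_ge_atTop 3] with n hn K hK
    refine le_trans (mul_le_mul_right (measure_mono fun ω hω => ?_) _)
      (h.fold_chebyshev hn hj' hj' (φ := fun _ => ψ) (hψm.comp measurable_snd) MeasurableSet.univ hc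
        (fun _ _ => le_rfl) hK.le)
    exact ⟨trivial, le_of_lt hω⟩
  refine key.congr' ?_
  filter_upwards [(h.lawOfLargeNumbers_fold j).ae _ hψ] with p hp
  rw [avg_congr hp, integral_congr_ae hψ]

lemma bddInProb_unlabeled (h : IsSplitSample μ P Q Z U κ ξ) {N : ℕ → ℕ} {q : ℕ}
    (hq : ∀ᶠ n in atTop, n ≤ q * N n) {φ : β → ℝ} (hφm : Measurable φ) (hφ : MemLp φ 2 Q) :
    BddInProb μ fun p => √(p.1 : ℝ) •
      (avg (firstPoints (N p.1) (fun i => U i p.2)) φ - ∫ z, φ z ∂Q) := by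
  have hc : ∫⁻ z, ‖φ z‖ₑ ^ 2 ∂Q ≠ ⊤ := by
    have := (eLpNorm_lt_top_iff_lintegral_rpow_enorm_lt_top (by norm_num) (by norm_num)).1 hφ.2
    simpa using this.ne
  refine bddInProb_of_sq_le (c := q * ∫⁻ z, ‖φ z‖ₑ ^ 2 ∂Q)
    (ENNReal.mul_ne_top (ENNReal.natCast_ne_top q) hc) ?_
  filter_upwards [hq] with n hn K hK
  refine le_trans (mul_le_mul_right (measure_mono fun ω hω => ?_) _)
    (h.unlabeled_chebyshev hn 0 0 (φ := fun _ => φ) (hφm.comp measurable_snd) MeasurableSet.univ hc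
      (fun _ _ => le_rfl) hK.le)
  exact ⟨trivial, le_of_lt hω⟩

end IsSplitSample

end SplitSample

end RePPI

namespace RePPI

/-! ### Convergence in probability from conditional Chebyshev bounds. -/

section ConditionalConvergence

variable {Ω : Type*} [MeasurableSpace Ω] {μ : Measure Ω}

/-- A random sequence tends to zero in probability if it satisfies a Chebyshev inequality
conditionally on an event of probability tending to one, with a small constant. -/
lemma tendsto_zero_of_conditional {E : Type*} [NormedAddCommGroup E] {X : ℕ × Ω → E}
    {err : ℕ → Ω → ℝ≥0∞}
    (herr : ∀ δ : ℝ≥0∞, 0 < δ → Tendsto (fun n => μ {ω | δ ≤ err n ω}) atTop (𝓝 0))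
    (q : ℕ)
    (h : ∀ ε : ℝ, 0 < ε → ∃ C : ℝ≥0∞, C ≠ 0 ∧ C ≠ ⊤ ∧ ∀ δ : ℝ≥0∞, δ ≠ ⊤ → ∀ᶠ n in atTop,
      C * μ {ω | err n ω ≤ δ ∧ ε ≤ ‖X (n, ω)‖} ≤ q * δ) :
    Tendsto X (probFilter μ) (𝓝 0) := by
  refine tendsto_zero_probFilter_of_le fun ε hε η hη => ?_
  rcases eq_or_ne η ⊤ with rfl | hηt
  · simp
  obtain ⟨C, hC0, hCt, hC⟩ := h ε hε
  have h2 : 0 < η / 2 := ENNReal.half_pos hη.ne'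
  have h2t : η / 2 ≠ ⊤ := ENNReal.div_ne_top hηt (by norm_num)
  -- Chosen so that `q * δ ≤ C * (η / 2)`; the `+ 1` covers `q = 0`.
  set δ : ℝ≥0∞ := C * (η / 2) / (q + 1) with hδ
  have hq0 : (q : ℝ≥0∞) + 1 ≠ 0 := by simp
  have hqt : (q : ℝ≥0∞) + 1 ≠ ⊤ := by simp
  have hδ0 : 0 < δ := ENNReal.div_pos (mul_ne_zero hC0 h2.ne') hqt
  have hδt : δ ≠ ⊤ := ENNReal.div_ne_top (ENNReal.mul_ne_top hCt h2t) hq0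
  have hqδ : q * δ ≤ C * (η / 2) := by
    calc q * δ ≤ (q + 1) * δ := mul_le_mul_left le_self_add _
      _ = C * (η / 2) := ENNReal.mul_div_cancel hq0 hqt
  filter_upwards [hC δ hδt, ENNReal.tendsto_nhds_zero.1 (herr δ hδ0) _ h2] with n h3 h4
  have h5 : μ {ω | err n ω ≤ δ ∧ ε ≤ ‖X (n, ω)‖} ≤ η / 2 :=
    (ENNReal.mul_le_mul_iff_right hC0 hCt).1 (h3.trans hqδ)
  calc μ {ω | ε ≤ ‖X (n, ω)‖}
      ≤ μ ({ω | err n ω ≤ δ ∧ ε ≤ ‖X (n, ω)‖} ∪ {ω | δ ≤ err n ω}) := by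
        refine measure_mono fun ω hω => ?_
        rcases le_total (err n ω) δ with hle | hle
        · exact Or.inl ⟨hle, hω⟩
        · exact Or.inr hle
    _ ≤ η / 2 + η / 2 := (measure_union_le _ _).trans (add_le_add h5 h4)
    _ = η := ENNReal.add_halves η

end ConditionalConvergence

section Coordinates

variable {d : ℕ}

lemma enorm_coord_le (x : Vec d) (i : Fin d) : ‖x i‖ₑ ≤ ‖x‖ₑ := by
  rw [← ofReal_norm, ← ofReal_norm]
  exact ENNReal.ofReal_le_ofReal (PiLp.norm_apply_le x i)

lemma tendsto_vec_of_coord {ι : Type*} {l : Filter ι} {X : ι → Vec d} {x : Vec d}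
    (h : ∀ i, Tendsto (fun p => X p i) l (𝓝 (x i))) : Tendsto X l (𝓝 x) := by
  have h1 : Tendsto (fun p => WithLp.ofLp (X p)) l (𝓝 (WithLp.ofLp x)) := tendsto_pi_nhds.2 h
  exact ((PiLp.continuous_toLp 2 (fun _ : Fin d => ℝ)).tendsto _).comp h1

lemma avg_coord {γ : Type*} (D : Dataset γ) (f : γ → Vec d) (i : Fin d) :
    avg D f i = avg D (fun z => f z i) :=
  (avg_map D (EuclideanSpace.proj i : Vec d →L[ℝ] ℝ).toLinearMap f).symm

end Coordinates

section ExtendedAverage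

variable {α 𝒜 : Type*}

/-- The sample average of an extended nonnegative function. -/
noncomputable def eavg (D : Dataset α) (ψ : α → ℝ≥0∞) : ℝ≥0∞ := (D.1 : ℝ≥0∞)⁻¹ * ∑ t, ψ (D.2 t)

lemma ofReal_avg_le_eavg (D : Dataset α) {ψ : α → ℝ} (hψ : ∀ z, 0 ≤ ψ z) :
    ENNReal.ofReal (avg D ψ) ≤ eavg D fun z => ENNReal.ofReal (ψ z) := by
  obtain ⟨m, x⟩ := D
  rcases Nat.eq_zero_or_pos m with rfl | h0
  · simp [avg]
  simp only [avg_mk, eavg, smul_eq_mul]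
  rw [ENNReal.ofReal_mul (by positivity), ENNReal.ofReal_inv_of_pos (by positivity),
    ENNReal.ofReal_natCast, ENNReal.ofReal_sum_of_nonneg fun t _ => hψ _]

variable [MeasurableSpace α] [MeasurableSpace 𝒜]

lemma measurable_eavg {m : ℕ} {ψ : 𝒜 → α → ℝ≥0∞}
    (hψ : Measurable fun v : 𝒜 × α => ψ v.1 v.2) :
    Measurable fun v : 𝒜 × (Fin m → α) => eavg ⟨m, v.2⟩ (ψ v.1) := by
  have hm : ∀ t : Fin m, Measurable fun v : 𝒜 × (Fin m → α) => ψ v.1 (v.2 t) := fun t =>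
    hψ.comp (measurable_fst.prodMk ((measurable_pi_apply t).comp measurable_snd))
  change Measurable fun v : 𝒜 × (Fin m → α) => (m : ℝ≥0∞)⁻¹ * ∑ t : Fin m, ψ v.1 (v.2 t)
  exact (Finset.measurable_fun_sum _ fun t _ => hm t).const_mul _

lemma lintegral_pi_eavg_le {P : Measure α} [IsProbabilityMeasure P] (m : ℕ) {ψ : α → ℝ≥0∞}
    (hψ : Measurable ψ) :
    ∫⁻ x, eavg ⟨m, x⟩ ψ ∂(Measure.pi fun _ : Fin m => P) ≤ ∫⁻ z, ψ z ∂P :=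
  lintegral_pi_avg_le m hψ

end ExtendedAverage

/-! ### Averages of functions fitted on independent training data. -/

section FittedFunctions

variable {α Ω Ξ β 𝒮 : Type*} [MeasurableSpace α] [MeasurableSpace β] [MeasurableSpace Ω]
  [MeasurableSpace Ξ] [MeasurableSpace 𝒮]
  {μ : Measure Ω} [IsProbabilityMeasure μ]
  {P : Measure α} [IsProbabilityMeasure P] {Q : Measure β} [IsProbabilityMeasure Q]
  {Z : ℕ → Ω → α} {U : ℕ → Ω → β} {κ : (n : ℕ) → Ω → Fin n → Fin 3} {ξ : ℕ → Fin 3 → Ω → Ξ}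
  {d : ℕ} {φ : ℕ → (Fin 3 → Ξ) × Dataset α × Dataset α → 𝒮 → Vec d}
  {pL : α → 𝒮} {pU : β → 𝒮} {j j₁ j₂ : Fin 3}

namespace IsSplitSample

lemma measurable_lintegral_sq (hφ : ∀ n, Measurable (Function.uncurry (φ n)))
    (hpL : Measurable pL) (n : ℕ) : Measurable fun a => ∫⁻ z, ‖φ n a (pL z)‖ₑ ^ 2 ∂P := by
  have : Measurable fun v : ((Fin 3 → Ξ) × Dataset α × Dataset α) × α => ‖φ n v.1 (pL v.2)‖ₑ ^ 2 :=
    ((hφ n).comp (measurable_fst.prodMk (hpL.comp measurable_snd))).enorm.pow_const 2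
  exact this.lintegral_prod_right'

/-- Given the training data, the mean of this average is at most the `L²` error of the fitted
function, so Markov's inequality applies. -/
lemma tendsto_avg_sq_fold (h : IsSplitSample μ P Q Z U κ ξ) (h₁ : j₁ ≠ j) (h₂ : j₂ ≠ j)
    (hφ : ∀ n, Measurable (Function.uncurry (φ n))) (hpL : Measurable pL)
    (hlim : ∀ δ : ℝ≥0∞, 0 < δ → Tendsto (fun n => μ {ω | δ ≤ ∫⁻ z,
      ‖φ n (trainingData Z ξ n j₁ j₂ (κ n ω) ω) (pL z)‖ₑ ^ 2 ∂P}) atTop (𝓝 0)) :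
    Tendsto (fun p : ℕ × Ω => avg (fold (κ p.1 p.2) (fun i => Z i p.2) j)
      (fun z => ‖φ p.1 (trainingData Z ξ p.1 j₁ j₂ (κ p.1 p.2) p.2) (pL z)‖ ^ 2))
      (probFilter μ) (𝓝 0) := by
  refine tendsto_zero_of_conditional hlim 1 fun ε hε =>
    ⟨ENNReal.ofReal ε, (ENNReal.ofReal_pos.2 hε).ne', ENNReal.ofReal_ne_top, fun δ _ =>
      Eventually.of_forall fun n => ?_⟩
  rw [Nat.cast_one, one_mul]
  have hmeas : Measurable fun v : ((Fin 3 → Ξ) × Dataset α × Dataset α) × α =>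
      ‖φ n v.1 (pL v.2)‖ₑ ^ 2 :=
    ((hφ n).comp (measurable_fst.prodMk (hpL.comp measurable_snd))).enorm.pow_const 2
  have hG : ∀ m, Measurable fun v : ((Fin 3 → Ξ) × Dataset α × Dataset α) × (Fin m → α) =>
      eavg ⟨m, v.2⟩ (fun z => ‖φ n v.1 (pL z)‖ₑ ^ 2) := fun m =>
    measurable_eavg (m := m) (ψ := fun a z => ‖φ n a (pL z)‖ₑ ^ 2) hmeas
  have hc : ∀ m, n ≤ 3 * m + 2 → ∀ a ∈ {a | ∫⁻ z, ‖φ n a (pL z)‖ₑ ^ 2 ∂P ≤ δ},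
      ∫⁻ x, eavg ⟨m, x⟩ (fun z => ‖φ n a (pL z)‖ₑ ^ 2) ∂(Measure.pi fun _ : Fin m => P) ≤ δ := by
    intro m _ a ha
    have ha' : ∫⁻ z, ‖φ n a (pL z)‖ₑ ^ 2 ∂P ≤ δ := ha
    have hma : Measurable fun z => ‖φ n a (pL z)‖ₑ ^ 2 := by
      have h0 : Measurable (φ n a) := (hφ n).comp (measurable_prodMk_left (x := a))
      exact (h0.comp hpL).enorm.pow_const 2
    exact (lintegral_pi_eavg_le (P := P) m hma).trans ha'
  refine h.fold_markov (n := n) (ε := ENNReal.ofReal ε) h₁ h₂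
    (G := fun a D => eavg D fun z => ‖φ n a (pL z)‖ₑ ^ 2)
    hG (measurableSet_le (measurable_lintegral_sq hφ hpL n) measurable_const) hc ?_
  rintro ω ⟨hωE, hω⟩
  refine ⟨hωE, (ENNReal.ofReal_le_ofReal hω).trans ?_⟩
  rw [Real.norm_of_nonneg (avg_nonneg fun t => by positivity)]
  refine (ofReal_avg_le_eavg _ fun z => by positivity).trans (le_of_eq ?_)
  have he : ∀ z, ENNReal.ofReal
      (‖φ n (trainingData Z ξ n j₁ j₂ (κ n ω) ω) (pL z)‖ ^ 2) =
      ‖φ n (trainingData Z ξ n j₁ j₂ (κ n ω) ω) (pL z)‖ₑ ^ 2 := fun z => by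
    rw [ENNReal.ofReal_pow (norm_nonneg _), ofReal_norm]
  simp only [he]

/-- The fluctuations of the labeled and the unlabeled averages of the fitted functions cancel up to
a term that is negligible at the parametric rate. -/
lemma tendsto_sqrt_smul_avg_sub_avg (h : IsSplitSample μ P Q Z U κ ξ) (h₁ : j₁ ≠ j) (h₂ : j₂ ≠ j)
    (hφ : ∀ n, Measurable (Function.uncurry (φ n))) (hpL : Measurable pL) (hpU : Measurable pU)
    (hPQ : P.map pL = Q.map pU) {N : ℕ → ℕ} {q : ℕ} (hq : ∀ᶠ n in atTop, n ≤ q * N n)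
    (hlim : ∀ δ : ℝ≥0∞, 0 < δ → Tendsto (fun n => μ {ω | δ ≤ ∫⁻ z,
      ‖φ n (trainingData Z ξ n j₁ j₂ (κ n ω) ω) (pL z)‖ₑ ^ 2 ∂P}) atTop (𝓝 0)) :
    Tendsto (fun p : ℕ × Ω => √(p.1 : ℝ) • (avg (fold (κ p.1 p.2) (fun i => Z i p.2) j)
        (fun z => φ p.1 (trainingData Z ξ p.1 j₁ j₂ (κ p.1 p.2) p.2) (pL z)) -
      avg (firstPoints (N p.1) (fun i => U i p.2))
        (fun u => φ p.1 (trainingData Z ξ p.1 j₁ j₂ (κ p.1 p.2) p.2) (pU u))))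
      (probFilter μ) (𝓝 0) := by
  refine tendsto_vec_of_coord fun i => ?_
  have hcoord : ∀ n, Measurable (Function.uncurry fun a v => φ n a v i) := fun n =>
    (EuclideanSpace.proj i : Vec d →L[ℝ] ℝ).continuous.measurable.comp (hφ n)
  have hL : ∀ n, Measurable (Function.uncurry fun a z => φ n a (pL z) i) := fun n =>
    (hcoord n).comp (measurable_fst.prodMk (hpL.comp measurable_snd))
  have hU : ∀ n, Measurable (Function.uncurry fun a u => φ n a (pU u) i) := fun n =>
    (hcoord n).comp (measurable_fst.prodMk (hpU.comp measurable_snd))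
  -- `pL` and `pU` have the same law, so the two conditional means agree whatever the fitted
  -- function; only fluctuations about them remain.
  have hint : ∀ n a, ∫ z, φ n a (pL z) i ∂P = ∫ u, φ n a (pU u) i ∂Q := by
    intro n a
    have hm : Measurable fun v => φ n a v i := (hcoord n).comp measurable_prodMk_left
    rw [← integral_map hpL.aemeasurable (f := fun v => φ n a v i) hm.aestronglyMeasurable,
      hPQ, integral_map hpU.aemeasurable hm.aestronglyMeasurable]
  have hlint : ∀ n a, ∫⁻ z, ‖φ n a (pL z)‖ₑ ^ 2 ∂P = ∫⁻ u, ‖φ n a (pU u)‖ₑ ^ 2 ∂Q := by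
    intro n a
    have hm : Measurable fun v => ‖φ n a v‖ₑ ^ 2 :=
      ((hφ n).comp measurable_prodMk_left).enorm.pow_const 2
    rw [← lintegral_map hm hpL, hPQ, lintegral_map hm hpU]
  have hE : ∀ n (δ : ℝ≥0∞), MeasurableSet {a | ∫⁻ z, ‖φ n a (pL z)‖ₑ ^ 2 ∂P ≤ δ} := fun n δ =>
    measurableSet_le (measurable_lintegral_sq hφ hpL n) measurable_const
  -- For `n ≥ 3`, the conditional second moment of this fluctuation is at most `5` times the `L²`
  -- error, which tends to zero in probability.
  have key₁ : Tendsto (fun p : ℕ × Ω => √(p.1 : ℝ) • (avg (fold (κ p.1 p.2) (fun i => Z i p.2) j)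
        (fun z => φ p.1 (trainingData Z ξ p.1 j₁ j₂ (κ p.1 p.2) p.2) (pL z) i) -
      ∫ z, φ p.1 (trainingData Z ξ p.1 j₁ j₂ (κ p.1 p.2) p.2) (pL z) i ∂P))
      (probFilter μ) (𝓝 0) := by
    refine tendsto_zero_of_conditional hlim 5 fun ε hε => ⟨ENNReal.ofReal (ε ^ 2),
      (ENNReal.ofReal_pos.2 (pow_pos hε 2)).ne', ENNReal.ofReal_ne_top, fun δ hδ => ?_⟩
    filter_upwards [eventually_ge_atTop 3] with n hn
    exact h.fold_chebyshev hn h₁ h₂ (hL n) (hE n δ) hδ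
      (fun a ha => (lintegral_mono fun z => by gcongr; exact enorm_coord_le _ i).trans ha) hε.le
  have key₂ : Tendsto (fun p : ℕ × Ω => √(p.1 : ℝ) • (avg (firstPoints (N p.1) (fun i => U i p.2))
        (fun u => φ p.1 (trainingData Z ξ p.1 j₁ j₂ (κ p.1 p.2) p.2) (pU u) i) -
      ∫ u, φ p.1 (trainingData Z ξ p.1 j₁ j₂ (κ p.1 p.2) p.2) (pU u) i ∂Q))
      (probFilter μ) (𝓝 0) := by
    refine tendsto_zero_of_conditional hlim q fun ε hε => ⟨ENNReal.ofReal (ε ^ 2),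
      (ENNReal.ofReal_pos.2 (pow_pos hε 2)).ne', ENNReal.ofReal_ne_top, fun δ hδ => ?_⟩
    filter_upwards [hq] with n hn
    refine h.unlabeled_chebyshev hn j₁ j₂ (hU n) (hE n δ) hδ (fun a ha => ?_) hε.le
    refine le_trans (lintegral_mono fun z => ?_) ((hlint n a).symm.le.trans ha)
    gcongr; exact enorm_coord_le _ i
  have := key₁.sub key₂
  rw [sub_zero] at this
  refine this.congr fun p => ?_
  rw [hint]
  simp only [PiLp.smul_apply, PiLp.sub_apply, avg_coord, smul_eq_mul]
  ring

/-- The fitted functions are small compared to `√n`, uniformly on the fold. -/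
lemma eventually_fold_le_of_tendsto_avg_sq {f : ℕ × Ω → α → Vec d}
    (hf : Tendsto (fun p : ℕ × Ω => avg (fold (κ p.1 p.2) (fun i => Z i p.2) j)
      (fun z => ‖f p z‖ ^ 2)) (probFilter μ) (𝓝 0)) {ε : ℝ} (hε : 0 < ε) :
    ∀ᶠ p in probFilter μ, ∀ t,
      ‖f p ((fold (κ p.1 p.2) (fun i => Z i p.2) j).2 t)‖ ≤ ε * √(p.1 : ℝ) := by
  filter_upwards [hf.eventually (gt_mem_nhds (pow_pos hε 2))] with p hp t
  generalize hD : fold (κ p.1 p.2) (fun i => Z i p.2) j = D at hp t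
  have hDn : D.1 ≤ p.1 := by
    rw [← hD]
    exact (Finset.card_le_univ (foldIndices (κ p.1 p.2) j)).trans_eq (Fintype.card_fin _)
  have hD0 : 0 < D.1 := t.pos
  -- A single term is at most the sum, which is at most `n` times the average.
  have h1 : ‖f p (D.2 t)‖ ^ 2 ≤ ∑ t, ‖f p (D.2 t)‖ ^ 2 :=
    Finset.single_le_sum (f := fun t => ‖f p (D.2 t)‖ ^ 2) (fun _ _ => by positivity)
      (Finset.mem_univ t)
  have h2 : ∑ t, ‖f p (D.2 t)‖ ^ 2 = D.1 * avg D (fun z => ‖f p z‖ ^ 2) := by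
    have : (D.1 : ℝ) ≠ 0 := by positivity
    rw [avg, smul_eq_mul, ← mul_assoc, mul_inv_cancel₀ this, one_mul]
  refine le_of_sq_le_sq ?_ (by positivity)
  rw [mul_pow, Real.sq_sqrt (Nat.cast_nonneg _)]
  calc ‖f p (D.2 t)‖ ^ 2 ≤ D.1 * avg D (fun z => ‖f p z‖ ^ 2) := h1.trans h2.le
    _ ≤ p.1 * ε ^ 2 := mul_le_mul (by exact_mod_cast hDn) hp.le
        (avg_nonneg fun t => by positivity) (by positivity)
    _ = ε ^ 2 * p.1 := mul_comm _ _

/-- A square integrable function is small compared to `√n`, uniformly on the fold. -/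
lemma eventually_fold_le (h : IsSplitSample μ P Q Z U κ ξ) {g : α → Vec d} (hg : Measurable g)
    (hg2 : MemLp g 2 P) {ε : ℝ} (hε : 0 < ε) :
    ∀ᶠ p in probFilter μ, ∀ t,
      ‖g ((fold (κ p.1 p.2) (fun i => Z i p.2) j).2 t)‖ ≤ ε * √(p.1 : ℝ) := by
  have hlim := tendsto_mul_measure_gt (φ := fun z => ‖g z‖ ^ 2) (hg.norm.pow_const 2)
    (hg2.integrable_norm_pow (by norm_num)) (pow_pos hε 2)
  rw [eventually_probFilter]
  refine tendsto_of_tendsto_of_tendsto_of_le_of_le tendsto_const_nhds hlim (fun _ => zero_le)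
    fun n => ?_
  have hS : MeasurableSet {z | ε ^ 2 * n < |‖g z‖ ^ 2|} :=
    measurableSet_lt measurable_const (hg.norm.pow_const 2).abs
  -- Union bound over all `n` points, regardless of the random fold.
  calc μ {ω | ¬ ∀ t, ‖g ((fold (κ n ω) (fun i => Z i ω) j).2 t)‖ ≤ ε * √(n : ℝ)}
      ≤ μ (⋃ i : Fin n, Z i ⁻¹' {z | ε ^ 2 * n < |‖g z‖ ^ 2|}) := by
        refine measure_mono fun ω hω => ?_
        simp only [Set.mem_ofPred_eq, not_forall, not_le] at hω
        obtain ⟨t, ht⟩ := hω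
        refine Set.mem_iUnion.2 ⟨(foldIndices (κ n ω) j).orderEmbOfFin rfl t, ?_⟩
        have h1 := pow_lt_pow_left₀ ht (by positivity) two_ne_zero
        rw [mul_pow, Real.sq_sqrt (Nat.cast_nonneg _)] at h1
        exact h1.trans_le (le_abs_self _)
    _ ≤ ∑ i : Fin n, μ (Z i ⁻¹' {z | ε ^ 2 * n < |‖g z‖ ^ 2|}) := measure_iUnion_fintype_le _ _
    _ = (n : ℝ≥0∞) * P {z | ε ^ 2 * n < |‖g z‖ ^ 2|} := by
        have : ∀ i : Fin n, μ (Z i ⁻¹' {z | ε ^ 2 * n < |‖g z‖ ^ 2|}) =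
            P {z | ε ^ 2 * n < |‖g z‖ ^ 2|} := fun i => by
          rw [← Measure.map_apply (h.measurable_labeled i) hS, h.law_labeled]
        rw [Finset.sum_congr rfl fun i _ => this i]
        simp only [Finset.sum_const, Finset.card_univ, Fintype.card_fin, nsmul_eq_mul]

end IsSplitSample

end FittedFunctions

end RePPI

namespace RePPI

/-! ### Consistency of sample covariances. -/

section SampleCovariance

variable {Z ι : Type*} [MeasurableSpace Z] {P : Measure Z} [IsProbabilityMeasure P] {l : Filter ι}
  {D : ι → Dataset Z} {d : ℕ}

/-- For a single point both sides are zero, since division by zero gives zero; so nonemptiness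
suffices. -/
lemma sampleCov_apply {D : Dataset Z} (hD : 0 < D.1) (φ ψ : Z → Vec d) (i j : Fin d) :
    sampleCov D φ ψ i j = ((D.1 : ℝ) / ((D.1 : ℝ) - 1)) *
      (avg D (fun z => φ z i * ψ z j) - avg D (fun z => φ z i) * avg D (fun z => ψ z j)) := by
  have h0 : (D.1 : ℝ) ≠ 0 := by positivity
  simp only [sampleCov, Matrix.of_apply, avg_coord]
  have hs : ∀ χ : Z → ℝ, ∑ t, χ (D.2 t) = D.1 * avg D χ := fun χ => by
    rw [avg, smul_eq_mul, mul_inv_cancel_left₀ h0]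
  have h1 : ∑ t, (φ (D.2 t) i - avg D fun z => φ z i) * (ψ (D.2 t) j - avg D fun z => ψ z j) =
      D.1 * (avg D (fun z => φ z i * ψ z j) -
        avg D (fun z => φ z i) * avg D (fun z => ψ z j)) := by
    simp only [sub_mul, mul_sub, Finset.sum_sub_distrib, ← Finset.mul_sum, ← Finset.sum_mul,
      Finset.sum_const, Finset.card_univ, Fintype.card_fin, nsmul_eq_mul]
    rw [hs fun z => φ z i * ψ z j, hs fun z => φ z i, hs fun z => ψ z j]
    ring
  rw [h1]
  ring

lemma tendsto_sampleCov (hsize : Tendsto (fun p => (D p).1) l atTop)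
    {φ ψ : ι → Z → Vec d} {φ₀ ψ₀ : Z → Vec d} (hφ₀ : MemLp φ₀ 2 P) (hψ₀ : MemLp ψ₀ 2 P)
    (hφ : ∀ i, Tendsto (fun p => avg (D p) fun z => φ p z i) l (𝓝 (∫ z, φ₀ z i ∂P)))
    (hψ : ∀ i, Tendsto (fun p => avg (D p) fun z => ψ p z i) l (𝓝 (∫ z, ψ₀ z i ∂P)))
    (hφψ : ∀ i j, Tendsto (fun p => avg (D p) fun z => φ p z i * ψ p z j) l
      (𝓝 (∫ z, φ₀ z i * ψ₀ z j ∂P))) :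
    Tendsto (fun p => sampleCov (D p) (φ p) (ψ p)) l (𝓝 (crossCov P φ₀ ψ₀)) := by
  refine tendsto_pi_nhds.2 fun i => tendsto_pi_nhds.2 fun j => ?_
  have h1 : Tendsto (fun p => ((D p).1 : ℝ) / (((D p).1 : ℝ) - 1)) l (𝓝 1) := by
    have h2 : Tendsto (fun m : ℕ => (m : ℝ) / ((m : ℝ) + (-1))) atTop (𝓝 1) :=
      tendsto_natCast_div_add_atTop (-1 : ℝ)
    simpa only [← sub_eq_add_neg, Function.comp_def] using h2.comp hsize
  have hc : crossCov P φ₀ ψ₀ i j =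
      1 * (∫ z, φ₀ z i * ψ₀ z j ∂P - (∫ z, φ₀ z i ∂P) * ∫ z, ψ₀ z j ∂P) := by
    rw [one_mul, crossCov, Matrix.of_apply, covariance_eq_sub (hφ₀.eval_piLp i) (hψ₀.eval_piLp j)]
    rfl
  rw [hc]
  refine (h1.mul ((hφψ i j).sub ((hφ i).mul (hψ j)))).congr' ?_
  filter_upwards [hsize.eventually_gt_atTop 0] with p hp
  rw [sampleCov_apply hp]

/-- Cauchy–Schwarz for sample averages. -/
lemma tendsto_avg_mul_of_sq {a b : ι → Z → ℝ}
    (ha : Tendsto (fun p => avg (D p) fun z => a p z ^ 2) l (𝓝 0)) {B : ℝ}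
    (hb : Tendsto (fun p => avg (D p) fun z => b p z ^ 2) l (𝓝 B)) :
    Tendsto (fun p => avg (D p) fun z => a p z * b p z) l (𝓝 0) := by
  have h1 := ha.mul hb
  rw [zero_mul] at h1
  have h2 : Tendsto (fun p => (avg (D p) fun z => a p z * b p z) ^ 2) l (𝓝 0) :=
    squeeze_zero (fun p => sq_nonneg _) (fun p => avg_mul_sq_le _ _ _) h1
  have h3 := h2.sqrt
  simp only [Real.sqrt_sq_eq_abs, Real.sqrt_zero] at h3
  exact tendsto_zero_iff_abs_tendsto_zero _ |>.2 h3

lemma sq_coord_le (x : Vec d) (i : Fin d) : x i ^ 2 ≤ ‖x‖ ^ 2 := by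
  rw [← sq_abs (x i)]
  exact pow_le_pow_left₀ (abs_nonneg _) (PiLp.norm_apply_le x i) 2

variable {s : Z → Vec d} {shat : ι → Z → Vec d}

lemma tendsto_avg_sq_coord
    (hδ : Tendsto (fun p => avg (D p) fun z => ‖shat p z - s z‖ ^ 2) l (𝓝 0)) (i : Fin d) :
    Tendsto (fun p => avg (D p) fun z => (shat p z i - s z i) ^ 2) l (𝓝 0) :=
  squeeze_zero (fun _ => avg_nonneg fun _ => sq_nonneg _)
    (fun p => avg_mono fun t => sq_coord_le (shat p ((D p).2 t) - s ((D p).2 t)) i) hδ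

/-- Averages of products with a consistent estimate of a function. -/
lemma LawOfLargeNumbers.tendsto_avg_mul_coord (h : LawOfLargeNumbers P l D) (hs : MemLp s 2 P)
    (hδ : Tendsto (fun p => avg (D p) fun z => ‖shat p z - s z‖ ^ 2) l (𝓝 0))
    {φ : Z → ℝ} (hφ : MemLp φ 2 P) (j : Fin d) :
    Tendsto (fun p => avg (D p) fun z => φ z * shat p z j) l (𝓝 (∫ z, φ z * s z j ∂P)) := by
  have h1 := h.tendsto_avg (fun z => φ z * s z j) (hφ.integrable_mul (hs.eval_piLp j))
  have h2 := tendsto_avg_mul_of_sq (tendsto_avg_sq_coord hδ j) (b := fun _ => φ)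
    (h.tendsto_avg (fun z => φ z ^ 2) hφ.integrable_sq)
  have h3 := h1.add h2
  rw [add_zero] at h3
  refine h3.congr fun p => ?_
  rw [← avg_add]
  congr 1; ext z; ring

lemma LawOfLargeNumbers.tendsto_avg_coord (h : LawOfLargeNumbers P l D) (hs : MemLp s 2 P)
    (hδ : Tendsto (fun p => avg (D p) fun z => ‖shat p z - s z‖ ^ 2) l (𝓝 0)) (j : Fin d) :
    Tendsto (fun p => avg (D p) fun z => shat p z j) l (𝓝 (∫ z, s z j ∂P)) := by
  simpa using h.tendsto_avg_mul_coord hs hδ (memLp_const (1 : ℝ)) j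

lemma LawOfLargeNumbers.tendsto_avg_coord_mul_coord (h : LawOfLargeNumbers P l D)
    (hs : MemLp s 2 P)
    (hδ : Tendsto (fun p => avg (D p) fun z => ‖shat p z - s z‖ ^ 2) l (𝓝 0)) (i j : Fin d) :
    Tendsto (fun p => avg (D p) fun z => shat p z i * shat p z j) l
      (𝓝 (∫ z, s z i * s z j ∂P)) := by
  have h1 := h.tendsto_avg_mul_coord hs hδ (hs.eval_piLp i) j
  have h2 := tendsto_avg_mul_of_sq (tendsto_avg_sq_coord hδ i) (tendsto_avg_sq_coord hδ j)
  have h3 := tendsto_avg_mul_of_sq (tendsto_avg_sq_coord hδ i) (b := fun _ z => s z j)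
    (h.tendsto_avg (fun z => s z j ^ 2) (hs.eval_piLp j).integrable_sq)
  have h4 := h1.add (h2.add h3)
  rw [add_zero, add_zero] at h4
  refine h4.congr fun p => ?_
  rw [← avg_add, ← avg_add]
  congr 1; ext z; ring

end SampleCovariance

/-! ### Consistency of the tuning matrix. -/

section TuningMatrix

open Metric

variable {𝒳 𝒲 𝒴 𝒱 ι : Type*} [MeasurableSpace 𝒳] [MeasurableSpace 𝒲] [MeasurableSpace 𝒴]
  [MeasurableSpace 𝒱] {d : ℕ}
  {P : Measure (𝒳 × 𝒲 × 𝒴)} [IsProbabilityMeasure P] {Θ : Set (Vec d)}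
  {ℓ : Vec d → 𝒳 → 𝒴 → ℝ} {θs : Vec d} {R : ℝ} {M₁ M₃ : 𝒳 × 𝒲 × 𝒴 → ℝ}
  {l : Filter ι} {D : ι → Dataset (𝒳 × 𝒲 × 𝒴)} {θ₀ : ι → Vec d}

namespace RegularOnBall

lemma eventually_gradLoss_sub_le (hR : RegularOnBall P Θ ℓ θs R M₁ M₃)
    (h : LawOfLargeNumbers P l D) (hθ : Tendsto θ₀ l (𝓝 θs)) :
    ∀ᶠ p in l, ∀ t, ‖gradLoss ℓ (θ₀ p) ((D p).2 t) - gradLoss ℓ θs ((D p).2 t)‖ ≤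
      M₃ ((D p).2 t) * ‖θ₀ p - θs‖ := by
  filter_upwards [h.ae _ hR.gradient_lipschitz, hθ.eventually (closedBall_mem_nhds θs hR.pos)]
    with p hp hp' t
  exact hp t _ hp' _ (mem_closedBall_self hR.pos.le)

lemma tendsto_avg_gradLoss_coord (hR : RegularOnBall P Θ ℓ θs R M₁ M₃)
    (h : LawOfLargeNumbers P l D) (hθ : Tendsto θ₀ l (𝓝 θs)) (i : Fin d) :
    Tendsto (fun p => avg (D p) fun z => gradLoss ℓ (θ₀ p) z i) l
      (𝓝 (∫ z, gradLoss ℓ θs z i ∂P)) := by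
  have hint := (hR.hasGradientAt (mem_ball_self hR.pos)).1
  have h1 := h.tendsto_avg (fun z => gradLoss ℓ θs z i)
    ((EuclideanSpace.proj i : Vec d →L[ℝ] ℝ).integrable_comp hint)
  have h2 : Tendsto (fun p => avg (D p) fun z => gradLoss ℓ (θ₀ p) z i - gradLoss ℓ θs z i) l
      (𝓝 0) := by
    have h3 : Tendsto (fun p => avg (D p) M₃ * ‖θ₀ p - θs‖) l (𝓝 0) := by
      have := (h.tendsto_avg M₃ hR.integrable₃).mul (tendsto_iff_norm_sub_tendsto_zero.1 hθ)
      rwa [mul_zero] at this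
    refine squeeze_zero_norm' ?_ h3
    filter_upwards [hR.eventually_gradLoss_sub_le h hθ] with p hp
    refine (norm_avg_le _ _).trans ?_
    have : avg (D p) (fun z => M₃ z * ‖θ₀ p - θs‖) = avg (D p) M₃ * ‖θ₀ p - θs‖ :=
      avg_map (D p) (LinearMap.mulRight ℝ ‖θ₀ p - θs‖) M₃
    rw [← this]
    exact avg_mono fun t => (PiLp.norm_apply_le (gradLoss ℓ (θ₀ p) ((D p).2 t) -
      gradLoss ℓ θs ((D p).2 t)) i).trans (hp t)
  have h4 := h1.add h2
  rw [add_zero] at h4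
  refine h4.congr fun p => ?_
  rw [← avg_add]
  congr 1; ext z; ring

variable {s : 𝒳 × 𝒲 × 𝒴 → Vec d} {shat : ι → 𝒳 × 𝒲 × 𝒴 → Vec d}

/-- Since `M₃` is only integrable, Cauchy–Schwarz cannot separate the gradient increment from
`shat`. Instead the increment is bounded by `M₃ * ‖θ₀ - θs‖` and the product `‖θ₀ - θs‖ * ‖shat‖` is
small uniformly on the sample, which is `hmax`; the average of `M₃` stays bounded. -/
lemma tendsto_avg_gradLoss_mul (hR : RegularOnBall P Θ ℓ θs R M₁ M₃)
    (h : LawOfLargeNumbers P l D) (hθ : Tendsto θ₀ l (𝓝 θs)) (hg : MemLp (gradLoss ℓ θs) 2 P)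
    (hs : MemLp s 2 P) (hδ : Tendsto (fun p => avg (D p) fun z => ‖shat p z - s z‖ ^ 2) l (𝓝 0))
    (hmax : ∀ ε : ℝ, 0 < ε → ∀ᶠ p in l, ∀ t, ‖θ₀ p - θs‖ * ‖shat p ((D p).2 t)‖ ≤ ε)
    (i j : Fin d) :
    Tendsto (fun p => avg (D p) fun z => gradLoss ℓ (θ₀ p) z i * shat p z j) l
      (𝓝 (∫ z, gradLoss ℓ θs z i * s z j ∂P)) := by
  have h1 := h.tendsto_avg_mul_coord hs hδ (hg.eval_piLp i) j
  have h2 : Tendsto (fun p => avg (D p) fun z =>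
      (gradLoss ℓ (θ₀ p) z i - gradLoss ℓ θs z i) * shat p z j) l (𝓝 0) := by
    rw [Metric.tendsto_nhds]
    intro ε hε
    have hM := h.tendsto_avg M₃ hR.integrable₃
    set m := ∫ z, M₃ z ∂P with hm
    have hm0 : 0 ≤ m := integral_nonneg hR.nonneg₃
    filter_upwards [hR.eventually_gradLoss_sub_le h hθ,
      hmax (ε / (2 * (m + 1))) (by positivity), hM.eventually (gt_mem_nhds (lt_add_one m))]
      with p hp hp' hMp
    rw [dist_zero_right]
    calc ‖avg (D p) fun z => (gradLoss ℓ (θ₀ p) z i - gradLoss ℓ θs z i) * shat p z j‖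
        ≤ avg (D p) fun z => ‖(gradLoss ℓ (θ₀ p) z i - gradLoss ℓ θs z i) * shat p z j‖ :=
          norm_avg_le _ _
      _ ≤ avg (D p) fun z => M₃ z * (ε / (2 * (m + 1))) := by
          refine avg_mono fun t => ?_
          rw [norm_mul]
          calc _ ≤ (M₃ ((D p).2 t) * ‖θ₀ p - θs‖) * ‖shat p ((D p).2 t)‖ :=
                mul_le_mul ((PiLp.norm_apply_le (gradLoss ℓ (θ₀ p) ((D p).2 t) -
                  gradLoss ℓ θs ((D p).2 t)) i).trans (hp t)) (PiLp.norm_apply_le _ j)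
                  (norm_nonneg _) (mul_nonneg (hR.nonneg₃ _) (norm_nonneg _))
            _ = M₃ ((D p).2 t) * (‖θ₀ p - θs‖ * ‖shat p ((D p).2 t)‖) := mul_assoc _ _ _
            _ ≤ _ := mul_le_mul_of_nonneg_left (hp' t) (hR.nonneg₃ _)
      _ = avg (D p) M₃ * (ε / (2 * (m + 1))) :=
          avg_map (D p) (LinearMap.mulRight ℝ (ε / (2 * (m + 1)))) M₃
      _ ≤ (m + 1) * (ε / (2 * (m + 1))) := by gcongr
      _ = ε / 2 := by field_simp
      _ < ε := half_lt_self hε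
  have h4 := h1.add h2
  rw [add_zero] at h4
  refine h4.congr fun p => ?_
  rw [← avg_add]
  congr 1; ext z; ring

/-- Consistency of the tuning matrix. -/
lemma tendsto_tuningMatrix (hR : RegularOnBall P Θ ℓ θs R M₁ M₃)
    (h : LawOfLargeNumbers P l D) (hsize : Tendsto (fun p => (D p).1) l atTop)
    (hθ : Tendsto θ₀ l (𝓝 θs)) (hg : MemLp (gradLoss ℓ θs) 2 P)
    {f : 𝒳 × 𝒲 → 𝒱} {s : 𝒳 × 𝒱 → Vec d} {shat : ι → 𝒳 × 𝒱 → Vec d}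
    (hs : MemLp (fun z => s (predL f z)) 2 P)
    (hcov : (crossCov P (fun z => s (predL f z)) fun z => s (predL f z)).PosDef)
    (hδ : Tendsto (fun p => avg (D p) fun z => ‖shat p (predL f z) - s (predL f z)‖ ^ 2) l (𝓝 0))
    (hmax : ∀ ε : ℝ, 0 < ε →
      ∀ᶠ p in l, ∀ t, ‖θ₀ p - θs‖ * ‖shat p (predL f ((D p).2 t))‖ ≤ ε) :
    Tendsto (fun p => tuningMatrix ℓ f (D p) (θ₀ p) (shat p)) l
      (𝓝 (crossCov P (gradLoss ℓ θs) (fun z => s (predL f z)) *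
        (crossCov P (fun z => s (predL f z)) fun z => s (predL f z))⁻¹)) := by
  have h1 := tendsto_sampleCov hsize (φ := fun p => gradLoss ℓ (θ₀ p))
    (ψ := fun p z => shat p (predL f z)) hg hs (hR.tendsto_avg_gradLoss_coord h hθ)
    (h.tendsto_avg_coord (shat := fun p z => shat p (predL f z)) hs hδ)
    (hR.tendsto_avg_gradLoss_mul (shat := fun p z => shat p (predL f z)) h hθ hg hs hδ hmax)
  have h2 := tendsto_sampleCov hsize (φ := fun p z => shat p (predL f z))
    (ψ := fun p z => shat p (predL f z)) hs hs
    (h.tendsto_avg_coord (shat := fun p z => shat p (predL f z)) hs hδ)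
    (h.tendsto_avg_coord (shat := fun p z => shat p (predL f z)) hs hδ)
    (h.tendsto_avg_coord_mul_coord (shat := fun p z => shat p (predL f z)) hs hδ)
  -- Inversion is continuous at the invertible limit `Cov(s)`; singular sample covariances at finite
  -- `n` do not matter.
  refine Tendsto.mul h1 ((continuousAt_matrix_inv _ ?_).tendsto.comp h2)
  rw [Ring.inverse_eq_inv']
  exact continuousAt_inv₀ hcov.det_pos.ne'

end RegularOnBall

end TuningMatrix

end RePPI

namespace RePPI

/-! ### Vector-valued boundedness in probability. -/

section VectorBounds

variable {Ω : Type*} [MeasurableSpace Ω] {μ : Measure Ω} {d : ℕ}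

lemma bddInProb_finset_sum {ι E : Type*} [NormedAddCommGroup E] (S : Finset ι)
    {X : ι → ℕ × Ω → E} (h : ∀ i, BddInProb μ (X i)) :
    BddInProb μ fun p => ∑ i ∈ S, X i p := by
  classical
  induction S using Finset.induction_on with
  | empty =>
    simp only [Finset.sum_empty]
    exact bddInProb_of_tendsto tendsto_const_nhds
  | insert a S ha ih => simpa only [Finset.sum_insert ha] using (h a).add ih

lemma bddInProb_vec_of_coord {X : ℕ × Ω → Vec d} (h : ∀ i, BddInProb μ fun p => X p i) :
    BddInProb μ X := by
  have h1 : BddInProb μ fun p => ∑ i, X p i • EuclideanSpace.single i (1 : ℝ) :=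
    bddInProb_finset_sum _ fun i => (h i).of_isBigO (Asymptotics.IsBigO.of_bound 1
      (Eventually.of_forall fun p => by rw [norm_smul]; simp))
  refine h1.congr' (Eventually.of_forall fun p => ?_)
  ext j
  simp [Pi.single_apply]

lemma integral_coord {α : Type*} [MeasurableSpace α] {P : Measure α} {φ : α → Vec d}
    (hφ : Integrable φ P) (i : Fin d) : (∫ z, φ z ∂P) i = ∫ z, φ z i ∂P :=
  ((EuclideanSpace.proj i : Vec d →L[ℝ] ℝ).integral_comp_comm hφ).symm

lemma BddInProb.smul_of_le_one {E : Type*} [NormedAddCommGroup E] [NormedSpace ℝ E]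
    {X : ℕ × Ω → E} (hX : BddInProb μ X) {w : ℕ × Ω → ℝ} (hw : ∀ p, |w p| ≤ 1) :
    BddInProb μ fun p => w p • X p :=
  hX.of_isBigO (Asymptotics.IsBigO.of_bound 1 (Eventually.of_forall fun p => by
    rw [norm_smul, Real.norm_eq_abs]
    exact mul_le_mul_of_nonneg_right (hw p) (norm_nonneg _)))

lemma tendsto_inv_sqrt_probFilter :
    Tendsto (fun p : ℕ × Ω => (√(p.1 : ℝ))⁻¹) (probFilter μ) (𝓝 0) :=
  (tendsto_inv_atTop_zero.comp (Real.tendsto_sqrt_atTop.comp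
    tendsto_natCast_atTop_atTop)).comp tendsto_fst_probFilter

lemma BddInProb.tendsto_of_sqrt_smul {X : ℕ × Ω → Vec d}
    (hX : BddInProb μ fun p => √(p.1 : ℝ) • X p) : Tendsto X (probFilter μ) (𝓝 0) := by
  refine (hX.tendsto_smul tendsto_inv_sqrt_probFilter).congr' ?_
  filter_upwards [tendsto_fst_probFilter.eventually_gt_atTop 0] with p hp
  have : √(p.1 : ℝ) ≠ 0 := (Real.sqrt_pos.2 (by exact_mod_cast hp)).ne'
  rw [smul_smul, inv_mul_cancel₀ this, one_smul]

end VectorBounds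

/-! ### Recombination of the folds. -/

section FoldAverages

variable {α : Type*} {E : Type*} [NormedAddCommGroup E] [NormedSpace ℝ E] {n : ℕ}

/-- The weight of the fold `j`. -/
noncomputable def foldWeight (κ₀ : Fin n → Fin 3) (j : Fin 3) : ℝ :=
  ((foldIndices κ₀ j).card : ℝ) / n

lemma sum_foldWeight (hn : 0 < n) (κ₀ : Fin n → Fin 3) : ∑ j, foldWeight κ₀ j = 1 := by
  have h : (n : ℝ) ≠ 0 := by positivity
  simp only [foldWeight]
  rw [← Finset.sum_div, ← Nat.cast_sum, sum_card_foldIndices, div_self h]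

lemma abs_foldWeight_le (κ₀ : Fin n → Fin 3) (j : Fin 3) : |foldWeight κ₀ j| ≤ 1 := by
  rw [foldWeight, abs_of_nonneg (by positivity)]
  refine div_le_one_of_le₀ ?_ (by positivity)
  exact_mod_cast (Finset.card_le_univ _).trans_eq (Fintype.card_fin _)

lemma EvenSplit.abs_foldWeight_sub_le {κ₀ : Fin n → Fin 3} (h : EvenSplit κ₀) (j j' : Fin 3) :
    |foldWeight κ₀ j - foldWeight κ₀ j'| ≤ (n : ℝ)⁻¹ := by
  have h1 : ((foldIndices κ₀ j).card : ℝ) ≤ (foldIndices κ₀ j').card + 1 := by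
    exact_mod_cast h j j'
  have h2 : ((foldIndices κ₀ j').card : ℝ) ≤ (foldIndices κ₀ j).card + 1 := by
    exact_mod_cast h j' j
  rw [foldWeight, foldWeight, ← sub_div, abs_div, Nat.abs_cast, ← one_div]
  refine div_le_div_of_nonneg_right (abs_le.2 ⟨?_, ?_⟩) (by positivity) <;> linarith

/-- The average over the sample is the weighted mean of the averages over the folds. -/
lemma sum_foldWeight_smul_avg (κ₀ : Fin n → Fin 3) (z : ℕ → α) (φ : α → E) :
    ∑ j, foldWeight κ₀ j • avg (fold κ₀ z j) φ = avg (firstPoints n z) φ := by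
  have h1 : ∀ j, foldWeight κ₀ j • avg (fold κ₀ z j) φ =
      (n : ℝ)⁻¹ • ∑ i ∈ Finset.univ.filter (fun i => κ₀ i = j), φ (z i) := by
    intro j
    have h2 : ∑ t, φ ((fold κ₀ z j).2 t) = ∑ i ∈ foldIndices κ₀ j, φ (z i) := by
      rw [← Finset.sum_coe_sort (foldIndices κ₀ j)]
      exact Fintype.sum_equiv ((foldIndices κ₀ j).orderIsoOfFin rfl).toEquiv _ _ fun t => rfl
    rw [avg, h2, smul_smul]
    change ((foldIndices κ₀ j).card / (n : ℝ) * ((foldIndices κ₀ j).card : ℝ)⁻¹) • _ = _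
    -- An empty fold has weight zero and contributes an empty sum.
    rcases Nat.eq_zero_or_pos (foldIndices κ₀ j).card with h0 | h0
    · rw [Finset.card_eq_zero] at h0
      simp only [foldIndices] at h0 ⊢
      simp [h0]
    · have : ((foldIndices κ₀ j).card : ℝ) ≠ 0 := by positivity
      congr 1
      field_simp
  simp only [h1]
  rw [← Finset.smul_sum, Finset.sum_fiberwise]
  rfl

end FoldAverages

section SplitSampleVectors

variable {α Ω Ξ β : Type*} [MeasurableSpace α] [MeasurableSpace β] [MeasurableSpace Ω]
  [MeasurableSpace Ξ]
  {μ : Measure Ω} [IsProbabilityMeasure μ]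
  {P : Measure α} [IsProbabilityMeasure P] {Q : Measure β} [IsProbabilityMeasure Q]
  {Z : ℕ → Ω → α} {U : ℕ → Ω → β} {κ : (n : ℕ) → Ω → Fin n → Fin 3} {ξ : ℕ → Fin 3 → Ω → Ξ}
  {d : ℕ}

namespace IsSplitSample

lemma bddInProb_fold_vec (h : IsSplitSample μ P Q Z U κ ξ) (j : Fin 3) {φ : α → Vec d}
    (hφ : MemLp φ 2 P) :
    BddInProb μ fun p => √(p.1 : ℝ) •
      (avg (fold (κ p.1 p.2) (fun i => Z i p.2) j) φ - ∫ z, φ z ∂P) := by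
  refine bddInProb_vec_of_coord fun i => ?_
  refine (h.bddInProb_fold j (hφ.eval_piLp i)).congr' (Eventually.of_forall fun p => ?_)
  simp only [PiLp.smul_apply, PiLp.sub_apply, avg_coord,
    integral_coord (hφ.integrable one_le_two)]

lemma bddInProb_unlabeled_vec (h : IsSplitSample μ P Q Z U κ ξ) {N : ℕ → ℕ} {q : ℕ}
    (hq : ∀ᶠ n in atTop, n ≤ q * N n) {φ : β → Vec d} (hφm : Measurable φ) (hφ : MemLp φ 2 Q) :
    BddInProb μ fun p => √(p.1 : ℝ) •
      (avg (firstPoints (N p.1) (fun i => U i p.2)) φ - ∫ z, φ z ∂Q) := by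
  refine bddInProb_vec_of_coord fun i => ?_
  refine (h.bddInProb_unlabeled hq (φ := fun z => φ z i)
    ((EuclideanSpace.proj i : Vec d →L[ℝ] ℝ).continuous.measurable.comp hφm)
    (hφ.eval_piLp i)).congr' (Eventually.of_forall fun p => ?_)
  simp only [PiLp.smul_apply, PiLp.sub_apply, avg_coord,
    integral_coord (hφ.integrable one_le_two)]

lemma tendsto_card_fold (h : IsSplitSample μ P Q Z U κ ξ) (j : Fin 3) :
    Tendsto (fun p : ℕ × Ω => (fold (κ p.1 p.2) (fun i => Z i p.2) j).1) (probFilter μ) atTop := by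
  refine tendsto_atTop.2 fun m => ?_
  filter_upwards [tendsto_fst_probFilter.eventually_ge_atTop (3 * m + 2)] with p hp
  have := (h.even p.1 p.2).le_three_mul_card j
  change m ≤ (foldIndices (κ p.1 p.2) j).card
  omega

lemma avg_firstPoints_sub {E : Type*} [NormedAddCommGroup E] [NormedSpace ℝ E] {n : ℕ}
    (hn : 0 < n) (κ₀ : Fin n → Fin 3) (z : ℕ → α) (φ : α → E) (m : E) :
    avg (firstPoints n z) φ - m = ∑ j, foldWeight κ₀ j • (avg (fold κ₀ z j) φ - m) := by
  simp only [smul_sub, Finset.sum_sub_distrib, sum_foldWeight_smul_avg, ← Finset.sum_smul,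
    sum_foldWeight hn, one_smul]

/-- The average over the full sample is a convex combination of the fold averages and inherits their
limits. -/
lemma lawOfLargeNumbers_firstPoints (h : IsSplitSample μ P Q Z U κ ξ) :
    LawOfLargeNumbers P (probFilter μ) fun p => firstPoints p.1 (fun i => Z i p.2) := by
  refine ⟨fun q hq => eventually_probFilter_of_ae fun n => ?_, fun φ hφ => ?_⟩
  · have : ∀ᵐ ω ∂μ, ∀ i, q (Z i ω) := ae_all_iff.2 fun i =>
      ae_of_ae_map (h.measurable_labeled i).aemeasurable (by rwa [h.law_labeled])
    filter_upwards [this] with ω hω t using hω _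
  · have h1 : Tendsto (fun p : ℕ × Ω => ∑ j, foldWeight (κ p.1 p.2) j •
        (avg (fold (κ p.1 p.2) (fun i => Z i p.2) j) φ - ∫ z, φ z ∂P)) (probFilter μ) (𝓝 0) := by
      rw [← Finset.sum_const_zero (s := (Finset.univ : Finset (Fin 3)))]
      refine tendsto_finsetSum _ fun j _ => ?_
      have h2 := tendsto_sub_nhds_zero_iff.2 ((h.lawOfLargeNumbers_fold j).tendsto_avg φ hφ)
      refine squeeze_zero_norm (fun p => ?_) (by simpa using h2.norm)
      rw [norm_smul, Real.norm_eq_abs]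
      exact mul_le_of_le_one_left (norm_nonneg _) (abs_foldWeight_le _ _)
    rw [← tendsto_sub_nhds_zero_iff]
    refine h1.congr' ?_
    filter_upwards [tendsto_fst_probFilter.eventually_gt_atTop 0] with p hp
    rw [avg_firstPoints_sub hp (κ p.1 p.2)]

lemma bddInProb_firstPoints_vec (h : IsSplitSample μ P Q Z U κ ξ) {φ : α → Vec d}
    (hφ : MemLp φ 2 P) :
    BddInProb μ fun p => √(p.1 : ℝ) •
      (avg (firstPoints p.1 (fun i => Z i p.2)) φ - ∫ z, φ z ∂P) := by
  have h1 := bddInProb_finset_sum (μ := μ) Finset.univ fun j : Fin 3 =>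
    (h.bddInProb_fold_vec j hφ).smul_of_le_one (w := fun p => foldWeight (κ p.1 p.2) j)
      fun p => abs_foldWeight_le _ _
  refine h1.congr' ?_
  filter_upwards [tendsto_fst_probFilter.eventually_gt_atTop 0] with p hp
  rw [avg_firstPoints_sub hp (κ p.1 p.2), Finset.smul_sum]
  exact Finset.sum_congr rfl fun j _ => smul_comm _ _ _

end IsSplitSample

end SplitSampleVectors

/-! ### The expansion of minimizers at the rate `1 / √n`. -/

section RootNExpansion

variable {𝒳 𝒲 𝒴 Ω : Type*} [MeasurableSpace 𝒳] [MeasurableSpace 𝒲] [MeasurableSpace 𝒴]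
  [MeasurableSpace Ω] {μ : Measure Ω} {d : ℕ}
  {P : Measure (𝒳 × 𝒲 × 𝒴)} [IsProbabilityMeasure P] {Θ : Set (Vec d)}
  {ℓ : Vec d → 𝒳 → 𝒴 → ℝ} {θs : Vec d} {D : ℕ × Ω → Dataset (𝒳 × 𝒲 × 𝒴)}
  {b θhat : ℕ × Ω → Vec d}

lemma expHessian_posDef (hreg : RegularLoss P Θ ℓ θs) (htarget : IsUniqueTarget P Θ ℓ θs) :
    (expHessian P ℓ θs).PosDef := by
  obtain ⟨R, M₁, M₃, hR⟩ := hreg.exists_regularOnBall htarget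
  exact hR.hessian_risk_eq ▸ hreg.hessian_posDef

lemma toEuclideanCLM_inv_apply {H : Matrix (Fin d) (Fin d) ℝ} (hH : H.PosDef) (x : Vec d) :
    Matrix.toEuclideanCLM (𝕜 := ℝ) H⁻¹ (Matrix.toEuclideanCLM (𝕜 := ℝ) H x) = x := by
  have h1 : Matrix.toEuclideanCLM (𝕜 := ℝ) H⁻¹ * Matrix.toEuclideanCLM (𝕜 := ℝ) H = 1 := by
    rw [← map_mul, Matrix.nonsing_inv_mul _ hH.det_pos.ne'.isUnit, map_one]
  exact congrArg (fun L : Vec d →L[ℝ] Vec d => L x) h1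

/-- Linear expansion, at the parametric rate, of the minimizer of a linearly perturbed empirical
risk. -/
theorem tendsto_sqrt_smul_argmin (hreg : RegularLoss P Θ ℓ θs)
    (htarget : IsUniqueTarget P Θ ℓ θs) (hD : LawOfLargeNumbers P (probFilter μ) D)
    (hb : BddInProb μ fun p => √(p.1 : ℝ) • b p)
    (hg : BddInProb μ fun p => √(p.1 : ℝ) • avg (D p) (gradLoss ℓ θs))
    (hθ : ∀ᶠ p in probFilter μ,
      SelectsArgmin (fun θ => empRisk ℓ (D p) θ - inner ℝ (b p) θ) Θ (θhat p)) :
    Tendsto (fun p => √(p.1 : ℝ) • (θhat p - θs) + Matrix.toEuclideanCLM (𝕜 := ℝ)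
      (expHessian P ℓ θs)⁻¹ (√(p.1 : ℝ) • (avg (D p) (gradLoss ℓ θs) - b p)))
      (probFilter μ) (𝓝 0) := by
  have h1 := argmin_expansion hreg htarget hD hb.tendsto_of_sqrt_smul hθ
  -- After multiplication by `√n` the remainder is `o` of `√n • (avg - b)`, which is bounded in
  -- probability; hence it vanishes in probability.
  have h2 := (Asymptotics.isBigO_refl (fun p : ℕ × Ω => √(p.1 : ℝ)) (probFilter μ)).smul_isLittleO
    h1
  have h3 : BddInProb μ fun p => √(p.1 : ℝ) • (avg (D p) (gradLoss ℓ θs) - b p) := by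
    simpa only [smul_sub] using hg.sub hb
  have h4 := ((Matrix.toEuclideanCLM (𝕜 := ℝ) (expHessian P ℓ θs)⁻¹).continuous.tendsto 0).comp
    (h3.tendsto_of_isLittleO h2)
  rw [map_zero] at h4
  refine h4.congr fun p => ?_
  simp only [Function.comp_apply, map_smul, map_add, smul_add,
    toEuclideanCLM_inv_apply (expHessian_posDef hreg htarget)]
  exact add_comm _ _

/-- Meant for the initial estimator: its rate, and not only its consistency, enters the analysis of
the tuning matrix. -/
lemma bddInProb_sqrt_smul_argmin (hreg : RegularLoss P Θ ℓ θs)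
    (htarget : IsUniqueTarget P Θ ℓ θs) (hD : LawOfLargeNumbers P (probFilter μ) D)
    (hg : BddInProb μ fun p => √(p.1 : ℝ) • avg (D p) (gradLoss ℓ θs))
    (hθ : ∀ᶠ p in probFilter μ, SelectsArgmin (empRisk ℓ (D p)) Θ (θhat p)) :
    BddInProb μ fun p => √(p.1 : ℝ) • (θhat p - θs) := by
  have h1 := tendsto_sqrt_smul_argmin (b := fun _ => 0) hreg htarget hD
    (bddInProb_of_tendsto (c := 0) (by simp [tendsto_const_nhds])) hg (by simpa using hθ)
  have h2 := (bddInProb_of_tendsto h1).sub (hg.clm_apply (tendsto_const_nhds (x :=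
    Matrix.toEuclideanCLM (𝕜 := ℝ) (expHessian P ℓ θs)⁻¹)))
  simpa using h2

end RootNExpansion

end RePPI

namespace RePPI

/-! ### Expansion of the estimate of one rotation. -/

section Objective

variable {𝒳 𝒲 𝒴 𝒱 : Type*} {d : ℕ}

lemma linearImputedLoss_eq_inner (c : ℝ) (M : Matrix (Fin d) (Fin d) ℝ) (shat : 𝒳 × 𝒱 → Vec d)
    (θ : Vec d) (v : 𝒳 × 𝒱) : linearImputedLoss c M shat θ v =
      inner ℝ (Matrix.toEuclideanCLM (𝕜 := ℝ) (c • M) (shat v)) θ := by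
  rw [EuclideanSpace.inner_eq_star_dotProduct, linearImputedLoss]
  simp [Matrix.ofLp_toEuclideanCLM]

lemma avg_inner {α : Type*} (D : Dataset α) (φ : α → Vec d) (θ : Vec d) :
    avg D (fun z => inner ℝ (φ z) θ) = inner ℝ (avg D φ) θ := by
  simp only [real_inner_comm θ]
  exact avg_map D (innerSL ℝ θ).toLinearMap φ

lemma avg_clm {α : Type*} (D : Dataset α) (L : Vec d →L[ℝ] Vec d) (φ : α → Vec d) :
    avg D (fun z => L (φ z)) = L (avg D φ) :=
  avg_map D L.toLinearMap φ

/-- Linearity of the imputed loss in `θ` reduces the whole correction to one linear functional,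
which preserves convexity of the objective. -/
lemma ppiObjective_linearImputedLoss (ℓ : Vec d → 𝒳 → 𝒴 → ℝ) (f : 𝒳 × 𝒲 → 𝒱) (c : ℝ)
    (M : Matrix (Fin d) (Fin d) ℝ) (shat : 𝒳 × 𝒱 → Vec d) (D : Dataset (𝒳 × 𝒲 × 𝒴))
    (D' : Dataset (𝒳 × 𝒲)) (θ : Vec d) :
    ppiObjective ℓ f (linearImputedLoss c M shat) D D' θ = empRisk ℓ D θ -
      inner ℝ (Matrix.toEuclideanCLM (𝕜 := ℝ) (c • M)
        (avg D (fun z => shat (predL f z)) - avg D' (fun u => shat (predU f u)))) θ := by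
  simp only [ppiObjective, linearImputedLoss_eq_inner, avg_inner, avg_clm, map_sub, inner_sub_left]

end Objective

section Rotation

variable {𝒳 𝒲 𝒴 𝒱 Ω Ξ : Type*} [MeasurableSpace 𝒳] [MeasurableSpace 𝒲] [MeasurableSpace 𝒴]
  [MeasurableSpace 𝒱] [MeasurableSpace Ω] [MeasurableSpace Ξ]
  {μ : Measure Ω} [IsProbabilityMeasure μ] {d : ℕ}
  {P : Measure (𝒳 × 𝒲 × 𝒴)} [IsProbabilityMeasure P] {Q : Measure (𝒳 × 𝒲)}
  [IsProbabilityMeasure Q] {Θ : Set (Vec d)}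
  {ℓ : Vec d → 𝒳 → 𝒴 → ℝ} {θs : Vec d}
  {Z : ℕ → Ω → 𝒳 × 𝒲 × 𝒴} {U : ℕ → Ω → 𝒳 × 𝒲} {κ : (n : ℕ) → Ω → Fin n → Fin 3}
  {ξ : ℕ → Fin 3 → Ω → Ξ} {f : 𝒳 × 𝒲 → 𝒱} {s : 𝒳 × 𝒱 → Vec d} {N : ℕ → ℕ}

namespace IsSplitSample

lemma bddInProb_gradLoss_fold (h : IsSplitSample μ P Q Z U κ ξ) (hreg : RegularLoss P Θ ℓ θs)
    (htarget : IsUniqueTarget P Θ ℓ θs) (j : Fin 3) :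
    BddInProb μ fun p => √(p.1 : ℝ) •
      avg (fold (κ p.1 p.2) (fun i => Z i p.2) j) (gradLoss ℓ θs) := by
  obtain ⟨R, M₁, M₃, hR⟩ := hreg.exists_regularOnBall htarget
  simpa [hR.integral_gradLoss_eq_zero htarget] using h.bddInProb_fold_vec j hreg.memLp_gradLoss

/-- Functions that are small compared to `√n`, multiplied by an error of the order `1 / √n`. -/
lemma eventually_mul_le_of_bddInProb {θ₀ : ℕ × Ω → Vec d}
    (hθ : BddInProb μ fun p => √(p.1 : ℝ) • (θ₀ p - θs)) {D : ℕ × Ω → Dataset (𝒳 × 𝒲 × 𝒴)}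
    {g : ℕ × Ω → 𝒳 × 𝒲 × 𝒴 → Vec d}
    (hg : ∀ ε : ℝ, 0 < ε → ∀ᶠ p in probFilter μ, ∀ t, ‖g p ((D p).2 t)‖ ≤ ε * √(p.1 : ℝ))
    {ε : ℝ} (hε : 0 < ε) :
    ∀ᶠ p in probFilter μ, ∀ t, ‖θ₀ p - θs‖ * ‖g p ((D p).2 t)‖ ≤ ε := by
  have hbdd : ∀ p, BddAbove (Set.range fun t => ‖g p ((D p).2 t)‖ / √(p.1 : ℝ)) := fun p =>
    (Set.finite_range _).bddAbove
  -- The supremum turns the uniform bounds into one scalar sequence tending to zero; over an empty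
  -- sample it is `0`.
  have h1 : Tendsto (fun p : ℕ × Ω => ⨆ t, ‖g p ((D p).2 t)‖ / √(p.1 : ℝ)) (probFilter μ)
      (𝓝 0) := by
    rw [Metric.tendsto_nhds]
    intro η hη
    filter_upwards [hg (η / 2) (by positivity), tendsto_fst_probFilter.eventually_gt_atTop 0]
      with p hp hp0
    have hs : 0 < √(p.1 : ℝ) := Real.sqrt_pos.2 (by exact_mod_cast hp0)
    rw [dist_zero_right, Real.norm_of_nonneg (Real.iSup_nonneg fun t => by positivity)]
    exact (Real.iSup_le (fun t => (div_le_iff₀ hs).2 (hp t)) (by positivity)).trans_lt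
      (half_lt_self hη)
  have h2 := (hθ.tendsto_smul h1).norm
  rw [norm_zero] at h2
  filter_upwards [h2.eventually (gt_mem_nhds hε), tendsto_fst_probFilter.eventually_gt_atTop 0]
    with p hp hp0 t
  have hs : 0 < √(p.1 : ℝ) := Real.sqrt_pos.2 (by exact_mod_cast hp0)
  rw [norm_smul, norm_smul, Real.norm_of_nonneg (Real.iSup_nonneg fun t => by positivity),
    Real.norm_of_nonneg hs.le] at hp
  refine le_trans (le_trans (le_of_eq ?_) (mul_le_mul_of_nonneg_right (le_ciSup (hbdd p) t)
    (by positivity))) hp.le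
  field_simp

/-- The expansion of the estimate of one rotation: the fold `j` is used for the tuning matrix and the
estimate, the fold `j₁` for the initial estimate, and the folds `j₁` and `j₂` to fit the score. -/
theorem tendsto_rotation (h : IsSplitSample μ P Q Z U κ ξ) (hreg : RegularLoss P Θ ℓ θs)
    (htarget : IsUniqueTarget P Θ ℓ θs) (hf : Measurable f) (hPQ : P.map (predL f) = Q.map (predU f))
    (hs : Measurable s) (hs2 : MemLp (fun z => s (predL f z)) 2 P)
    (hcov : (crossCov P (fun z => s (predL f z)) fun z => s (predL f z)).PosDef)
    {q : ℕ} (hq : ∀ᶠ n in atTop, n ≤ q * N n) {c : ℕ → ℝ} {c₀ : ℝ} (hc : Tendsto c atTop (𝓝 c₀))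
    {j j₁ j₂ : Fin 3} (h₁ : j₁ ≠ j) (h₂ : j₂ ≠ j)
    {init : Dataset (𝒳 × 𝒲 × 𝒴) → Vec d}
    (hinit : ∀ D, SelectsArgmin (empRisk ℓ D) Θ (init D))
    {shat : ℕ → (Fin 3 → Ξ) × Dataset (𝒳 × 𝒲 × 𝒴) × Dataset (𝒳 × 𝒲 × 𝒴) → 𝒳 × 𝒱 → Vec d}
    (hshat : ∀ n, Measurable (Function.uncurry (shat n)))
    (hlim : ∀ δ : ℝ≥0∞, 0 < δ → Tendsto (fun n => μ {ω | δ ≤ ∫⁻ z,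
      ‖shat n (trainingData Z ξ n j₁ j₂ (κ n ω) ω) (predL f z) - s (predL f z)‖ₑ ^ 2 ∂P})
      atTop (𝓝 0))
    {θhat : ℕ × Ω → Vec d}
    (hθ : ∀ᶠ p in probFilter μ, SelectsArgmin (ppiObjective ℓ f
      (linearImputedLoss (c p.1) (tuningMatrix ℓ f (fold (κ p.1 p.2) (fun i => Z i p.2) j)
          (init (fold (κ p.1 p.2) (fun i => Z i p.2) j₁))
          (shat p.1 (trainingData Z ξ p.1 j₁ j₂ (κ p.1 p.2) p.2)))
        (shat p.1 (trainingData Z ξ p.1 j₁ j₂ (κ p.1 p.2) p.2)))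
      (fold (κ p.1 p.2) (fun i => Z i p.2) j) (firstPoints (N p.1) (fun i => U i p.2)))
      Θ (θhat p)) :
    Tendsto (fun p => √(p.1 : ℝ) • (θhat p - θs) + Matrix.toEuclideanCLM (𝕜 := ℝ)
      (expHessian P ℓ θs)⁻¹ (√(p.1 : ℝ) •
        (avg (fold (κ p.1 p.2) (fun i => Z i p.2) j) (gradLoss ℓ θs) -
          Matrix.toEuclideanCLM (𝕜 := ℝ) (c₀ • (crossCov P (gradLoss ℓ θs)
            (fun z => s (predL f z)) *
              (crossCov P (fun z => s (predL f z)) fun z => s (predL f z))⁻¹))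
            (avg (fold (κ p.1 p.2) (fun i => Z i p.2) j) (fun z => s (predL f z)) -
              avg (firstPoints (N p.1) (fun i => U i p.2)) (fun u => s (predU f u))))))
      (probFilter μ) (𝓝 0) := by
  obtain ⟨R, M₁, M₃, hR⟩ := hreg.exists_regularOnBall htarget
  have hpL : Measurable (predL f : 𝒳 × 𝒲 × 𝒴 → 𝒳 × 𝒱) :=
    measurable_fst.prodMk (hf.comp (measurable_fst.prodMk (measurable_fst.comp measurable_snd)))
  have hpU : Measurable (predU f : 𝒳 × 𝒲 → 𝒳 × 𝒱) := measurable_fst.prodMk hf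
  set C : ℕ × Ω → Dataset (𝒳 × 𝒲 × 𝒴) := fun p => fold (κ p.1 p.2) (fun i => Z i p.2) j with hC
  set V : ℕ × Ω → Dataset (𝒳 × 𝒲) := fun p => firstPoints (N p.1) (fun i => U i p.2) with hV
  set S : ℕ × Ω → 𝒳 × 𝒱 → Vec d := fun p =>
    shat p.1 (trainingData Z ξ p.1 j₁ j₂ (κ p.1 p.2) p.2) with hS
  set θ₀ : ℕ × Ω → Vec d := fun p => init (fold (κ p.1 p.2) (fun i => Z i p.2) j₁) with hθ₀
  set M := crossCov P (gradLoss ℓ θs) (fun z => s (predL f z)) *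
    (crossCov P (fun z => s (predL f z)) fun z => s (predL f z))⁻¹ with hM
  have hφ : ∀ n, Measurable (Function.uncurry fun a v => shat n a v - s v) := fun n =>
    (hshat n).sub (hs.comp measurable_snd)
  have hLLN := h.lawOfLargeNumbers_fold j
  have hδ : Tendsto (fun p => avg (C p) fun z => ‖S p (predL f z) - s (predL f z)‖ ^ 2)
      (probFilter μ) (𝓝 0) :=
    h.tendsto_avg_sq_fold (φ := fun n a v => shat n a v - s v) h₁ h₂ hφ hpL hlim
  have hθ₀b : BddInProb μ fun p => √(p.1 : ℝ) • (θ₀ p - θs) :=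
    bddInProb_sqrt_smul_argmin hreg htarget (h.lawOfLargeNumbers_fold j₁)
      (h.bddInProb_gradLoss_fold hreg htarget j₁) (Eventually.of_forall fun p => hinit _)
  -- The fitted score is `(ŝ - s) + s`: the first part is `o(√n)` on the fold by its vanishing mean
  -- square, the second by its second moment.
  have hmaxS : ∀ ε : ℝ, 0 < ε → ∀ᶠ p in probFilter μ, ∀ t,
      ‖S p (predL f ((C p).2 t))‖ ≤ ε * √(p.1 : ℝ) := by
    intro ε hε
    filter_upwards [eventually_fold_le_of_tendsto_avg_sq
      (f := fun p z => S p (predL f z) - s (predL f z)) hδ (half_pos hε),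
      h.eventually_fold_le (j := j) (g := fun z => s (predL f z)) (hs.comp hpL) hs2 (half_pos hε)]
      with p h3 h4 t
    calc ‖S p (predL f ((C p).2 t))‖ = ‖(S p (predL f ((C p).2 t)) - s (predL f ((C p).2 t))) +
          s (predL f ((C p).2 t))‖ := by rw [sub_add_cancel]
      _ ≤ ε / 2 * √(p.1 : ℝ) + ε / 2 * √(p.1 : ℝ) :=
          (norm_add_le _ _).trans (add_le_add (h3 t) (h4 t))
      _ = ε * √(p.1 : ℝ) := by ring
  have hMlim : Tendsto (fun p => tuningMatrix ℓ f (C p) (θ₀ p) (S p)) (probFilter μ) (𝓝 M) :=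
    hR.tendsto_tuningMatrix hLLN (h.tendsto_card_fold j)
      (tendsto_sub_nhds_zero_iff.1 hθ₀b.tendsto_of_sqrt_smul) hreg.memLp_gradLoss hs2 hcov hδ
      fun ε hε => eventually_mul_le_of_bddInProb (g := fun p z => S p (predL f z)) hθ₀b hmaxS hε
  set L : ℕ × Ω → Vec d →L[ℝ] Vec d := fun p => Matrix.toEuclideanCLM (𝕜 := ℝ)
    (c p.1 • tuningMatrix ℓ f (C p) (θ₀ p) (S p)) with hL
  have hLlim : Tendsto L (probFilter μ) (𝓝 (Matrix.toEuclideanCLM (𝕜 := ℝ) (c₀ • M))) := by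
    have h3 : Continuous (Matrix.toEuclideanCLM (𝕜 := ℝ) (n := Fin d)) :=
      LinearMap.continuous_of_finiteDimensional
        { toFun := Matrix.toEuclideanCLM (𝕜 := ℝ) (n := Fin d)
          map_add' := map_add _
          map_smul' := map_smul _ }
    exact (h3.tendsto _).comp ((hc.comp tendsto_fst_probFilter).smul hMlim)
  generalize Matrix.toEuclideanCLM (𝕜 := ℝ) (c₀ • M) = L₀ at hLlim ⊢
  set T : ℕ × Ω → Vec d := fun p => √(p.1 : ℝ) • (avg (C p) (fun z => S p (predL f z)) -
    avg (V p) fun u => S p (predU f u)) with hT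
  set T₀ : ℕ × Ω → Vec d := fun p => √(p.1 : ℝ) • (avg (C p) (fun z => s (predL f z)) -
    avg (V p) fun u => s (predU f u)) with hT₀
  have hTT₀ : Tendsto (fun p => T p - T₀ p) (probFilter μ) (𝓝 0) := by
    refine (h.tendsto_sqrt_smul_avg_sub_avg (φ := fun n a v => shat n a v - s v) h₁ h₂ hφ hpL hpU
      hPQ hq hlim).congr fun p => ?_
    simp only [hT, hT₀, avg_sub, ← smul_sub]
    congr 1
    simp only [hC, hV, hS]
    abel
  -- The two averages of `s` have a common mean, so their difference needs no centering.
  have hT₀b : BddInProb μ T₀ := by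
    have hs2' : MemLp (fun u => s (predU f u)) 2 Q := by
      have h3 : MemLp s 2 (P.map (predL f)) :=
        (memLp_map_measure_iff hs.aestronglyMeasurable hpL.aemeasurable).2 hs2
      rw [hPQ] at h3
      exact (memLp_map_measure_iff hs.aestronglyMeasurable hpU.aemeasurable).1 h3
    have hint : ∫ z, s (predL f z) ∂P = ∫ u, s (predU f u) ∂Q := by
      rw [← integral_map hpL.aemeasurable hs.aestronglyMeasurable, hPQ,
        integral_map hpU.aemeasurable hs.aestronglyMeasurable]
    refine ((h.bddInProb_fold_vec j hs2).sub
      (h.bddInProb_unlabeled_vec hq (hs.comp hpU) hs2')).congr' (Eventually.of_forall fun p => ?_)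
    simp only [Function.comp_def, hT₀, ← smul_sub, hint]
    congr 1
    simp only [hC, hV]
    abel
  have hTb : BddInProb μ T := by simpa using (bddInProb_of_tendsto hTT₀).add hT₀b
  set b : ℕ × Ω → Vec d := fun p => L p (avg (C p) (fun z => S p (predL f z)) -
    avg (V p) fun u => S p (predU f u)) with hb
  have hbT : ∀ p, √(p.1 : ℝ) • b p = L p (T p) := fun p => by simp only [hb, hT, map_smul]
  have hbb : BddInProb μ fun p => √(p.1 : ℝ) • b p := by
    simp only [hbT]
    exact hTb.clm_apply hLlim
  have h5 := tendsto_sqrt_smul_argmin hreg htarget hLLN hbb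
    (h.bddInProb_gradLoss_fold hreg htarget j) (θhat := θhat) (by
      filter_upwards [hθ] with p hp
      have h6 : (fun θ => empRisk ℓ (C p) θ - inner ℝ (b p) θ) = _ :=
        (funext fun θ => ppiObjective_linearImputedLoss ℓ f (c p.1)
          (tuningMatrix ℓ f (C p) (θ₀ p) (S p)) (S p) (C p) (V p) θ).symm
      exact h6 ▸ hp)
  -- `L T - L₀ T₀ = (L - L₀) T + L₀ (T - T₀)`. As `T` is bounded in probability, consistency of `L`
  -- without a rate is enough.
  have h7 : Tendsto (fun p => √(p.1 : ℝ) • b p - L₀ (T₀ p)) (probFilter μ) (𝓝 0) := by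
    have h8 := hTb.tendsto_clm_apply (Y := fun p => L p - L₀)
      (tendsto_sub_nhds_zero_iff.2 hLlim)
    have h9 := (L₀.continuous.tendsto 0).comp hTT₀
    rw [map_zero] at h9
    have h10 := h8.add h9
    rw [add_zero] at h10
    refine h10.congr fun p => ?_
    rw [hbT]
    simp
  have h11 := h5.add (((Matrix.toEuclideanCLM (𝕜 := ℝ) (expHessian P ℓ θs)⁻¹).continuous.tendsto
    0).comp h7)
  rw [map_zero, add_zero] at h11
  refine h11.congr fun p => ?_
  simp only [Function.comp_apply, hT₀, map_smul, smul_sub, map_sub]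
  abel

end IsSplitSample

end Rotation

end RePPI

namespace RePPI

/-! ### Averaging the three rotations. -/

section CrossFit

variable {α Ω Ξ β : Type*} [MeasurableSpace α] [MeasurableSpace β] [MeasurableSpace Ω]
  [MeasurableSpace Ξ]
  {μ : Measure Ω} [IsProbabilityMeasure μ]
  {P : Measure α} [IsProbabilityMeasure P] {Q : Measure β} [IsProbabilityMeasure Q]
  {Z : ℕ → Ω → α} {U : ℕ → Ω → β} {κ : (n : ℕ) → Ω → Fin n → Fin 3} {ξ : ℕ → Fin 3 → Ω → Ξ}
  {d : ℕ} {N : ℕ → ℕ} {ψ : α → Vec d} {χ : β → Vec d} {θs : Vec d}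

/-- Each fold is the estimation fold of exactly one rotation. -/
lemma sum_rotation {E : Type*} [AddCommMonoid E] (g : Fin 3 → E) :
    ∑ k, g (rotation k).2.2 = ∑ j, g j := by
  simp only [Fin.sum_univ_three]
  change g 2 + g 1 + g 0 = _
  abel

lemma crossFit_eq {n : ℕ} (κ₀ : Fin n → Fin 3) (θhat : Fin 3 → Vec d) :
    crossFit κ₀ θhat = ∑ k, foldWeight κ₀ k • θhat k := rfl

namespace IsSplitSample

/-- The cross-fitted estimator is asymptotically linear if the estimates of the rotations are. -/
theorem tendsto_crossFit (h : IsSplitSample μ P Q Z U κ ξ) (hψ : MemLp ψ 2 P)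
    (hψ0 : ∫ z, ψ z ∂P = 0) {q : ℕ} (hq : ∀ᶠ n in atTop, n ≤ q * N n)
    (hχm : Measurable χ) (hχ : MemLp χ 2 Q) (hχ0 : ∫ u, χ u ∂Q = 0) {θhat : Fin 3 → ℕ × Ω → Vec d}
    (hθ : ∀ k, Tendsto (fun p => √(p.1 : ℝ) • (θhat k p - θs) - √(p.1 : ℝ) •
      (avg (fold (κ p.1 p.2) (fun i => Z i p.2) (rotation k).2.2) ψ +
        avg (firstPoints (N p.1) (fun i => U i p.2)) χ)) (probFilter μ) (𝓝 0)) :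
    Tendsto (fun p : ℕ × Ω => √(p.1 : ℝ) • (crossFit (κ p.1 p.2) (fun k => θhat k p) - θs) -
      √(p.1 : ℝ) • (avg (firstPoints p.1 (fun i => Z i p.2)) ψ +
        avg (firstPoints (N p.1) (fun i => U i p.2)) χ)) (probFilter μ) (𝓝 0) := by
  set Y : Fin 3 → ℕ × Ω → Vec d := fun j p => √(p.1 : ℝ) •
    (avg (fold (κ p.1 p.2) (fun i => Z i p.2) j) ψ +
      avg (firstPoints (N p.1) (fun i => U i p.2)) χ) with hY
  have hYb : ∀ j, BddInProb μ (Y j) := by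
    intro j
    have h1 := (h.bddInProb_fold_vec j hψ).add (h.bddInProb_unlabeled_vec hq hχm hχ)
    simpa only [hψ0, hχ0, sub_zero, ← smul_add] using h1
  -- The estimate of rotation `k` carries the weight of fold `k`, but its expansion averages over
  -- fold `(rotation k).2.2`. Exchanging the weights costs at most `1 / n` times a quantity bounded
  -- in probability.
  have h1 : Tendsto (fun p : ℕ × Ω => ∑ k, (foldWeight (κ p.1 p.2) k •
      (√(p.1 : ℝ) • (θhat k p - θs) - Y (rotation k).2.2 p) +
      (foldWeight (κ p.1 p.2) k - foldWeight (κ p.1 p.2) (rotation k).2.2) •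
        Y (rotation k).2.2 p)) (probFilter μ) (𝓝 0) := by
    rw [← Finset.sum_const_zero (s := (Finset.univ : Finset (Fin 3)))]
    refine tendsto_finsetSum _ fun k _ => ?_
    rw [← add_zero (0 : Vec d)]
    refine Tendsto.add ?_ ((hYb _).tendsto_smul ?_)
    · have hk := (hθ k).norm
      rw [norm_zero] at hk
      refine squeeze_zero_norm (fun p => ?_) hk
      rw [norm_smul, Real.norm_eq_abs]
      exact mul_le_of_le_one_left (norm_nonneg _) (abs_foldWeight_le _ _)
    · exact squeeze_zero_norm (fun p => (h.even p.1 p.2).abs_foldWeight_sub_le _ _)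
        ((tendsto_inv_atTop_zero.comp tendsto_natCast_atTop_atTop).comp tendsto_fst_probFilter)
  refine h1.congr' ?_
  filter_upwards [tendsto_fst_probFilter.eventually_gt_atTop 0] with p hp
  have hw := sum_foldWeight hp (κ p.1 p.2)
  have h2 : √(p.1 : ℝ) • (crossFit (κ p.1 p.2) (fun k => θhat k p) - θs) =
      ∑ k, foldWeight (κ p.1 p.2) k • √(p.1 : ℝ) • (θhat k p - θs) := by
    have : crossFit (κ p.1 p.2) (fun k => θhat k p) - θs =
        ∑ k, foldWeight (κ p.1 p.2) k • (θhat k p - θs) := by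
      simp only [crossFit_eq, smul_sub, Finset.sum_sub_distrib, ← Finset.sum_smul, hw, one_smul]
    rw [this, Finset.smul_sum]
    exact Finset.sum_congr rfl fun k _ => smul_comm _ _ _
  have h3 : √(p.1 : ℝ) • (avg (firstPoints p.1 (fun i => Z i p.2)) ψ +
      avg (firstPoints (N p.1) (fun i => U i p.2)) χ) =
      ∑ k, foldWeight (κ p.1 p.2) (rotation k).2.2 • Y (rotation k).2.2 p := by
    rw [sum_rotation fun j => foldWeight (κ p.1 p.2) j • Y j p]
    simp only [hY, smul_comm _ (√(p.1 : ℝ))]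
    rw [← Finset.smul_sum]
    simp only [smul_add, Finset.sum_add_distrib, sum_foldWeight_smul_avg, ← Finset.sum_smul, hw,
      one_smul]
  rw [h2, h3, ← Finset.sum_sub_distrib]
  refine Finset.sum_congr rfl fun k _ => ?_
  rw [smul_sub, sub_smul]
  abel

end IsSplitSample

end CrossFit

end RePPI

namespace RePPI

/-! ### The central limit theorem for two independent samples. -/

section CrossCovariance

variable {α : Type*} [MeasurableSpace α] {P : Measure α} [IsProbabilityMeasure P] {d : ℕ}

lemma dotProduct_crossCov_mulVec {φ ψ : α → Vec d} (hφ : MemLp φ 2 P) (hψ : MemLp ψ 2 P)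
    (x y : Vec d) :
    WithLp.ofLp x ⬝ᵥ (crossCov P φ ψ).mulVec (WithLp.ofLp y) =
      covariance (fun z => inner ℝ (φ z) x) (fun z => inner ℝ (ψ z) y) P := by
  have h1 : ∀ (φ : α → Vec d) (x : Vec d), (fun z => inner ℝ (φ z) x) =
      fun z => ∑ i, x i * φ z i := fun φ x => by
    ext z
    rw [EuclideanSpace.inner_eq_star_dotProduct]
    simp [dotProduct]
  rw [h1, h1, covariance_fun_sum_fun_sum (fun i => (hφ.eval_piLp i).const_mul _)
    (fun i => (hψ.eval_piLp i).const_mul _)]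
  simp only [dotProduct, Matrix.mulVec, Finset.mul_sum, crossCov, Matrix.of_apply,
    covariance_const_mul_left, covariance_const_mul_right]
  exact Finset.sum_congr rfl fun i _ => Finset.sum_congr rfl fun j _ => by ring

end CrossCovariance

section CentralLimit

variable {Ω : Type*} [MeasurableSpace Ω] {μ : Measure Ω} [IsProbabilityMeasure μ] {d : ℕ}

lemma charFun_map_eq_charFun_map_inner {A : Ω → Vec d} (hA : AEMeasurable A μ) (x : Vec d) :
    charFun (μ.map A) x = charFun (μ.map fun ω => inner ℝ (A ω) x) 1 := by
  rw [charFun_apply, charFun_apply_real, integral_map hA (by fun_prop),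
    integral_map (by fun_prop) (by fun_prop)]
  simp

/-- The central limit theorem for deterministically rescaled sums with varying numbers of terms. -/
lemma tendsto_charFun_scaled_sum {X : ℕ → Ω → ℝ} (hX : MemLp (X 0) 2 μ) (h0 : ∫ ω, X 0 ω ∂μ = 0)
    (hindep : iIndepFun X μ) (hident : ∀ i, IdentDistrib (X i) (X 0) μ μ)
    {m : ℕ → ℕ} (hm : Tendsto m atTop atTop) {a : ℕ → ℝ} {a₀ : ℝ} (ha : Tendsto a atTop (𝓝 a₀)) :
    Tendsto (fun n => charFun (μ.map fun ω =>
        a n * ((√(m n : ℝ))⁻¹ * ∑ k ∈ Finset.range (m n), X k ω)) 1) atTop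
      (𝓝 (Complex.exp (-(a₀ ^ 2 * Var[X 0; μ] : ℝ) / 2))) := by
  have hmeas : ∀ k, AEMeasurable (X k) μ := fun k => (hident k).aemeasurable_fst
  have h1 := tendstoInDistribution_inv_sqrt_mul_sum_sub (Y := id)
    (P' := gaussianReal 0 Var[X 0; μ].toNNReal) ⟨aemeasurable_id, Measure.map_id⟩ hX hindep hident
  simp only [h0, mul_zero, sub_zero] at h1
  have h2 : TendstoInDistribution
      (fun n ω => (√(m n : ℝ))⁻¹ * ∑ k ∈ Finset.range (m n), X k ω) atTop id (fun _ => μ)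
      (gaussianReal 0 Var[X 0; μ].toNNReal) :=
    ⟨fun n => h1.forall_aemeasurable (m n), h1.aemeasurable_limit, h1.tendsto.comp hm⟩
  have h3 : TendstoInMeasure μ (fun n (_ : Ω) => a n) atTop (fun _ => a₀) :=
    tendstoInMeasure_of_tendsto_ae (fun n => aestronglyMeasurable_const) (ae_of_all _ fun _ => ha)
  have h4 := h2.continuous_comp_prodMk_of_tendstoInMeasure_const
    (g := fun v : ℝ × ℝ => v.2 * v.1) (by fun_prop) h3 (fun n => aemeasurable_const)
  have h5 := ProbabilityMeasure.tendsto_iff_tendsto_charFun.1 h4.tendsto 1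
  simp only [ProbabilityMeasure.coe_mk] at h5
  refine h5.trans_eq ?_
  simp only [id]
  rw [charFun_map_mul (μ := gaussianReal 0 Var[X 0; μ].toNNReal) a₀ 1, charFun_gaussianReal,
    Real.coe_toNNReal _ (variance_nonneg _ _)]
  congr 2
  push_cast
  ring

lemma measurable_smul_avg_firstPoints {α : Type*} [MeasurableSpace α] {ψ : α → Vec d}
    (hψ : Measurable ψ) (c : ℝ) (m : ℕ) :
    Measurable fun z : ℕ → α => c • avg (firstPoints m z) ψ := by
  change Measurable fun z : ℕ → α => c • ((m : ℝ)⁻¹ • ∑ t : Fin m, ψ (z t))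
  fun_prop

/-- Cramér–Wold: projected on `x`, this is a normalized scalar sum of `m n` terms, rescaled by `√(n
/ m n)`, which tends to `√r`. -/
lemma charFun_map_avg {α : Type*} [MeasurableSpace α] {P : Measure α} [IsProbabilityMeasure P]
    {Z : ℕ → Ω → α} (hZ : ∀ i, Measurable (Z i)) (hlaw : ∀ i, μ.map (Z i) = P)
    (hindep : iIndepFun Z μ) {ψ : α → Vec d} (hψm : Measurable ψ) (hψ : MemLp ψ 2 P)
    (hψ0 : ∫ z, ψ z ∂P = 0) {m : ℕ → ℕ} (hm : Tendsto m atTop atTop) {r : ℝ}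
    (hr : Tendsto (fun n : ℕ => (n : ℝ) / (m n : ℝ)) atTop (𝓝 r)) (x : Vec d) :
    Tendsto (fun n : ℕ => charFun (μ.map fun ω =>
        √(n : ℝ) • avg (firstPoints (m n) (fun i => Z i ω)) ψ) x) atTop
      (𝓝 (Complex.exp (-(r * (WithLp.ofLp x ⬝ᵥ
        (crossCov P ψ ψ).mulVec (WithLp.ofLp x)) : ℝ) / 2))) := by
  have hr0 : 0 ≤ r := ge_of_tendsto' hr fun n => by positivity
  set X : ℕ → Ω → ℝ := fun k ω => inner ℝ (ψ (Z k ω)) x with hX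
  have hg : Measurable fun z => inner ℝ (ψ z) x := by fun_prop
  have hgL : MemLp (fun z => inner ℝ (ψ z) x) 2 P := hψ.inner_const x
  have hX2 : MemLp (X 0) 2 μ :=
    (memLp_map_measure_iff (μ := μ) (f := Z 0) (g := fun z => inner ℝ (ψ z) x)
      hg.aestronglyMeasurable (hZ 0).aemeasurable).1 (by rwa [hlaw])
  have hinner : ∫ z, inner ℝ (ψ z) x ∂P = 0 := by
    simp only [real_inner_comm x]
    rw [integral_inner (hψ.integrable one_le_two), hψ0, inner_zero_right]
  have hX0 : ∫ ω, X 0 ω ∂μ = 0 := by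
    rw [hX, ← integral_map (φ := Z 0) (f := fun z => inner ℝ (ψ z) x) (hZ 0).aemeasurable
      hg.aestronglyMeasurable, hlaw, hinner]
  have hvar : Var[X 0; μ] = WithLp.ofLp x ⬝ᵥ (crossCov P ψ ψ).mulVec (WithLp.ofLp x) := by
    rw [dotProduct_crossCov_mulVec hψ hψ, covariance_self hg.aemeasurable, ← hlaw 0,
      variance_map hg.aemeasurable (hZ 0).aemeasurable]
    rfl
  have hident : ∀ i, IdentDistrib (X i) (X 0) μ μ := fun i =>
    IdentDistrib.comp (f := Z i) (g := Z 0) ⟨(hZ i).aemeasurable, (hZ 0).aemeasurable,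
      (hlaw i).trans (hlaw 0).symm⟩ hg
  have h1 := tendsto_charFun_scaled_sum hX2 hX0 (hindep.comp _ fun _ => hg) hident hm
    (hr.sqrt)
  rw [hvar, Real.sq_sqrt hr0] at h1
  refine h1.congr fun n => ?_
  have hmeas : Measurable fun ω => √(n : ℝ) • avg (firstPoints (m n) (fun i => Z i ω)) ψ :=
    (measurable_smul_avg_firstPoints hψm _ _).comp (measurable_pi_lambda _ hZ)
  rw [charFun_map_eq_charFun_map_inner hmeas.aemeasurable]
  congr 2
  ext ω
  change _ = inner ℝ (√(n : ℝ) • ((m n : ℝ)⁻¹ • ∑ t : Fin (m n), ψ (Z t ω))) x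
  rw [real_inner_smul_left, real_inner_smul_left, sum_inner, Finset.sum_range,
    Real.sqrt_div (Nat.cast_nonneg n)]
  have : (√(m n : ℝ))⁻¹ * (√(m n : ℝ))⁻¹ = (m n : ℝ)⁻¹ := by
    rw [← mul_inv, Real.mul_self_sqrt (Nat.cast_nonneg _)]
  rw [← this]
  ring

/-- The central limit theorem for the sum of two averages over independent samples. -/
theorem tendstoInDistribution_avg_add_avg {α β : Type*} [MeasurableSpace α] [MeasurableSpace β]
    {P : Measure α} [IsProbabilityMeasure P] {Q : Measure β} [IsProbabilityMeasure Q]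
    {Z : ℕ → Ω → α} (hZ : ∀ i, Measurable (Z i)) (hZlaw : ∀ i, μ.map (Z i) = P)
    (hZindep : iIndepFun Z μ)
    {U : ℕ → Ω → β} (hU : ∀ i, Measurable (U i)) (hUlaw : ∀ i, μ.map (U i) = Q)
    (hUindep : iIndepFun U μ) (hZU : IndepFun (fun ω i => Z i ω) (fun ω j => U j ω) μ)
    {ψ : α → Vec d} (hψm : Measurable ψ) (hψ : MemLp ψ 2 P) (hψ0 : ∫ z, ψ z ∂P = 0)
    {χ : β → Vec d} (hχm : Measurable χ) (hχ : MemLp χ 2 Q) (hχ0 : ∫ z, χ z ∂Q = 0)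
    {N : ℕ → ℕ} (hN : Tendsto N atTop atTop) {r : ℝ}
    (hr : Tendsto (fun n : ℕ => (n : ℝ) / (N n : ℝ)) atTop (𝓝 r))
    (hS : (crossCov P ψ ψ + r • crossCov Q χ χ).PosSemidef) :
    TendstoInDistribution (fun (n : ℕ) ω =>
        √(n : ℝ) • (avg (firstPoints n (fun i => Z i ω)) ψ +
          avg (firstPoints (N n) (fun i => U i ω)) χ)) atTop id (fun _ => μ)
      (multivariateGaussian 0 (crossCov P ψ ψ + r • crossCov Q χ χ)) := by
  have hA : ∀ n : ℕ, Measurable fun ω => √(n : ℝ) • avg (firstPoints n (fun i => Z i ω)) ψ :=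
    fun n => (measurable_smul_avg_firstPoints hψm _ n).comp (measurable_pi_lambda _ hZ)
  have hB : ∀ n : ℕ, Measurable fun ω => √(n : ℝ) • avg (firstPoints (N n) (fun i => U i ω)) χ :=
    fun n => (measurable_smul_avg_firstPoints hχm _ (N n)).comp (measurable_pi_lambda _ hU)
  simp only [smul_add]
  refine ⟨fun n => ((hA n).add (hB n)).aemeasurable, aemeasurable_id, ?_⟩
  refine ProbabilityMeasure.tendsto_iff_tendsto_charFun.2 fun x => ?_
  simp only [ProbabilityMeasure.coe_mk, Measure.map_id]
  have h1 : Tendsto (fun n : ℕ => (n : ℝ) / ((id n : ℕ) : ℝ)) atTop (𝓝 1) := by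
    refine tendsto_const_nhds.congr' ?_
    filter_upwards [eventually_gt_atTop 0] with n hn
    have : (n : ℝ) ≠ 0 := by positivity
    simp [this]
  -- Independence of the samples factorizes the characteristic function, and the limiting exponents
  -- add.
  have h2 := (charFun_map_avg hZ hZlaw hZindep hψm hψ hψ0 tendsto_id h1 x).mul
    (charFun_map_avg hU hUlaw hUindep hχm hχ hχ0 hN hr x)
  have h3 : charFun (multivariateGaussian 0 (crossCov P ψ ψ + r • crossCov Q χ χ)) x =
      Complex.exp (-(1 * (WithLp.ofLp x ⬝ᵥ (crossCov P ψ ψ).mulVec (WithLp.ofLp x)) : ℝ) / 2) *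
      Complex.exp (-(r * (WithLp.ofLp x ⬝ᵥ (crossCov Q χ χ).mulVec (WithLp.ofLp x)) : ℝ) / 2) := by
    rw [charFun_multivariateGaussian hS, ← Complex.exp_add]
    congr 1
    simp only [inner_zero_right, Complex.ofReal_zero, zero_mul, zero_sub, Matrix.add_mulVec,
      Matrix.smul_mulVec, dotProduct_add, dotProduct_smul, smul_eq_mul]
    push_cast
    ring
  rw [h3]
  refine h2.congr fun n => ?_
  rw [IndepFun.charFun_map_fun_add_eq_mul (hA n).aemeasurable (hB n).aemeasurable
    (hZU.comp (measurable_smul_avg_firstPoints hψm _ n)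
      (measurable_smul_avg_firstPoints hχm _ (N n)))]
  rfl

end CentralLimit

end RePPI

namespace RePPI

/-! ### Algebra of covariance matrices. -/

section CrossCovarianceAlgebra

variable {α : Type*} [MeasurableSpace α] {P : Measure α} [IsProbabilityMeasure P] {d : ℕ}
  {φ φ' ψ ψ' : α → Vec d}

lemma crossCov_transpose (P : Measure α) (φ ψ : α → Vec d) :
    (crossCov P φ ψ).transpose = crossCov P ψ φ := by
  ext i j
  exact covariance_comm _ _

lemma crossCov_sub_left (hφ : MemLp φ 2 P) (hφ' : MemLp φ' 2 P) (hψ : MemLp ψ 2 P) :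
    crossCov P (fun z => φ z - φ' z) ψ = crossCov P φ ψ - crossCov P φ' ψ := by
  ext i j
  exact covariance_fun_sub_left (hφ.eval_piLp i) (hφ'.eval_piLp i) (hψ.eval_piLp j)

lemma crossCov_sub_right (hφ : MemLp φ 2 P) (hψ : MemLp ψ 2 P) (hψ' : MemLp ψ' 2 P) :
    crossCov P φ (fun z => ψ z - ψ' z) = crossCov P φ ψ - crossCov P φ ψ' := by
  rw [← crossCov_transpose, crossCov_sub_left hψ hψ' hφ, Matrix.transpose_sub, crossCov_transpose,
    crossCov_transpose]

lemma crossCov_sub_const_left (hφ : Integrable φ P) (c : Vec d) (ψ : α → Vec d) :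
    crossCov P (fun z => φ z - c) ψ = crossCov P φ ψ := by
  ext i j
  exact covariance_sub_const_left ((EuclideanSpace.proj i : Vec d →L[ℝ] ℝ).integrable_comp hφ) _

lemma crossCov_sub_const_right (φ : α → Vec d) (hψ : Integrable ψ P) (c : Vec d) :
    crossCov P φ (fun z => ψ z - c) = crossCov P φ ψ := by
  rw [← crossCov_transpose, crossCov_sub_const_left hψ, crossCov_transpose]

lemma crossCov_clm_left (A : Matrix (Fin d) (Fin d) ℝ) (hφ : MemLp φ 2 P) (hψ : MemLp ψ 2 P) :
    crossCov P (fun z => Matrix.toEuclideanCLM (𝕜 := ℝ) A (φ z)) ψ = A * crossCov P φ ψ := by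
  ext i j
  simp only [crossCov, Matrix.of_apply, Matrix.ofLp_toEuclideanCLM, Matrix.mul_apply,
    Matrix.mulVec, dotProduct]
  rw [covariance_fun_sum_left (fun k => (hφ.eval_piLp k).const_mul _) (hψ.eval_piLp j)]
  simp only [covariance_const_mul_left]

lemma crossCov_clm_right (A : Matrix (Fin d) (Fin d) ℝ) (hφ : MemLp φ 2 P) (hψ : MemLp ψ 2 P) :
    crossCov P φ (fun z => Matrix.toEuclideanCLM (𝕜 := ℝ) A (ψ z)) =
      crossCov P φ ψ * A.transpose := by
  rw [← crossCov_transpose, crossCov_clm_left A hψ hφ, Matrix.transpose_mul, crossCov_transpose]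

lemma memLp_clm (A : Matrix (Fin d) (Fin d) ℝ) (hφ : MemLp φ 2 P) :
    MemLp (fun z => Matrix.toEuclideanCLM (𝕜 := ℝ) A (φ z)) 2 P :=
  (Matrix.toEuclideanCLM (𝕜 := ℝ) A).comp_memLp' hφ

lemma crossCov_clm (A : Matrix (Fin d) (Fin d) ℝ) (hφ : MemLp φ 2 P) :
    crossCov P (fun z => Matrix.toEuclideanCLM (𝕜 := ℝ) A (φ z))
      (fun z => Matrix.toEuclideanCLM (𝕜 := ℝ) A (φ z)) =
      A * crossCov P φ φ * A.transpose := by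
  rw [crossCov_clm_left A hφ (memLp_clm A hφ), crossCov_clm_right A hφ hφ, Matrix.mul_assoc]

lemma crossCov_sub_clm (A : Matrix (Fin d) (Fin d) ℝ) (hφ : MemLp φ 2 P) (hψ : MemLp ψ 2 P) :
    crossCov P (fun z => φ z - Matrix.toEuclideanCLM (𝕜 := ℝ) A (ψ z))
      (fun z => φ z - Matrix.toEuclideanCLM (𝕜 := ℝ) A (ψ z)) =
      crossCov P φ φ - crossCov P φ ψ * A.transpose - A * crossCov P ψ φ +
        A * crossCov P ψ ψ * A.transpose := by
  have hA := memLp_clm A hψ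
  have hφA : MemLp (fun z => φ z - Matrix.toEuclideanCLM (𝕜 := ℝ) A (ψ z)) 2 P := hφ.sub hA
  rw [crossCov_sub_left hφ hA hφA, crossCov_sub_right hφ hφ hA, crossCov_sub_right hA hφ hA,
    crossCov_clm A hψ, crossCov_clm_left A hψ hφ, crossCov_clm_right A hφ hψ]
  abel

lemma crossCov_posSemidef (hφ : MemLp φ 2 P) : (crossCov P φ φ).PosSemidef := by
  refine Matrix.PosSemidef.of_dotProduct_mulVec_nonneg ?_ fun x => ?_
  · rw [Matrix.IsHermitian, Matrix.conjTranspose_eq_transpose_of_trivial, crossCov_transpose]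
  · have h := dotProduct_crossCov_mulVec hφ hφ (WithLp.toLp 2 x) (WithLp.toLp 2 x)
    rw [star_trivial]
    rw [covariance_self (hφ.inner_const _).1.aemeasurable] at h
    exact h.symm ▸ variance_nonneg _ _

lemma crossCov_comp_eq_of_map_eq {β 𝒮 : Type*} [MeasurableSpace β] [MeasurableSpace 𝒮]
    {Q : Measure β} {pL : α → 𝒮} {pU : β → 𝒮} (hpL : Measurable pL) (hpU : Measurable pU)
    (hPQ : P.map pL = Q.map pU) {g h : 𝒮 → Vec d} (hg : Measurable g) (hh : Measurable h) :
    crossCov Q (fun u => g (pU u)) (fun u => h (pU u)) =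
      crossCov P (fun z => g (pL z)) (fun z => h (pL z)) := by
  ext i j
  have hi : Measurable fun v => g v i :=
    (EuclideanSpace.proj i : Vec d →L[ℝ] ℝ).continuous.measurable.comp hg
  have hj : Measurable fun v => h v j :=
    (EuclideanSpace.proj j : Vec d →L[ℝ] ℝ).continuous.measurable.comp hh
  have h1 := covariance_map_fun (μ := Q) (Z := pU) hi.aestronglyMeasurable hj.aestronglyMeasurable
    hpU.aemeasurable
  have h2 := covariance_map_fun (μ := P) (Z := pL) hi.aestronglyMeasurable hj.aestronglyMeasurable
    hpL.aemeasurable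
  simp only [crossCov, Matrix.of_apply]
  rw [← h1, ← h2, hPQ]

/-- The cross-covariance with a function of the conditioning variable is that of the conditional
expectation. -/
lemma crossCov_eq_of_condExp {m m₀ : MeasurableSpace α} {P : Measure[m₀] α}
    [IsProbabilityMeasure P] {φ ψ χ : α → Vec d} (hm : m ≤ m₀)
    (hφ : MemLp φ 2 P) (hψ : MemLp ψ 2 P) (hχ : MemLp χ 2 P) (hχm : Measurable[m] χ)
    (h : ψ =ᵐ[P] P[φ | m]) : crossCov P φ χ = crossCov P ψ χ := by
  ext i j
  have hφi := hφ.eval_piLp i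
  have hψi := hψ.eval_piLp i
  have hχj := hχ.eval_piLp j
  have h1 : (fun z => ψ z i) =ᵐ[P] P[fun z => φ z i | m] := by
    have h2 := ContinuousLinearMap.comp_condExp_comm (m := m) (hφ.integrable one_le_two)
      (EuclideanSpace.proj i : Vec d →L[ℝ] ℝ)
    filter_upwards [h, h2] with z hz hz2
    rw [hz]
    exact hz2
  have hχjm : StronglyMeasurable[m] fun z => χ z j :=
    (((EuclideanSpace.proj j : Vec d →L[ℝ] ℝ).continuous.measurable.comp hχm)).stronglyMeasurable
  have h3 : ∫ z, φ z i ∂P = ∫ z, ψ z i ∂P := by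
    rw [integral_congr_ae h1, integral_condExp hm]
  have h4 : ∫ z, ((fun z => φ z i) * fun z => χ z j) z ∂P =
      ∫ z, ((fun z => ψ z i) * fun z => χ z j) z ∂P := by
    rw [← integral_condExp hm]
    refine integral_congr_ae ?_
    refine (condExp_mul_of_stronglyMeasurable_right hχjm (hφi.integrable_mul hχj)
      (hφi.integrable one_le_two)).trans ?_
    filter_upwards [h1] with z hz
    simp only [Pi.mul_apply, hz]
  simp only [crossCov, Matrix.of_apply]
  rw [covariance_eq_sub hφi hχj, covariance_eq_sub hψi hχj, h3, h4]

end CrossCovarianceAlgebra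

section CovarianceIdentities

variable {d : ℕ} {CG Cs Cgs : Matrix (Fin d) (Fin d) ℝ} {c r : ℝ}

/-- With `D = Cgs * Cs⁻¹ * Cgsᵀ`, the cross terms contribute `-2 c D` and the two squares `(1 + r)
c² D = c D`. This is where the factor `1 / (1 + r)` of the imputed loss pays off. -/
lemma recalibrated_covariance_identity (hCs : Cs.PosDef) (hc : c * (1 + r) = 1) :
    CG - Cgs * (c • (Cgs * Cs⁻¹)).transpose - c • (Cgs * Cs⁻¹) * Cgs.transpose +
        c • (Cgs * Cs⁻¹) * Cs * (c • (Cgs * Cs⁻¹)).transpose +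
        r • (c • (Cgs * Cs⁻¹) * Cs * (c • (Cgs * Cs⁻¹)).transpose) =
      CG - c • (Cgs * Cs⁻¹ * Cgs.transpose) := by
  have hsymm : Cs.transpose = Cs := by
    simpa [Matrix.IsHermitian, Matrix.conjTranspose_eq_transpose_of_trivial] using hCs.isHermitian
  have hT : (c • (Cgs * Cs⁻¹)).transpose = c • (Cs⁻¹ * Cgs.transpose) := by
    rw [Matrix.transpose_smul, Matrix.transpose_mul, Matrix.transpose_nonsing_inv, hsymm]
  have h1 : c • (Cgs * Cs⁻¹) * Cs = c • Cgs := by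
    rw [Matrix.smul_mul, Matrix.mul_assoc, Matrix.nonsing_inv_mul _ hCs.det_pos.ne'.isUnit,
      Matrix.mul_one]
  rw [hT, h1]
  simp only [Matrix.smul_mul, Matrix.mul_smul, ← Matrix.mul_assoc]
  generalize Cgs * Cs⁻¹ * Cgs.transpose = D
  have h2 : r • c • c • D = (c - c * c) • D := by
    rw [smul_smul, smul_smul]
    congr 1
    linear_combination c * hc
  rw [h2]
  module

end CovarianceIdentities

/-! ### Comparison of the asymptotic covariances. -/

section AsymptoticCovariance

variable {𝒳 𝒲 𝒴 𝒱 : Type*} [MeasurableSpace 𝒳] [MeasurableSpace 𝒲] [MeasurableSpace 𝒴]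
  [MeasurableSpace 𝒱] {d : ℕ} {P : Measure (𝒳 × 𝒲 × 𝒴)} [IsProbabilityMeasure P]
  {ℓ : Vec d → 𝒳 → 𝒴 → ℝ} {θs : Vec d} {f : 𝒳 × 𝒲 → 𝒱} {r : ℝ} {s : 𝒳 × 𝒱 → Vec d}

lemma measurable_predL (hf : Measurable f) : Measurable (predL f : 𝒳 × 𝒲 × 𝒴 → 𝒳 × 𝒱) :=
  measurable_fst.prodMk (hf.comp (measurable_fst.prodMk (measurable_fst.comp measurable_snd)))

lemma transpose_inv_of_posDef {H : Matrix (Fin d) (Fin d) ℝ} (hH : H.PosDef) :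
    H⁻¹.transpose = H⁻¹ := by
  simpa [Matrix.IsHermitian, Matrix.conjTranspose_eq_transpose_of_trivial] using hH.inv.isHermitian

lemma posSemidef_sandwich {B C : Matrix (Fin d) (Fin d) ℝ} (hB : B.transpose = B)
    (hC : C.PosSemidef) : (B * C * B).PosSemidef := by
  have := hC.mul_mul_conjTranspose_same B
  rwa [Matrix.conjTranspose_eq_transpose_of_trivial, hB] at this

/-- The difference is `H⁻¹ Δ H⁻¹`, and `Δ` is a nonnegative multiple of `A Cov(s)⁻¹ Aᵀ` with `A =
Cov(∇ℓ, s)`. -/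
lemma xyCov_sub_reppiCov_posSemidef (hH : (expHessian P ℓ θs).PosDef) (hr : 0 ≤ r)
    (hcov : (crossCov P (fun z => s (predL f z)) fun z => s (predL f z)).PosDef) :
    (xyCov P ℓ θs - reppiCov P ℓ θs f r s).PosSemidef := by
  have h1 : xyCov P ℓ θs - reppiCov P ℓ θs f r s =
      (expHessian P ℓ θs)⁻¹ * reduction P ℓ θs f r s * (expHessian P ℓ θs)⁻¹ := by
    rw [xyCov, reppiCov]
    noncomm_ring
  rw [h1]
  refine posSemidef_sandwich (transpose_inv_of_posDef hH) ?_
  rw [reduction]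
  refine Matrix.PosSemidef.smul ?_ (by positivity)
  rw [← crossCov_transpose P (gradLoss ℓ θs), ← Matrix.conjTranspose_eq_transpose_of_trivial]
  exact hcov.inv.posSemidef.mul_mul_conjTranspose_same _

/-- The covariance of the recalibrated estimator is that of the sum of the averages of its
influence functions. -/
lemma reppiCov_eq (hH : (expHessian P ℓ θs).PosDef) (hr : 0 ≤ r)
    (hg : MemLp (gradLoss ℓ θs) 2 P) (hs : MemLp (fun z => s (predL f z)) 2 P)
    (hcov : (crossCov P (fun z => s (predL f z)) fun z => s (predL f z)).PosDef)
    {K : Matrix (Fin d) (Fin d) ℝ}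
    (hK : K = (1 / (1 + r)) • (crossCov P (gradLoss ℓ θs) (fun z => s (predL f z)) *
      (crossCov P (fun z => s (predL f z)) fun z => s (predL f z))⁻¹)) (m : Vec d) :
    crossCov P
        (fun z => Matrix.toEuclideanCLM (𝕜 := ℝ) (-(expHessian P ℓ θs)⁻¹)
          (gradLoss ℓ θs z - Matrix.toEuclideanCLM (𝕜 := ℝ) K (s (predL f z) - m)))
        (fun z => Matrix.toEuclideanCLM (𝕜 := ℝ) (-(expHessian P ℓ θs)⁻¹)
          (gradLoss ℓ θs z - Matrix.toEuclideanCLM (𝕜 := ℝ) K (s (predL f z) - m))) +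
      r • crossCov P
        (fun z => Matrix.toEuclideanCLM (𝕜 := ℝ) (-(expHessian P ℓ θs)⁻¹)
          (Matrix.toEuclideanCLM (𝕜 := ℝ) K (s (predL f z) - m)))
        (fun z => Matrix.toEuclideanCLM (𝕜 := ℝ) (-(expHessian P ℓ θs)⁻¹)
          (Matrix.toEuclideanCLM (𝕜 := ℝ) K (s (predL f z) - m))) =
      reppiCov P ℓ θs f r s := by
  have hsm : MemLp (fun z => s (predL f z) - m) 2 P := hs.sub (memLp_const m)
  have hc : 1 / (1 + r) * (1 + r) = 1 := by
    have : 1 + r ≠ 0 := by positivity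
    field_simp
  have hsi := hs.integrable one_le_two
  have hgK : MemLp (fun z => gradLoss ℓ θs z -
      Matrix.toEuclideanCLM (𝕜 := ℝ) K (s (predL f z) - m)) 2 P := hg.sub (memLp_clm K hsm)
  rw [crossCov_clm _ hgK, crossCov_clm _ (memLp_clm K hsm),
    crossCov_sub_clm K hg hsm, crossCov_clm K hsm, crossCov_sub_const_left hsi,
    crossCov_sub_const_left hsi, crossCov_sub_const_right _ hsi, crossCov_sub_const_right _ hsi,
    Matrix.transpose_neg, transpose_inv_of_posDef hH, reppiCov, reduction,
    ← crossCov_transpose P (gradLoss ℓ θs) (fun z => s (predL f z)), hK,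
    ← recalibrated_covariance_identity (CG := crossCov P (gradLoss ℓ θs) (gradLoss ℓ θs))
      (Cgs := crossCov P (gradLoss ℓ θs) fun z => s (predL f z)) hcov hc]
  have hneg : ∀ B X Y : Matrix (Fin d) (Fin d) ℝ,
      -B * X * -B + r • (-B * Y * -B) = B * (X + r • Y) * B := fun B X Y => by
    simp [mul_add, add_mul]
  exact hneg _ _ _

/-- Completion of the square in `h`: as `∇ℓ` and `s` have the same covariance with `h`, the middle
factor is `Cov(∇ℓ) - Cov(s, h) - Cov(h, s) + (1 + r) Cov(h)`, which is minimal at `h = s / (1 + r)`.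
-/
lemma ppiCov_eq_of_crossCov_eq (hr : 0 ≤ r)
    (hg : MemLp (gradLoss ℓ θs) 2 P) (hs : MemLp (fun z => s (predL f z)) 2 P)
    {h : 𝒳 × 𝒱 → Vec d} (hh : MemLp (fun z => h (predL f z)) 2 P)
    (hgh : crossCov P (gradLoss ℓ θs) (fun z => h (predL f z)) =
      crossCov P (fun z => s (predL f z)) (fun z => h (predL f z))) :
    ppiCov P ℓ θs f r h = (expHessian P ℓ θs)⁻¹ *
      (crossCov P (gradLoss ℓ θs) (gradLoss ℓ θs) -
        (1 / (1 + r)) • crossCov P (fun z => s (predL f z)) (fun z => s (predL f z)) +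
        (1 + r) • crossCov P (fun z => h (predL f z) - (1 / (1 + r)) • s (predL f z))
          (fun z => h (predL f z) - (1 / (1 + r)) • s (predL f z))) * (expHessian P ℓ θs)⁻¹ := by
  rw [ppiCov]
  congr 2
  have h1r : 1 + r ≠ 0 := by positivity
  have h1 := crossCov_sub_clm (P := P) 1 hg hh
  have h2 := crossCov_sub_clm (P := P) ((1 / (1 + r)) • 1) hh hs
  simp only [map_one, map_smul, one_apply_eq_self, smul_apply,
    Matrix.transpose_one, Matrix.transpose_smul, mul_one, one_mul, Matrix.mul_smul,
    Matrix.smul_mul] at h1 h2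
  rw [h1, h2, hgh, ← crossCov_transpose P (gradLoss ℓ θs) (fun z => h (predL f z)), hgh,
    crossCov_transpose]
  match_scalars <;> field_simp <;> ring

lemma crossCov_gradLoss_eq (hf : Measurable f)
    (hcond : (fun z => s (predL f z)) =ᵐ[P]
      P[gradLoss ℓ θs | MeasurableSpace.comap (predL f) inferInstance])
    (hg : MemLp (gradLoss ℓ θs) 2 P) (hs : MemLp (fun z => s (predL f z)) 2 P)
    {h : 𝒳 × 𝒱 → Vec d} (hhm : Measurable h) (hh : MemLp (fun z => h (predL f z)) 2 P) :
    crossCov P (gradLoss ℓ θs) (fun z => h (predL f z)) =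
      crossCov P (fun z => s (predL f z)) (fun z => h (predL f z)) := by
  have hpL : Measurable (predL f : 𝒳 × 𝒲 × 𝒴 → 𝒳 × 𝒱) := measurable_predL hf
  exact crossCov_eq_of_condExp hpL.comap_le hg hs hh (hhm.comp (comap_measurable _)) hcond

/-- If the score is the conditional expectation of the gradient, the variance reduction is
a multiple of the covariance of the score. -/
lemma reppiCov_eq_of_condExp (hf : Measurable f)
    (hcond : (fun z => s (predL f z)) =ᵐ[P]
      P[gradLoss ℓ θs | MeasurableSpace.comap (predL f) inferInstance])
    (hg : MemLp (gradLoss ℓ θs) 2 P) (hsm : Measurable s)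
    (hs : MemLp (fun z => s (predL f z)) 2 P)
    (hcov : (crossCov P (fun z => s (predL f z)) fun z => s (predL f z)).PosDef) :
    reppiCov P ℓ θs f r s = (expHessian P ℓ θs)⁻¹ *
      (crossCov P (gradLoss ℓ θs) (gradLoss ℓ θs) -
        (1 / (1 + r)) • crossCov P (fun z => s (predL f z)) (fun z => s (predL f z))) *
      (expHessian P ℓ θs)⁻¹ := by
  have h1 := crossCov_gradLoss_eq hf hcond hg hs hsm hs
  have h2 : crossCov P (fun z => s (predL f z)) (gradLoss ℓ θs) =
      crossCov P (fun z => s (predL f z)) (fun z => s (predL f z)) := by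
    rw [← crossCov_transpose P (gradLoss ℓ θs), h1, crossCov_transpose]
  rw [reppiCov, reduction, h1, h2,
    Matrix.mul_nonsing_inv _ hcov.det_pos.ne'.isUnit, Matrix.one_mul]

/-- At `h = s / (1 + r)` the completed square vanishes. -/
lemma reppiCov_eq_ppiCov (hf : Measurable f) (hr : 0 ≤ r)
    (hcond : (fun z => s (predL f z)) =ᵐ[P]
      P[gradLoss ℓ θs | MeasurableSpace.comap (predL f) inferInstance])
    (hg : MemLp (gradLoss ℓ θs) 2 P) (hsm : Measurable s)
    (hs : MemLp (fun z => s (predL f z)) 2 P)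
    (hcov : (crossCov P (fun z => s (predL f z)) fun z => s (predL f z)).PosDef) :
    reppiCov P ℓ θs f r s = ppiCov P ℓ θs f r (fun v => (1 / (1 + r)) • s v) := by
  have hh : MemLp (fun z => (1 / (1 + r)) • s (predL f z)) 2 P :=
    hs.const_smul (1 / (1 + r))
  rw [reppiCov_eq_of_condExp hf hcond hg hsm hs hcov, ppiCov_eq_of_crossCov_eq hr hg hs
    (h := fun v => (1 / (1 + r)) • s v) hh
    (crossCov_gradLoss_eq hf hcond hg hs (h := fun v => (1 / (1 + r)) • s v)
      (hsm.const_smul (1 / (1 + r))) hh)]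
  have h0 : crossCov P (fun _ : 𝒳 × 𝒲 × 𝒴 => (0 : Vec d)) (fun _ => 0) = 0 := by
    ext i j
    exact covariance_const_left _
  simp only [sub_self, h0, smul_zero, add_zero]

/-- The difference is exactly the completed square between two factors `H⁻¹`. -/
lemma ppiCov_sub_reppiCov_posSemidef (hf : Measurable f) (hr : 0 ≤ r)
    (hH : (expHessian P ℓ θs).PosDef)
    (hcond : (fun z => s (predL f z)) =ᵐ[P]
      P[gradLoss ℓ θs | MeasurableSpace.comap (predL f) inferInstance])
    (hg : MemLp (gradLoss ℓ θs) 2 P) (hsm : Measurable s)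
    (hs : MemLp (fun z => s (predL f z)) 2 P)
    (hcov : (crossCov P (fun z => s (predL f z)) fun z => s (predL f z)).PosDef)
    {h : 𝒳 × 𝒱 → Vec d} (hhm : Measurable h) (hh : MemLp (fun z => h (predL f z)) 2 P) :
    (ppiCov P ℓ θs f r h - reppiCov P ℓ θs f r s).PosSemidef := by
  rw [reppiCov_eq_of_condExp hf hcond hg hsm hs hcov, ppiCov_eq_of_crossCov_eq hr hg hs hh
    (crossCov_gradLoss_eq hf hcond hg hs hhm hh), ← sub_mul, ← mul_sub, add_sub_cancel_left]
  refine posSemidef_sandwich (transpose_inv_of_posDef hH) ?_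
  have hd : MemLp (fun z => h (predL f z) - (1 / (1 + r)) • s (predL f z)) 2 P :=
    hh.sub (hs.const_smul (1 / (1 + r)))
  exact (crossCov_posSemidef hd).smul (by positivity)

end AsymptoticCovariance

end RePPI

namespace RePPI

/-! ### From linear expansions to asymptotic normality. -/

section SampleSizes

variable {N : ℕ → ℕ} {r : ℝ}

/-- The unlabeled sample is at least of the order of `n`, so `√n` times the fluctuation of its
averages stays bounded in probability. -/
lemma exists_eventually_le_mul (hN : ∀ n, 0 < N n)
    (hr : Tendsto (fun n : ℕ => (n : ℝ) / (N n : ℝ)) atTop (𝓝 r)) :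
    ∃ q : ℕ, ∀ᶠ n in atTop, n ≤ q * N n := by
  refine ⟨⌈r + 1⌉₊, ?_⟩
  filter_upwards [hr.eventually (gt_mem_nhds (lt_add_one r))] with n hn
  have h0 : (0 : ℝ) < N n := by exact_mod_cast hN n
  have h1 : (n : ℝ) ≤ ⌈r + 1⌉₊ * N n :=
    ((div_lt_iff₀ h0).1 hn).le.trans (mul_le_mul_of_nonneg_right (Nat.le_ceil _) h0.le)
  exact_mod_cast h1

lemma tendsto_atTop_of_eventually_le_mul {q : ℕ} (hq : ∀ᶠ n in atTop, n ≤ q * N n) :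
    Tendsto N atTop atTop := by
  refine tendsto_atTop.2 fun b => ?_
  filter_upwards [hq, eventually_gt_atTop (q * b)] with n h1 h2
  by_contra! h3
  exact absurd (h2.trans_le h1) (not_lt.2 (Nat.mul_le_mul_left q h3.le))

end SampleSizes

section AsymptoticNormality

variable {α Ω Ξ β : Type*} [MeasurableSpace α] [MeasurableSpace β] [MeasurableSpace Ω]
  [MeasurableSpace Ξ]
  {μ : Measure Ω} [IsProbabilityMeasure μ]
  {P : Measure α} [IsProbabilityMeasure P] {Q : Measure β} [IsProbabilityMeasure Q]
  {Z : ℕ → Ω → α} {U : ℕ → Ω → β} {κ : (n : ℕ) → Ω → Fin n → Fin 3} {ξ : ℕ → Fin 3 → Ω → Ξ}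
  {d : ℕ} {N : ℕ → ℕ} {ψ : α → Vec d} {χ : β → Vec d} {θs : Vec d} {r : ℝ}

lemma crossCov_congr {φ φ' : α → Vec d} (h : φ =ᵐ[P] φ') : crossCov P φ φ = crossCov P φ' φ' := by
  ext i j
  have hk : ∀ k, (fun z => φ z k) =ᵐ[P] fun z => φ' z k := fun k => by
    filter_upwards [h] with z hz
    rw [hz]
  simp only [crossCov, Matrix.of_apply, covariance]
  rw [integral_congr_ae (hk i), integral_congr_ae (hk j)]
  refine integral_congr_ae ?_
  filter_upwards [h] with z hz
  rw [hz]

/-- An estimator with an asymptotically linear expansion is asymptotically normal. -/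
theorem IsSplitSample.asymptoticallyNormal (h : IsSplitSample μ P Q Z U κ ξ)
    (hψ : MemLp ψ 2 P) (hψ0 : ∫ z, ψ z ∂P = 0)
    (hχm : Measurable χ) (hχ : MemLp χ 2 Q) (hχ0 : ∫ u, χ u ∂Q = 0)
    (hN : Tendsto N atTop atTop)
    (hr : Tendsto (fun n : ℕ => (n : ℝ) / (N n : ℝ)) atTop (𝓝 r))
    {T : ℕ → Ω → Vec d} (hTm : ∀ n, AEMeasurable (T n) μ)
    (hT : Tendsto (fun p : ℕ × Ω => √(p.1 : ℝ) • (T p.1 p.2 - θs) -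
      √(p.1 : ℝ) • (avg (firstPoints p.1 (fun i => Z i p.2)) ψ +
        avg (firstPoints (N p.1) (fun i => U i p.2)) χ)) (probFilter μ) (𝓝 0))
    {S : Matrix (Fin d) (Fin d) ℝ} (hS : crossCov P ψ ψ + r • crossCov Q χ χ = S) :
    AsymptoticallyNormal μ T θs S := by
  have hr0 : 0 ≤ r := ge_of_tendsto' hr fun n => by positivity
  -- The gradient is only almost everywhere measurable. A measurable version has the same moments
  -- and almost surely the same averages over the data.
  obtain ⟨ψ', hψ'm, hψψ'⟩ := hψ.1.aemeasurable
  have hψ' : MemLp ψ' 2 P := hψ.ae_eq hψψ'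
  have hψ'0 : ∫ z, ψ' z ∂P = 0 := by rw [← integral_congr_ae hψψ', hψ0]
  rw [crossCov_congr hψψ'] at hS
  have hpsd : S.PosSemidef := hS ▸ (crossCov_posSemidef hψ').add ((crossCov_posSemidef hχ).smul hr0)
  refine ⟨hpsd, ?_⟩
  subst hS
  have hclt := tendstoInDistribution_avg_add_avg h.measurable_labeled h.law_labeled h.iIndep_labeled
    h.measurable_unlabeled h.law_unlabeled h.iIndep_unlabeled h.indep hψ'm hψ' hψ'0 hχm hχ hχ0
    hN hr hpsd
  -- Slutsky: the remainder vanishes in probability.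
  refine tendstoInDistribution_of_tendstoInMeasure_sub _ _ hclt
    (tendstoInMeasure_of_tendsto_probFilter (hT.congr' ?_))
    fun n => ((hTm n).sub_const θs).const_smul (√(n : ℝ))
  filter_upwards [h.lawOfLargeNumbers_firstPoints.ae _ hψψ'] with p hp
  rw [avg_congr hp]
  rfl

end AsymptoticNormality

section CrossFitMeasurability

variable {Ω : Type*} [MeasurableSpace Ω] {μ : Measure Ω} {d n : ℕ}

lemma aemeasurable_crossFit {κ : Ω → Fin n → Fin 3} (hκ : Measurable κ)
    {θhat : Fin 3 → Ω → Vec d} (hθ : ∀ k, AEMeasurable (θhat k) μ) :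
    AEMeasurable (fun ω => crossFit (κ ω) fun k => θhat k ω) μ := by
  have hw : ∀ k, Measurable fun ω => foldWeight (κ ω) k := fun k =>
    (measurable_of_finite fun κ₀ : Fin n → Fin 3 => foldWeight κ₀ k).comp hκ
  simp only [crossFit_eq]
  exact Finset.aemeasurable_fun_sum _ fun k _ => (hw k).aemeasurable.smul (hθ k)

end CrossFitMeasurability

section InfluenceFunctions

variable {𝒳 𝒲 𝒴 𝒱 : Type*} [MeasurableSpace 𝒳] [MeasurableSpace 𝒲] [MeasurableSpace 𝒴]
  [MeasurableSpace 𝒱] {d : ℕ} {P : Measure (𝒳 × 𝒲 × 𝒴)} [IsProbabilityMeasure P]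
  {Θ : Set (Vec d)} {ℓ : Vec d → 𝒳 → 𝒴 → ℝ} {θs : Vec d} {f : 𝒳 × 𝒲 → 𝒱} {s : 𝒳 × 𝒱 → Vec d}

lemma measurable_predU (hf : Measurable f) : Measurable (predU f : 𝒳 × 𝒲 → 𝒳 × 𝒱) :=
  measurable_fst.prodMk hf

lemma map_predL_eq (hf : Measurable f) :
    P.map (predL f) = (P.map fun z => (z.1, z.2.1)).map (predU f) := by
  rw [Measure.map_map (measurable_predU hf) (by fun_prop)]
  rfl

lemma integral_clm (A : Matrix (Fin d) (Fin d) ℝ) {α : Type*} [MeasurableSpace α] {P : Measure α}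
    {φ : α → Vec d} (hφ : Integrable φ P) :
    ∫ z, Matrix.toEuclideanCLM (𝕜 := ℝ) A (φ z) ∂P =
      Matrix.toEuclideanCLM (𝕜 := ℝ) A (∫ z, φ z ∂P) :=
  (Matrix.toEuclideanCLM (𝕜 := ℝ) A).integral_comp_comm hφ

lemma integral_gradLoss (hreg : RegularLoss P Θ ℓ θs) (htarget : IsUniqueTarget P Θ ℓ θs) :
    ∫ z, gradLoss ℓ θs z ∂P = 0 := by
  obtain ⟨R, M₁, M₃, hR⟩ := hreg.exists_regularOnBall htarget
  exact hR.integral_gradLoss_eq_zero htarget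

lemma integral_sub_integral {α : Type*} [MeasurableSpace α] {P : Measure α}
    [IsProbabilityMeasure P] {φ : α → Vec d} (hφ : Integrable φ P) :
    ∫ z, (φ z - ∫ z, φ z ∂P) ∂P = 0 := by
  rw [integral_sub hφ (integrable_const _)]
  simp

/-- The influence functions of the estimate of a rotation. -/
lemma avg_influence {D : Dataset (𝒳 × 𝒲 × 𝒴)} (hD : 0 < D.1) {D' : Dataset (𝒳 × 𝒲)}
    (hD' : 0 < D'.1) (B K : Matrix (Fin d) (Fin d) ℝ) (m : Vec d) (G : 𝒳 × 𝒲 × 𝒴 → Vec d) :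
    avg D (fun z => Matrix.toEuclideanCLM (𝕜 := ℝ) (-B)
        (G z - Matrix.toEuclideanCLM (𝕜 := ℝ) K (s (predL f z) - m))) +
      avg D' (fun u => Matrix.toEuclideanCLM (𝕜 := ℝ) (-B)
        (Matrix.toEuclideanCLM (𝕜 := ℝ) K (s (predU f u) - m))) =
    - Matrix.toEuclideanCLM (𝕜 := ℝ) B (avg D G - Matrix.toEuclideanCLM (𝕜 := ℝ) K
      (avg D (fun z => s (predL f z)) - avg D' fun u => s (predU f u))) := by
  simp only [avg_clm, avg_sub, avg_const hD, avg_const hD']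
  simp only [map_neg, neg_apply, map_sub]
  abel

end InfluenceFunctions

end RePPI

/-! ### Assembly of the theorem. -/

theorem theorem2
    {𝒳 𝒲 𝒴 𝒱 Ξ Ω : Type*}
    [MeasurableSpace 𝒳] [MeasurableSpace 𝒲] [MeasurableSpace 𝒴] [MeasurableSpace 𝒱]
    [MeasurableSpace Ξ] [MeasurableSpace Ω]
    (μ : Measure Ω) [IsProbabilityMeasure μ]
    {d : ℕ}
    -- population law of `(X, W, Y)`, prediction model `Ŷ = f (X, W)`, loss, target
    (P : Measure (𝒳 × 𝒲 × 𝒴)) [IsProbabilityMeasure P]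
    (f : 𝒳 × 𝒲 → 𝒱) (hf : Measurable f)
    (Θ : Set (RePPI.Vec d)) (ℓ : RePPI.Vec d → 𝒳 → 𝒴 → ℝ) (θs : RePPI.Vec d)
    (htarget : RePPI.IsUniqueTarget P Θ ℓ θs)
    (hreg : RePPI.RegularLoss P Θ ℓ θs)
    -- labeled and unlabeled samples
    (Z : ℕ → Ω → 𝒳 × 𝒲 × 𝒴) (U : ℕ → Ω → 𝒳 × 𝒲)
    (hsample : RePPI.IsSample μ P Z U)
    -- `n` labeled and `N n` unlabeled points
    (N : ℕ → ℕ) (hN : ∀ n, 0 < N n) (r : ℝ)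
    (hr : Tendsto (fun n : ℕ => (n : ℝ) / (N n : ℝ)) atTop (𝓝 r))
    -- random even split, and auxiliary randomness of the learning method
    (κ : (n : ℕ) → Ω → Fin n → Fin 3) (hκ : ∀ n, Measurable (κ n))
    (hκ_even : ∀ n ω, RePPI.EvenSplit (κ n ω))
    (ξ : ℕ → Fin 3 → Ω → Ξ) (hξ : ∀ n k, Measurable (ξ n k))
    (hindep : ∀ n, IndepFun (fun ω => (κ n ω, fun k => ξ n k ω))
      (fun ω => (fun i => Z i ω, fun j => U j ω)) μ)
    -- initial estimator: a measurable choice of the minimizer of the empirical risk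
    (init : RePPI.Dataset (𝒳 × 𝒲 × 𝒴) → RePPI.Vec d) (hinit : Measurable init)
    (hinit_min : ∀ D, RePPI.SelectsArgmin (RePPI.empRisk ℓ D) Θ (init D))
    -- the (arbitrary) learning method, and the limit `s` of the fitted functions
    (learn : ℕ → RePPI.Vec d → RePPI.Dataset (𝒳 × 𝒲 × 𝒴) → Ξ → 𝒳 × 𝒱 → RePPI.Vec d)
    (hlearn : ∀ n, Measurable
      (fun p : RePPI.Vec d × RePPI.Dataset (𝒳 × 𝒲 × 𝒴) × Ξ × (𝒳 × 𝒱) =>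
        learn n p.1 p.2.1 p.2.2.1 p.2.2.2))
    (s : 𝒳 × 𝒱 → RePPI.Vec d) (hs : Measurable s)
    (hs_L2 : MemLp (fun z => s (RePPI.predL f z)) 2 P)
    (hs_cov : (RePPI.crossCov P (fun z => s (RePPI.predL f z))
      (fun z => s (RePPI.predL f z))).PosDef)
    (hs_lim : ∀ k : Fin 3, ∀ ε : ENNReal, 0 < ε →
      Tendsto (fun n => μ {ω | ε ≤ ∫⁻ z,
        ‖RePPI.fittedScore init (learn n) (RePPI.fold (κ n ω) (fun i => Z i ω)) k (ξ n k ω)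
            (RePPI.predL f z) - s (RePPI.predL f z)‖ₑ ^ 2 ∂P}) atTop (𝓝 0))
    -- the estimates of the three rotations: minimizers of the respective objective functions
    (θhat : ℕ → Fin 3 → Ω → RePPI.Vec d) (hθhat : ∀ n k, AEMeasurable (θhat n k) μ)
    (hθhat_min : ∀ n k, ∀ᵐ ω ∂μ, RePPI.SelectsArgmin
      (RePPI.rotationObjective ℓ f init (learn n) n (RePPI.fold (κ n ω) (fun i => Z i ω))
        (RePPI.firstPoints (N n) (fun j => U j ω)) k (ξ n k ω)) Θ (θhat n k ω))
    -- the XY-only estimator: minimizer of the empirical risk on the whole labeled sample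
    (θXY : ℕ → Ω → RePPI.Vec d) (hθXY : ∀ n, AEMeasurable (θXY n) μ)
    (hθXY_min : ∀ n, ∀ᵐ ω ∂μ, RePPI.SelectsArgmin
      (RePPI.empRisk ℓ (RePPI.firstPoints n (fun i => Z i ω))) Θ (θXY n ω)) :
    -- asymptotic normality of the cross-fitted estimator
    RePPI.AsymptoticallyNormal μ
        (fun n ω => RePPI.crossFit (κ n ω) (fun k => θhat n k ω)) θs
        (RePPI.reppiCov P ℓ θs f r s) ∧
    -- it improves on the XY-only estimator
    (RePPI.AsymptoticallyNormal μ θXY θs (RePPI.xyCov P ℓ θs) ∧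
      (RePPI.xyCov P ℓ θs - RePPI.reppiCov P ℓ θs f r s).PosSemidef) ∧
    -- it attains the optimal variance of prediction-powered estimators if
    -- `s (X, Ŷ) = E[∇ℓ | X, Ŷ]`
    ((fun z => s (RePPI.predL f z)) =ᵐ[P]
        P[RePPI.gradLoss ℓ θs | MeasurableSpace.comap (RePPI.predL f) inferInstance] →
      RePPI.reppiCov P ℓ θs f r s =
          (RePPI.expHessian P ℓ θs)⁻¹ *
            (RePPI.crossCov P (RePPI.gradLoss ℓ θs) (RePPI.gradLoss ℓ θs) -
              (1 / (1 + r)) • RePPI.crossCov P (fun z => s (RePPI.predL f z))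
                (fun z => s (RePPI.predL f z))) *
            (RePPI.expHessian P ℓ θs)⁻¹ ∧
        RePPI.reppiCov P ℓ θs f r s =
          RePPI.ppiCov P ℓ θs f r (fun v => (1 / (1 + r)) • s v) ∧
        ∀ h : 𝒳 × 𝒱 → RePPI.Vec d, Measurable h →
          MemLp (fun z => h (RePPI.predL f z)) 2 P →
          (RePPI.ppiCov P ℓ θs f r h - RePPI.reppiCov P ℓ θs f r s).PosSemidef) := by
  obtain ⟨q, hq⟩ := RePPI.exists_eventually_le_mul hN hr
  have hNtop := RePPI.tendsto_atTop_of_eventually_le_mul hq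
  have hr0 : 0 ≤ r := ge_of_tendsto' hr fun n => by positivity
  have hXW : Measurable fun z : 𝒳 × 𝒲 × 𝒴 => (z.1, z.2.1) := by fun_prop
  have : IsProbabilityMeasure (P.map fun z => (z.1, z.2.1)) :=
    Measure.isProbabilityMeasure_map hXW.aemeasurable
  have hsplit : RePPI.IsSplitSample μ P (P.map fun z => (z.1, z.2.1)) Z U κ ξ :=
    ⟨hsample.measurable_labeled, hsample.measurable_unlabeled, hsample.law_labeled,
      hsample.law_unlabeled, hsample.iIndep_labeled, hsample.iIndep_unlabeled, hsample.indep, hκ,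
      hκ_even, hξ, hindep⟩
  have hPQ := RePPI.map_predL_eq (P := P) hf
  have hpL : Measurable (RePPI.predL f : 𝒳 × 𝒲 × 𝒴 → 𝒳 × 𝒱) := RePPI.measurable_predL hf
  have hpU : Measurable (RePPI.predU f : 𝒳 × 𝒲 → 𝒳 × 𝒱) := RePPI.measurable_predU hf
  have hH := RePPI.expHessian_posDef hreg htarget
  have hg := hreg.memLp_gradLoss
  have hg0 := RePPI.integral_gradLoss hreg htarget
  have hgi := hg.integrable one_le_two
  have hsi := hs_L2.integrable one_le_two
  refine ⟨?_, ⟨?_, RePPI.xyCov_sub_reppiCov_posSemidef hH hr0 hs_cov⟩, fun hcond =>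
    ⟨RePPI.reppiCov_eq_of_condExp hf hcond hg hs hs_L2 hs_cov,
      RePPI.reppiCov_eq_ppiCov hf hr0 hcond hg hs hs_L2 hs_cov, fun h hhm hh =>
        RePPI.ppiCov_sub_reppiCov_posSemidef hf hr0 hH hcond hg hs hs_L2 hs_cov hhm hh⟩⟩
  · set m : RePPI.Vec d := ∫ z, s (RePPI.predL f z) ∂P with hm
    -- `K` is the limit of `(1 + n / N)⁻¹ M̂`. Subtracting `m` from `s` centres both influence
    -- functions; it cancels between the labeled and the unlabeled average.
    set K : Matrix (Fin d) (Fin d) ℝ := (1 / (1 + r)) •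
      (RePPI.crossCov P (RePPI.gradLoss ℓ θs) (fun z => s (RePPI.predL f z)) *
        (RePPI.crossCov P (fun z => s (RePPI.predL f z)) fun z => s (RePPI.predL f z))⁻¹) with hK
    have hsU : MemLp (fun u => s (RePPI.predU f u)) 2 (P.map fun z => (z.1, z.2.1)) := by
      have h1 : MemLp s 2 (P.map (RePPI.predL f)) :=
        (memLp_map_measure_iff hs.aestronglyMeasurable hpL.aemeasurable).2 hs_L2
      rw [hPQ] at h1
      exact (memLp_map_measure_iff hs.aestronglyMeasurable hpU.aemeasurable).1 h1
    have hmU : ∫ u, s (RePPI.predU f u) ∂(P.map fun z => (z.1, z.2.1)) = m := by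
      rw [hm, ← integral_map hpL.aemeasurable hs.aestronglyMeasurable, hPQ,
        integral_map hpU.aemeasurable hs.aestronglyMeasurable]
    have hsm : MemLp (fun z => s (RePPI.predL f z) - m) 2 P := hs_L2.sub (memLp_const m)
    have hsUm : MemLp (fun u => s (RePPI.predU f u) - m) 2 (P.map fun z => (z.1, z.2.1)) :=
      hsU.sub (memLp_const m)
    have hgK : MemLp (fun z => RePPI.gradLoss ℓ θs z - Matrix.toEuclideanCLM (𝕜 := ℝ) K
        (s (RePPI.predL f z) - m)) 2 P := hg.sub (RePPI.memLp_clm K hsm)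
    have hψ := RePPI.memLp_clm (-(RePPI.expHessian P ℓ θs)⁻¹) hgK
    have hχ := RePPI.memLp_clm (-(RePPI.expHessian P ℓ θs)⁻¹) (RePPI.memLp_clm K hsUm)
    have hψ0 : ∫ z, Matrix.toEuclideanCLM (𝕜 := ℝ) (-(RePPI.expHessian P ℓ θs)⁻¹)
        (RePPI.gradLoss ℓ θs z - Matrix.toEuclideanCLM (𝕜 := ℝ) K
          (s (RePPI.predL f z) - m)) ∂P = 0 := by
      rw [RePPI.integral_clm _ (hgK.integrable one_le_two),
        integral_sub hgi ((RePPI.memLp_clm K hsm).integrable one_le_two), hg0,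
        RePPI.integral_clm _ (hsm.integrable one_le_two), RePPI.integral_sub_integral hsi]
      simp
    have hχ0 : ∫ u, Matrix.toEuclideanCLM (𝕜 := ℝ) (-(RePPI.expHessian P ℓ θs)⁻¹)
        (Matrix.toEuclideanCLM (𝕜 := ℝ) K (s (RePPI.predU f u) - m))
          ∂(P.map fun z => (z.1, z.2.1)) = 0 := by
      rw [RePPI.integral_clm _ ((RePPI.memLp_clm K hsUm).integrable one_le_two),
        RePPI.integral_clm _ (hsUm.integrable one_le_two), ← hmU,
        RePPI.integral_sub_integral (hsU.integrable one_le_two)]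
      simp
    have hχm : Measurable fun u => Matrix.toEuclideanCLM (𝕜 := ℝ) (-(RePPI.expHessian P ℓ θs)⁻¹)
        (Matrix.toEuclideanCLM (𝕜 := ℝ) K (s (RePPI.predU f u) - m)) := by
      have h1 : Measurable fun u => s (RePPI.predU f u) := hs.comp hpU
      fun_prop
    have hc : Tendsto (fun n : ℕ => 1 / (1 + (n : ℝ) / (N n : ℝ))) atTop (𝓝 (1 / (1 + r))) :=
      tendsto_const_nhds.div (tendsto_const_nhds.add hr) (by positivity)
    have hshat : ∀ k n, Measurable (Function.uncurry fun
        (a : (Fin 3 → Ξ) × RePPI.Dataset (𝒳 × 𝒲 × 𝒴) × RePPI.Dataset (𝒳 × 𝒲 × 𝒴)) v =>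
          learn n (init a.2.1) a.2.2 (a.1 k) v) := by
      intro k n
      have h1 : Measurable fun p : ((Fin 3 → Ξ) × RePPI.Dataset (𝒳 × 𝒲 × 𝒴) ×
          RePPI.Dataset (𝒳 × 𝒲 × 𝒴)) × (𝒳 × 𝒱) => (init p.1.2.1, p.1.2.2, p.1.1 k, p.2) := by
        have h2 : Measurable fun p : ((Fin 3 → Ξ) × RePPI.Dataset (𝒳 × 𝒲 × 𝒴) ×
            RePPI.Dataset (𝒳 × 𝒲 × 𝒴)) × (𝒳 × 𝒱) => init p.1.2.1 := hinit.comp (by fun_prop)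
        have h3 : Measurable fun p : ((Fin 3 → Ξ) × RePPI.Dataset (𝒳 × 𝒲 × 𝒴) ×
            RePPI.Dataset (𝒳 × 𝒲 × 𝒴)) × (𝒳 × 𝒱) => p.1.1 k := by fun_prop
        exact h2.prodMk (Measurable.prodMk (by fun_prop) (h3.prodMk measurable_snd))
      exact (hlearn n).comp h1
    have hrot : ∀ k : Fin 3, (RePPI.rotation k).1 ≠ (RePPI.rotation k).2.2 ∧
        (RePPI.rotation k).2.1 ≠ (RePPI.rotation k).2.2 := by
      intro k
      fin_cases k <;> simp [RePPI.rotation]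
    refine hsplit.asymptoticallyNormal hψ hψ0 hχm hχ hχ0 hNtop hr
      (fun n => RePPI.aemeasurable_crossFit (hκ n) (hθhat n))
      (hsplit.tendsto_crossFit (θhat := fun k p => θhat p.1 k p.2) hψ hψ0 hq hχm hχ hχ0
        fun k => ?_) ?_
    · have h1 := hsplit.tendsto_rotation hreg htarget hf hPQ hs hs_L2 hs_cov hq hc (hrot k).1
        (hrot k).2 hinit_min (shat := fun n a v => learn n (init a.2.1) a.2.2 (a.1 k) v) (hshat k)
        (hs_lim k) (θhat := fun p => θhat p.1 k p.2)
        (RePPI.eventually_probFilter_of_ae fun n => hθhat_min n k)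
      refine h1.congr' ?_
      -- The fold must be nonempty for the average of the constant `m` to be `m`.
      filter_upwards [(hsplit.tendsto_card_fold (RePPI.rotation k).2.2).eventually_gt_atTop 0]
        with p hp
      rw [RePPI.avg_influence hp (hN p.1), smul_neg, sub_neg_eq_add, map_smul]
    · rw [← RePPI.reppiCov_eq hH hr0 hg hs_L2 hs_cov hK m]
      congr 2
      exact RePPI.crossCov_comp_eq_of_map_eq hpL hpU hPQ
        (g := fun v => Matrix.toEuclideanCLM (𝕜 := ℝ) (-(RePPI.expHessian P ℓ θs)⁻¹)
          (Matrix.toEuclideanCLM (𝕜 := ℝ) K (s v - m)))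
        (h := fun v => Matrix.toEuclideanCLM (𝕜 := ℝ) (-(RePPI.expHessian P ℓ θs)⁻¹)
          (Matrix.toEuclideanCLM (𝕜 := ℝ) K (s v - m))) (by fun_prop) (by fun_prop)
  · have hψ := RePPI.memLp_clm (-(RePPI.expHessian P ℓ θs)⁻¹) hg
    have hψ0 : ∫ z, Matrix.toEuclideanCLM (𝕜 := ℝ) (-(RePPI.expHessian P ℓ θs)⁻¹)
        (RePPI.gradLoss ℓ θs z) ∂P = 0 := by
      rw [RePPI.integral_clm _ hgi, hg0, map_zero]
    have hgb := hsplit.bddInProb_firstPoints_vec hg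
    simp only [hg0, sub_zero] at hgb
    -- The XY-only estimator is the case of zero tilt, with zero influence function on the unlabeled
    -- points.
    have h1 := RePPI.tendsto_sqrt_smul_argmin (b := fun _ => 0) (θhat := fun p => θXY p.1 p.2)
      hreg htarget hsplit.lawOfLargeNumbers_firstPoints
      (RePPI.bddInProb_of_tendsto (c := 0) (by simp [tendsto_const_nhds])) hgb
      (RePPI.eventually_probFilter_of_ae fun n => by simpa using hθXY_min n)
    refine hsplit.asymptoticallyNormal (χ := fun _ => 0) hψ hψ0 measurable_const
      (memLp_const 0) (by simp) hNtop hr hθXY (h1.congr fun p => ?_) ?_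
    · have h2 : ∀ D : RePPI.Dataset (𝒳 × 𝒲), RePPI.avg D (fun _ => (0 : RePPI.Vec d)) = 0 :=
        fun D => by simp [RePPI.avg]
      rw [h2, RePPI.avg_clm, add_zero, sub_zero, map_smul, map_neg, neg_apply, smul_neg,
        sub_neg_eq_add]
    · have h0 : RePPI.crossCov (P.map fun z : 𝒳 × 𝒲 × 𝒴 => (z.1, z.2.1))
          (fun _ => (0 : RePPI.Vec d)) (fun _ => 0) = 0 := by
        ext i j
        exact covariance_const_left _
      rw [h0, smul_zero, add_zero, RePPI.crossCov_clm _ hg, Matrix.transpose_neg,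
        RePPI.transpose_inv_of_posDef hH, RePPI.xyCov]
      simp only [neg_mul, mul_neg, neg_neg]
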